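/- Let $M$ be a complex manifold, $p_\lambda:\mathbb{P}^1_\lambda\times M\to M$ the projection and $j_\lambda(\lambda,t)=(-\lambda,t)$. A trTLE-structure on $M$ is a pair $(\mathcal H,\nabla)$ of a holomorphic vector bundle $\mathcal H$ on $\mathbb{P}^1_\lambda\times M$ for which $p_\lambda^*p_{\lambda*}\mathcal H\to\mathcal H$ is an isomorphism, and a flat meromorphic connection $\nabla:\mathcal H\to\mathcal H\otimes\Omega^1(\log\{0,\infty\}\times M)\otimes\mathcal O(\{0\}\times M)$. For $k\in\mathbb Z$, a trTLEP$(k)$-structure is a trTLE-structure with a $\nabla$-flat pairing $P:\mathcal H\otimes j_\lambda^*\mathcal H\to\lambda^k\mathcal O:=\mathcal O(-k\{0\}\times M+k\{\infty\}\times M)$ that is $(-1)^k$-symmetric ($j_\lambda^*P=(-1)^kP\circ\sigma$, where $\sigma$ exchanges the factors) and non-degenerate ($\lambda^{-k}P$ induces an isomorphism $\mathcal H\to(j_\lambda^*\mathcal H)^\vee$). A mixed trTLEP-structure is a tuple $(\mathcal G,\nabla,W,Q)$ consisting of a trTLE-structure $(\mathcal G,\nabla)$, an increasing exhaustive filtration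 $W=(W_k)_{k\in\mathbb Z}$ of $\mathcal G$ by $\nabla$-flat subbundles whose graded pieces $\mathrm{Gr}^W_k=W_k/W_{k-1}$ are trTLE-structures with the induced connections, and pairings $Q_k$ such that $(\mathrm{Gr}^W_k,\nabla,Q_k)$ is a trTLEP$(-k)$-structure for every $k\in\mathbb Z$. Let $(\mathcal H,\nabla,P)$ be a trTLEP$(0)$-structure on $M$, and let $\mathfrak N$ be a nilpotent endomorphism of $\mathcal H$ with $$[\nabla,\mathfrak N]=\mathfrak N\,\frac{\mathrm d\lambda}{\lambda},\qquad \mathfrak N=p_\lambda^*(\mathfrak N|_{\lambda=0}),\qquad P(\mathfrak Na,b)=P(a,\mathfrak Nb).$$ Then $\mathcal G:=\mathrm{Coker}\,\mathfrak N$ is a holomorphic vector bundle, and $\nabla$ induces a flat meromorphic connection $\overline\nabla$ on $\mathcal G$. Put $W_k:=0$ for $k<0$ and $W_k:=\mathrm{Im}\big(\mathrm{Ker}(\mathfrak N^{k+1})\to\mathcal G\big)$ for $k\ge0$. The pairings $Q_k:\mathrm{Gr}^W_k\mathcal G\otimes j_\lambda^*\mathrm{Gr}^W_k\mathcal G\to\lambda^{-k}\mathcal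 O$ given by $Q_k:=0$ for $k<0$ and $Q_k([a],[b]):=P(\lambda^{-k}\mathfrak N^ka,b)$ for $k\ge0$, where $a$ and $b$ are local sections of $\mathrm{Ker}(\mathfrak N^{k+1})$ and of $j_\lambda^*\mathrm{Ker}(\mathfrak N^{k+1})$, are well defined, and $(\mathcal G,\overline\nabla,W,Q)$ is a mixed trTLEP-structure on $M$. -/

import Mathlib

open Set Filter Topology Manifold
open scoped ContDiff

noncomputable section

namespace TrTLE

/-! ### The complex projective line -/

/-- The projective line with non-homogeneous coordinate `λ`, as the Riemann sphere ℂ with one point added. -/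
abbrev PLine : Type := OnePoint ℂ

/-- The coordinate `λ` on `ℂ` (its value at infinity is irrelevant). -/
def lam (x : PLine) : ℂ := x.elim 0 id

/-- The involution `λ ↦ -λ`, fixing infinity. -/
def negP (x : PLine) : PLine := OnePoint.map (fun z : ℂ => -z) x

/-- The involution `λ ↦ 1 / λ`, exchanging zero and infinity. -/
def invP (x : PLine) : PLine :=
  x.elim ((0 : ℂ) : PLine) (fun z => if z = 0 then .infty else ((z⁻¹ : ℂ) : PLine))

@[simp] lemma lam_coe (z : ℂ) : lam (z : PLine) = z := rfl

@[simp] lemma negP_coe (z : ℂ) : negP (z : PLine) = ((-z : ℂ) : PLine) := rfl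

@[simp] lemma negP_infty : negP .infty = (.infty : PLine) := rfl

@[simp] lemma invP_infty : invP .infty = ((0 : ℂ) : PLine) := rfl

lemma invP_coe (z : ℂ) : invP (z : PLine) = if z = 0 then .infty else ((z⁻¹ : ℂ) : PLine) := rfl

@[simp] lemma invP_zero : invP ((0 : ℂ) : PLine) = .infty := by simp [invP_coe]

lemma invP_coe_of_ne {z : ℂ} (hz : z ≠ 0) : invP (z : PLine) = ((z⁻¹ : ℂ) : PLine) := by
  simp [invP_coe, hz]

lemma invP_invP (x : PLine) : invP (invP x) = x := by
  induction x using OnePoint.rec with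
  | infty => simp
  | coe z =>
    by_cases hz : z = 0
    · subst hz; simp
    · rw [invP_coe_of_ne hz, invP_coe_of_ne (inv_ne_zero hz), inv_inv]

lemma continuous_invP : Continuous invP := by
  rw [continuous_iff_continuousAt]
  intro x
  induction x using OnePoint.rec with
  | infty =>
    rw [OnePoint.continuousAt_infty', coclosedCompact_eq_cocompact, ← Metric.cobounded_eq_cocompact, invP_infty]
    have h1 : Tendsto (fun z : ℂ => ((z⁻¹ : ℂ) : PLine)) (Bornology.cobounded ℂ)
        (𝓝 ((0 : ℂ) : PLine)) :=
      (OnePoint.continuous_coe.tendsto (0 : ℂ)).comp tendsto_inv₀_cobounded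
    refine h1.congr' ?_
    have h2 : ∀ᶠ z : ℂ in Bornology.cobounded ℂ, z ≠ 0 := 
      Bornology.isBounded_def.1 (Bornology.isBounded_singleton (x := (0 : ℂ)))
    filter_upwards [h2] with z hz
    simp [invP_coe_of_ne hz]
  | coe z =>
    rw [OnePoint.continuousAt_coe]
    by_cases hz : z = 0
    · subst hz
      rw [continuousAt_iff_punctured_nhds]
      have h1 : Tendsto (fun w : ℂ => ((w⁻¹ : ℂ) : PLine)) (𝓝[≠] 0) (𝓝 (.infty : PLine)) := by
        refine OnePoint.tendsto_coe_infty.comp ?_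
        rw [coclosedCompact_eq_cocompact, ← Metric.cobounded_eq_cocompact]
        exact tendsto_inv₀_nhdsNE_zero
      simp only [Function.comp_apply, invP_zero]
      refine h1.congr' ?_
      filter_upwards [self_mem_nhdsWithin] with w hw
      simp [invP_coe_of_ne hw]
    · have h1 : ContinuousAt (fun w : ℂ => ((w⁻¹ : ℂ) : PLine)) z :=
        OnePoint.continuous_coe.continuousAt.comp (continuousAt_inv₀ hz)
      refine h1.congr ?_
      filter_upwards [isOpen_ne.mem_nhds hz] with w hw
      simp [invP_coe_of_ne hw]

/-- `λ ↦ 1 / λ` as a homeomorphism. -/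
def invHomeo : PLine ≃ₜ PLine where
  toFun := invP
  invFun := invP
  left_inv := invP_invP
  right_inv := invP_invP
  continuous_toFun := continuous_invP
  continuous_invFun := continuous_invP

/-- The chart `λ` on the complement of infinity. -/
def chartZero : OpenPartialHomeomorph PLine ℂ :=
  ((OnePoint.isOpenEmbedding_coe (X := ℂ)).toOpenPartialHomeomorph (fun z : ℂ => (z : PLine))).symm

/-- The chart `1 / λ` on the complement of `0`. -/
def chartInfty : OpenPartialHomeomorph PLine ℂ :=
  invHomeo.toOpenPartialHomeomorph.trans chartZero

open Classical in
/-- The standard atlas of the projective line. -/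
instance : ChartedSpace ℂ PLine where
  atlas := {chartZero, chartInfty}
  chartAt x := if x = .infty then chartInfty else chartZero
  mem_chart_source x := by
    induction x using OnePoint.rec with
    | infty => simp [chartInfty, chartZero, invHomeo]
    | coe z => simp [chartZero]
  chart_mem_atlas x := by
    by_cases h : x = .infty <;> simp [h]

lemma chartZero_source : chartZero.source = range ((↑) : ℂ → PLine) := by
  simp [chartZero]

lemma chartZero_coe (z : ℂ) : chartZero (z : PLine) = z :=
  (OnePoint.isOpenEmbedding_coe (X := ℂ)).toOpenPartialHomeomorph_left_inv

lemma chartZero_symm_apply (z : ℂ) : chartZero.symm z = (z : PLine) := rfl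

lemma chartInfty_apply (x : PLine) : chartInfty x = chartZero (invP x) := rfl

lemma chartInfty_symm_apply (z : ℂ) : chartInfty.symm z = invP (z : PLine) := rfl

/-- The projective line is a complex manifold. -/
instance : IsManifold 𝓘(ℂ, ℂ) ω PLine := by
  apply isManifold_of_contDiffOn
  have key : ContDiffOn ℂ ω (fun z : ℂ => z⁻¹) {z | z ≠ 0} := contDiffOn_inv ℂ
  have hz : ∀ z : ℂ, invP (z : PLine) ∈ chartZero.source → z ≠ 0 := by
    rintro z hz rfl
    simp [chartZero_source] at hz
  rintro e e' (rfl | rfl) (rfl | rfl)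
  · refine contDiffOn_id.congr fun z _ => ?_
    simp [chartZero_symm_apply, chartZero_coe]
  · have hs : ∀ z ∈ 𝓘(ℂ, ℂ).symm ⁻¹' (chartZero.symm ≫ₕ chartInfty).source ∩ range 𝓘(ℂ, ℂ),
        z ≠ 0 := by
      intro z h
      exact hz z (by simpa [chartInfty, chartZero_symm_apply, invHomeo] using h.1.2)
    refine (key.mono hs).congr fun z h => ?_
    simp [chartZero_symm_apply, chartInfty_apply, invP_coe_of_ne (hs z h), chartZero_coe]
  · have hs : ∀ z ∈ 𝓘(ℂ, ℂ).symm ⁻¹' (chartInfty.symm ≫ₕ chartZero).source ∩ range 𝓘(ℂ, ℂ),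
        z ≠ 0 := by
      intro z h
      exact hz z (by simpa [chartInfty_symm_apply] using h.1.2)
    refine (key.mono hs).congr fun z h => ?_
    simp [chartInfty_symm_apply, invP_coe_of_ne (hs z h), chartZero_coe]
  · refine contDiffOn_id.congr fun z _ => ?_
    simp [chartInfty_symm_apply, chartInfty_apply, invP_invP, chartZero_coe]

/-! ### Functions and vector fields on `PLine × M` -/

section Fields

variable (E : Type*) [NormedAddCommGroup E] [NormedSpace ℂ E]
  {M : Type*} [TopologicalSpace M] [ChartedSpace E M] [IsManifold 𝓘(ℂ, E) ω M]

/-- The model with corners of the complex manifold `PLine × M`. -/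
abbrev model : ModelWithCorners ℂ (ℂ × E) (ModelProd ℂ E) := 𝓘(ℂ, ℂ).prod 𝓘(ℂ, E)

/-- The involution `j(λ, t) = (-λ, t)`. -/
def negX (x : PLine × M) : PLine × M := (negP x.1, x.2)

/-- `f` is holomorphic in a neighbourhood of `x`. -/
def HolFunAt (f : PLine × M → ℂ) (x : PLine × M) : Prop :=
  ContMDiffAt (model E) 𝓘(ℂ, ℂ) ω f x

variable (M) in
/-- Vector fields on `PLine × M` (not necessarily holomorphic). -/
abbrev VField : Type _ := (x : PLine × M) → TangentSpace (model E) x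

variable {E}

/-- `v` is holomorphic in a neighbourhood of `x`. -/
def HolFieldAt (v : VField E M) (x : PLine × M) : Prop :=
  ContMDiffAt (model E) (model E).tangent ω
    (fun y => (⟨y, v y⟩ : TangentBundle (model E) (PLine × M))) x

/-- The derivative `v(f)` of a function at a point. -/
def applyField (v : VField E M) (f : PLine × M → ℂ) (x : PLine × M) : ℂ :=
  mfderiv (model E) 𝓘(ℂ, ℂ) f x (v x)

/-- `v` is, near `x`, a holomorphic vector field tangent to `{0, infinity} × M`, that is a section
of the dual of the sheaf of 1-forms with logarithmic poles along `{0, infinity} × M`. -/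
def LogFieldAt (v : VField E M) (x : PLine × M) : Prop :=
  HolFieldAt v x ∧ ∀ᶠ y in 𝓝 x, (y.1 = ((0 : ℂ) : PLine) ∨ y.1 = .infty) →
    mfderiv (model E) 𝓘(ℂ, ℂ) (Prod.fst : PLine × M → PLine) y (v y) = 0

/-- `v` is, near `x`, a section of `Θ(-log {0, infinity} × M) ⊗ O(-{0} × M)`: a logarithmic field
which away from infinity is `λ` times a logarithmic field. This sheaf is the dual of
`Ω¹(log {0, infinity} × M) ⊗ O({0} × M)`. -/
def PoleFieldAt (v : VField E M) (x : PLine × M) : Prop :=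
  LogFieldAt v x ∧
    (x.1 ≠ .infty → ∃ w : VField E M, LogFieldAt w x ∧ ∀ᶠ y in 𝓝 x, v y = lam y.1 • w y)

/-- The function `(dλ / λ)(v)`, at points with `λ ≠ 0, infinity`. -/
def dlog (v : VField E M) (x : PLine × M) : ℂ := applyField v (fun y => lam y.1) x / lam x.1

end Fields

/-! ### Holomorphic vector bundles -/

/-- A family of complex vector spaces over `X`, together with a class of sections, called the
holomorphic ones, which is given by its germs: `HolAt s x` means that `s` is holomorphic in a
neighbourhood of `x`. -/
structure HolFamily (X : Type*) where
  fiber : X → Type*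
  [addCommGroup : ∀ x, AddCommGroup (fiber x)]
  [module : ∀ x, Module ℂ (fiber x)]
  HolAt : (∀ x, fiber x) → X → Prop

attribute [instance] HolFamily.addCommGroup HolFamily.module

namespace HolFamily

section Constructions

variable {X : Type*} [TopologicalSpace X]

/-- Sections of a family (not necessarily holomorphic). -/
abbrev Sec (H : HolFamily X) : Type _ := (x : X) → H.fiber x

/-- The subfamily given by subspaces of the fibres; its holomorphic sections are the holomorphic
sections of `H` with values in these subspaces. -/
def sub (H : HolFamily X) (W : ∀ x, Submodule ℂ (H.fiber x)) : HolFamily X where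
  fiber x := W x
  HolAt s x := H.HolAt (fun y => (s y : H.fiber y)) x

/-- The quotient family; its holomorphic sections are those which locally lift to holomorphic
sections of `H`. -/
def quot (H : HolFamily X) (W : ∀ x, Submodule ℂ (H.fiber x)) : HolFamily X where
  fiber x := H.fiber x ⧸ W x
  HolAt σ x := ∃ s : H.Sec, H.HolAt s x ∧ ∀ᶠ y in 𝓝 x, σ y = (W y).mkQ (s y)

end Constructions

variable (E : Type*) [NormedAddCommGroup E] [NormedSpace ℂ E]
  {M : Type*} [TopologicalSpace M] [ChartedSpace E M]

/-- The sections `e` form a holomorphic frame of `H` in a neighbourhood of `x`: they are a basis of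
each fibre, and the holomorphic sections are the combinations with holomorphic coefficients. -/
def IsFrameAt (H : HolFamily (PLine × M)) {n : ℕ} (e : Fin n → H.Sec) (x : PLine × M) : Prop :=
  ∀ᶠ y in 𝓝 x,
    (LinearIndependent ℂ (fun i => e i y) ∧ Submodule.span ℂ (range fun i => e i y) = ⊤) ∧
    ∀ s : H.Sec, H.HolAt s y ↔
      ∃ f : Fin n → PLine × M → ℂ, (∀ i, HolFunAt E (f i) y) ∧
        ∀ᶠ z in 𝓝 y, s z = ∑ i, f i z • e i z

/-- Holomorphic vector bundles of finite rank: there are local holomorphic frames. -/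
def IsBundle (H : HolFamily (PLine × M)) : Prop :=
  ∀ x, ∃ (n : ℕ) (e : Fin n → H.Sec), H.IsFrameAt E e x

/-- The bundle is trivial along the projective line: locally on `M` it has a frame over
`PLine × V`, that is, it is the pull-back of a bundle on `M` (of its own direct image). -/
def IsTrivialAlong (H : HolFamily (PLine × M)) : Prop :=
  ∀ t : M, ∃ (n : ℕ) (e : Fin n → H.Sec), ∀ l : PLine, H.IsFrameAt E e (l, t)

/-- Holomorphic subbundles: locally there is a frame of `H` part of which spans `W`. -/
def IsSubbundle (H : HolFamily (PLine × M)) (W : ∀ x, Submodule ℂ (H.fiber x)) : Prop :=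
  ∀ x, ∃ (n : ℕ) (e : Fin n → H.Sec) (S : Set (Fin n)), H.IsFrameAt E e x ∧
    ∀ᶠ y in 𝓝 x, W y = Submodule.span ℂ ((fun i => e i y) '' S)

end HolFamily

/-! ### Connections, pairings, trTLE- and trTLEP-structures -/

section Structures

variable {E : Type*} [NormedAddCommGroup E] [NormedSpace ℂ E]
  {M : Type*} [TopologicalSpace M] [ChartedSpace E M] [IsManifold 𝓘(ℂ, E) ω M]

/-- The type of `(v, s) ↦ ∇_v s`; only its values on holomorphic sections `s` and on fields `v` as
in `PoleFieldAt` are relevant. -/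
abbrev Conn (E : Type*) [NormedAddCommGroup E] [NormedSpace ℂ E]
    {M : Type*} [TopologicalSpace M] [ChartedSpace E M] (H : HolFamily (PLine × M)) : Type _ :=
  VField E M → H.Sec → H.Sec

/-- `D` is a flat meromorphic connection
`∇ : H → H ⊗ Ω¹(log {0, infinity} × M) ⊗ O({0} × M)`, given by the contractions `∇_v s` with the
sections `v` of the dual of `Ω¹(log {0, infinity} × M) ⊗ O({0} × M)`. -/
structure IsFlatConn (H : HolFamily (PLine × M)) (D : Conn E H) : Prop where
  hol : ∀ x v s, PoleFieldAt v x → H.HolAt s x → H.HolAt (D v s) x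
  congr : ∀ x v v' s s', PoleFieldAt v x → H.HolAt s x → (∀ᶠ y in 𝓝 x, v y = v' y) →
    (∀ᶠ y in 𝓝 x, s y = s' y) → D v s x = D v' s' x
  add_field : ∀ x v v' s, PoleFieldAt v x → PoleFieldAt v' x → H.HolAt s x →
    D (fun y => v y + v' y) s x = D v s x + D v' s x
  smul_field : ∀ x v f s, PoleFieldAt v x → HolFunAt E f x → H.HolAt s x →
    D (fun y => f y • v y) s x = f x • D v s x
  add_sec : ∀ x v s s', PoleFieldAt v x → H.HolAt s x → H.HolAt s' x →
    D v (fun y => s y + s' y) x = D v s x + D v s' x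
  leibniz : ∀ x v f s, PoleFieldAt v x → HolFunAt E f x → H.HolAt s x →
    D v (fun y => f y • s y) x = applyField v f x • s x + f x • D v s x
  /-- The curvature vanishes; `w` is the bracket of `v` and `v'`. -/
  flat : ∀ x v v' w s, PoleFieldAt v x → PoleFieldAt v' x → PoleFieldAt w x → H.HolAt s x →
    (∀ᶠ y in 𝓝 x, w y = VectorField.mlieBracket (model E) v v' y) →
    D v (D v' s) x - D v' (D v s) x = D w s x

/-- trTLE-structures on `M`. -/
structure IsTrTLE (H : HolFamily (PLine × M)) (D : Conn E H) : Prop where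
  bundle : H.IsBundle E
  trivial : H.IsTrivialAlong E
  conn : IsFlatConn H D

/-- The type of a pairing `P : H ⊗ j^* H → λ^k O`, written as `P = λ^k B` (the sheaf
`λ^k O = O(-k {0} × M + k {infinity} × M)` is generated by `λ^k`): `B` is given by the bilinear maps
`B x (j x) : H_x × H_{j x} → ℂ`. The values `B x y` for `y ≠ j x` are irrelevant. -/
abbrev Pairing (H : HolFamily (PLine × M)) : Type _ :=
  ∀ x y : PLine × M, H.fiber x →ₗ[ℂ] H.fiber y →ₗ[ℂ] ℂ

/-- The value of the pairing `P = λ^k B`, at points with `λ ≠ 0, infinity`. -/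
def Pairing.val {H : HolFamily (PLine × M)} (B : Pairing H) (k : ℤ) (x y : PLine × M)
    (a : H.fiber x) (b : H.fiber y) : ℂ :=
  lam x.1 ^ k * B x y a b

/-- `(H, D, P)` with `P = λ^k B` is a trTLEP(k)-structure on `M`. Flatness and symmetry are
conditions on `P`; by continuity it suffices to impose them for `λ ≠ 0, infinity`. -/
structure IsTrTLEP (k : ℤ) (H : HolFamily (PLine × M)) (D : Conn E H) (B : Pairing H) : Prop where
  trTLE : IsTrTLE H D
  hol : ∀ x a b, H.HolAt a x → H.HolAt b (negX x) →
    HolFunAt E (fun y => B y (negX y) (a y) (b (negX y))) x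
  /-- `v (P (a, b)) = P (∇_v a, b) + P (a, ∇_w b)`, where `w = j_* v`. -/
  flat : ∀ (x : PLine × M) (v w : VField E M) (a b : H.Sec),
    x.1 ≠ ((0 : ℂ) : PLine) → x.1 ≠ .infty →
    PoleFieldAt v x → PoleFieldAt w (negX x) →
    (∀ᶠ y in 𝓝 x, w (negX y) = mfderiv (model E) (model E) negX y (v y)) →
    H.HolAt a x → H.HolAt b (negX x) →
    applyField v (fun y => B.val k y (negX y) (a y) (b (negX y))) x =
      B.val k x (negX x) (D v a x) (b (negX x)) + B.val k x (negX x) (a x) (D w b (negX x))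
  symm : ∀ (x y : PLine × M), y = negX x → x.1 ≠ ((0 : ℂ) : PLine) → x.1 ≠ .infty →
    ∀ (a : H.fiber x) (b : H.fiber y), B.val k y x b a = (-1) ^ k * B.val k x y a b
  nondegenerate : ∀ x, Function.Bijective (B x (negX x))

/-! ### Filtered and mixed structures -/

/-- The graded piece `W_k / W_{k-1}`. -/
def gr (H : HolFamily (PLine × M)) (W : ℤ → ∀ x, Submodule ℂ (H.fiber x)) (k : ℤ) :
    HolFamily (PLine × M) :=
  (H.sub (W k)).quot (fun x => (W (k - 1) x).submoduleOf (W k x))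

/-- The class in the graded piece of a vector of `W_k`. -/
def grMk {H : HolFamily (PLine × M)} (W : ℤ → ∀ x, Submodule ℂ (H.fiber x)) (k : ℤ)
    {x : PLine × M} (a : W k x) : (gr H W k).fiber x :=
  ((W (k - 1) x).submoduleOf (W k x)).mkQ a

/-- `W` is preserved by the connection. -/
def IsFlatSub (H : HolFamily (PLine × M)) (D : Conn E H)
    (W : ∀ x, Submodule ℂ (H.fiber x)) : Prop :=
  ∀ x v s, PoleFieldAt v x → H.HolAt s x → (∀ᶠ y in 𝓝 x, s y ∈ W y) → D v s x ∈ W x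

/-- `D'` is the connection induced by `D` on the quotient of `H` by `W`. -/
def InducedOnQuot (H : HolFamily (PLine × M)) (D : Conn E H)
    (W : ∀ x, Submodule ℂ (H.fiber x)) (D' : Conn E (H.quot W)) : Prop :=
  ∀ x v (s : H.Sec), PoleFieldAt v x → H.HolAt s x →
    D' v (fun y => (W y).mkQ (s y)) x = (W x).mkQ (D v s x)

/-- `D'` is the connection induced by `D` on `W_k / W_{k-1}`. -/
def InducedOnGr (H : HolFamily (PLine × M)) (D : Conn E H)
    (W : ℤ → ∀ x, Submodule ℂ (H.fiber x)) (k : ℤ) (D' : Conn E (gr H W k)) : Prop :=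
  ∀ x v (s : (y : PLine × M) → W k y), PoleFieldAt v x → H.HolAt (fun y => (s y : H.fiber y)) x →
    ∃ h : D v (fun y => (s y : H.fiber y)) x ∈ W k x,
      D' v (fun y => grMk W k (s y)) x = grMk W k ⟨D v (fun y => (s y : H.fiber y)) x, h⟩

/-- `(H, D, W)` is a filtered trTLE-structure: `W` is an increasing exhaustive filtration by flat
subbundles whose graded pieces are trTLE-structures with the induced connection. -/
structure IsFiltered (H : HolFamily (PLine × M)) (D : Conn E H)
    (W : ℤ → ∀ x, Submodule ℂ (H.fiber x)) : Prop where
  trTLE : IsTrTLE H D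
  mono : ∀ x, Monotone fun k => W k x
  exhaustive : ∀ x, ∀ a : H.fiber x, ∃ k, a ∈ W k x
  subbundle : ∀ k, H.IsSubbundle E (W k)
  flat : ∀ k, IsFlatSub H D (W k)
  graded : ∀ k, ∃ D' : Conn E (gr H W k), InducedOnGr H D W k D' ∧ IsTrTLE (gr H W k) D'

/-- `(H, D, W, (Q_k)_k)` is a mixed trTLEP-structure: `(H, D, W)` is a filtered trTLE-structure, and
with `Q_k = λ^(-k) B_k` the graded piece of weight `k` is a trTLEP(-k)-structure. -/
structure IsMixed (H : HolFamily (PLine × M)) (D : Conn E H)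
    (W : ℤ → ∀ x, Submodule ℂ (H.fiber x)) (B : ∀ k : ℤ, Pairing (gr H W k)) : Prop where
  filtered : IsFiltered H D W
  graded : ∀ k, ∃ D' : Conn E (gr H W k),
    InducedOnGr H D W k D' ∧ IsTrTLEP (-k) (gr H W k) D' (B k)

/-! ### The data given by a nilpotent endomorphism -/

/-- `N` is a holomorphic, nilpotent endomorphism of `H` with
`[∇, N] = N dλ / λ`, `N = p^* (N|_{λ = 0})` and `P (N a, b) = P (a, N b)`.
Nilpotency is imposed on each fibre, which is the same as `N ^ n = 0` for some `n` if the rank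
of `H` is bounded. -/
structure IsNilpotentData (H : HolFamily (PLine × M)) (D : Conn E H) (P : Pairing H)
    (N : ∀ x, Module.End ℂ (H.fiber x)) : Prop where
  hol : ∀ x s, H.HolAt s x → H.HolAt (fun y => N y (s y)) x
  nilpotent : ∀ x, IsNilpotent (N x)
  flat : ∀ x v s, x.1 ≠ ((0 : ℂ) : PLine) → x.1 ≠ .infty → PoleFieldAt v x → H.HolAt s x →
    D v (fun y => N y (s y)) x - N x (D v s x) = dlog v x • N x (s x)
  /-- The fibres over `(0, t)` and `(l, t)` are identified by the values of sections over
  neighbourhoods of `PLine × {t}`; under this identification `N` does not depend on `l`. -/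
  const : ∀ (t : M) (a b : H.Sec), (∀ l : PLine, H.HolAt a (l, t) ∧ H.HolAt b (l, t)) →
    N (((0 : ℂ) : PLine), t) (a (((0 : ℂ) : PLine), t)) = b (((0 : ℂ) : PLine), t) →
    ∀ l : PLine, N (l, t) (a (l, t)) = b (l, t)
  selfAdjoint : ∀ x a b, P x (negX x) (N x a) b = P x (negX x) a (N (negX x) b)

/-- The cokernel of `N`. -/
def coker (H : HolFamily (PLine × M)) (N : ∀ x, Module.End ℂ (H.fiber x)) :
    HolFamily (PLine × M) :=
  H.quot fun x => LinearMap.range (N x)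

/-- The class in the cokernel of `N`. -/
def cokerMk (H : HolFamily (PLine × M)) (N : ∀ x, Module.End ℂ (H.fiber x)) (x : PLine × M) :
    H.fiber x →ₗ[ℂ] (coker H N).fiber x :=
  (LinearMap.range (N x)).mkQ

/-- The weight filtration of the cokernel: `W_k` is zero for `k < 0`, and the image of
`Ker N^(k+1)` for `k ≥ 0`. -/
def weight (H : HolFamily (PLine × M)) (N : ∀ x, Module.End ℂ (H.fiber x)) (k : ℤ)
    (x : PLine × M) : Submodule ℂ ((coker H N).fiber x) :=
  if k < 0 then ⊥ else (LinearMap.ker (N x ^ (k.toNat + 1))).map (cokerMk H N x)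

end Structures

end TrTLE

end

noncomputable section

namespace TrTLE

/-! ### Holomorphic functions on `PLine × M` -/

section HolomorphicFunctions

variable {E : Type*} [NormedAddCommGroup E] [NormedSpace ℂ E]
  {M : Type*} [TopologicalSpace M] [ChartedSpace E M]

/-! Everything rests on one fact: near each `PLine × {t₀}` there is a holomorphic frame in which `N`
is a constant Jordan matrix (`IsNilpotentData.exists_jordan_frame`). In a frame over `PLine × V` the
matrix `A` of `N` depends on `t ∈ V` only. Along a field tangent to `M` the form `dλ / λ` vanishes,
so `N` commutes with `∇`, and this reads `∂ A = [A, Γ]` with `Γ` the connection matrix on the slice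
`λ = 1`.

Such a family has locally constant Jordan type, and no differential equation has to be solved to see
it. Each power `B = A ^ m` satisfies the same equation. If `g` is a generalized inverse of `B z₀`,
then `F = B (1 + g (B - B z₀))⁻¹ (1 - g B z₀)` satisfies a homogeneous linear equation and vanishes
at `z₀`, hence near `z₀` (`mul_inverse_eq_zero_of_fderiv_eq_commutator`). So `(1 + g (B - B z₀))⁻¹`
moves the kernel of `A z₀ ^ m` holomorphically into that of `A z ^ m`. Moving the heads of the
Jordan chains at `z₀` in this way yields a holomorphic Jordan basis
(`exists_holomorphic_jordan_basis`).

In a Jordan frame the image of `N` is spanned by the vectors that are not heads of chains, so the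
heads give a frame of the cokernel, and `W_k` is spanned by the classes of the heads of chains of
length at most `k + 1` (`JordanFrameOn.weight_eq`). Local freeness, triviality along the projective
line, the subbundle property and local lifting of sections follow. Flatness of the image and of
`W_k` comes from `[∇, N ^ m] = m N ^ m dλ / λ` off `{0, infinity} × M` and extends by continuity
(`isFlatSub_of_regular`).

For the pairings, the kernel of `Ker N ^ (k+1) → Gr_k` consists of the sums of a vector of `Ker N ^
k` and one of `Im N`. Self-adjointness makes `P (N ^ k a, b)` vanish on it in either argument, and
`(Ker N ^ m)^⊥ = Im N ^ m` gives non-degeneracy (`IsNilpotentData.natGrPairing_bijective`). The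
factor `λ ^ (-k)` has two effects: its derivative cancels the term `k N ^ k dλ / λ`, and `λ ↦ -λ`
produces the sign `(-1) ^ k`. -/

lemma HolFunAt.add {f g : PLine × M → ℂ} {x : PLine × M} (hf : HolFunAt E f x)
    (hg : HolFunAt E g x) : HolFunAt E (fun y => f y + g y) x :=
  ContMDiffAt.add hf hg

lemma HolFunAt.mul {f g : PLine × M → ℂ} {x : PLine × M} (hf : HolFunAt E f x)
    (hg : HolFunAt E g x) : HolFunAt E (fun y => f y * g y) x :=
  ContMDiffAt.mul hf hg

lemma HolFunAt.inv {f : PLine × M → ℂ} {x : PLine × M} (hf : HolFunAt E f x)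
    (hx : f x ≠ 0) : HolFunAt E (fun y => (f y)⁻¹) x :=
  ContMDiffAt.inv₀ hf hx

lemma holFunAt_const (c : ℂ) (x : PLine × M) : HolFunAt E (fun _ => c) x := contMDiffAt_const

lemma HolFunAt.sum {ι : Type*} {s : Finset ι} {f : ι → PLine × M → ℂ} {x : PLine × M}
    (hf : ∀ i ∈ s, HolFunAt E (f i) x) : HolFunAt E (fun y => ∑ i ∈ s, f i y) x :=
  contMDiffAt_finsetSum hf

lemma HolFunAt.congr {f g : PLine × M → ℂ} {x : PLine × M} (hf : HolFunAt E f x)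
    (h : ∀ᶠ y in 𝓝 x, g y = f y) : HolFunAt E g x :=
  ContMDiffAt.congr_of_eventuallyEq hf h

lemma HolFunAt.continuousAt {f : PLine × M → ℂ} {x : PLine × M} (hf : HolFunAt E f x) :
    ContinuousAt f x :=
  ContMDiffAt.continuousAt hf

lemma HolFunAt.mdifferentiableAt {f : PLine × M → ℂ} {x : PLine × M} (hf : HolFunAt E f x) :
    MDifferentiableAt (model E) 𝓘(ℂ, ℂ) f x :=
  ContMDiffAt.mdifferentiableAt hf (by simp)

lemma HolFunAt.eventually [IsManifold 𝓘(ℂ, E) ω M] {f : PLine × M → ℂ} {x : PLine × M}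
    (hf : HolFunAt E f x) : ∀ᶠ y in 𝓝 x, HolFunAt E f y :=
  (contMDiffAt_iff_contMDiffAt_nhds (by simp)).1 hf

lemma contMDiffAt_lam (z : ℂ) : ContMDiffAt 𝓘(ℂ, ℂ) 𝓘(ℂ, ℂ) ω lam (z : PLine) := by
  have h : ContMDiffAt 𝓘(ℂ, ℂ) 𝓘(ℂ, ℂ) ω (chartAt ℂ (z : PLine)) (z : PLine) :=
    contMDiffAt_of_mem_maximalAtlas (IsManifold.chart_mem_maximalAtlas _) (mem_chart_source _ _)
  have hc : chartAt ℂ (z : PLine) = chartZero := if_neg (OnePoint.coe_ne_infty z)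
  rw [hc] at h
  refine h.congr_of_eventuallyEq ?_
  filter_upwards [OnePoint.isOpenEmbedding_coe.isOpen_range.mem_nhds (mem_range_self z)]
  rintro _ ⟨w, rfl⟩
  rw [chartZero_coe, lam_coe]

lemma holFunAt_lam {x : PLine × M} (hx : x.1 ≠ .infty) :
    HolFunAt E (fun y => lam y.1) x := by
  obtain ⟨l, t⟩ := x
  induction l using OnePoint.rec with
  | infty => exact absurd rfl hx
  | coe z =>
    exact ContMDiffAt.comp (f := Prod.fst) (g := lam) (((z : PLine), t) : PLine × M)
      (contMDiffAt_lam z) contMDiffAt_fst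

lemma lam_ne_zero {l : PLine} (h0 : l ≠ ((0 : ℂ) : PLine)) (h1 : l ≠ .infty) : lam l ≠ 0 := by
  induction l using OnePoint.rec with
  | infty => exact absurd rfl h1
  | coe z => rintro h; exact h0 (by rw [lam_coe] at h; rw [h])

lemma lam_negP {l : PLine} (h1 : l ≠ .infty) : lam (negP l) = - lam l := by
  induction l using OnePoint.rec with
  | infty => exact absurd rfl h1
  | coe z => simp

lemma negP_negP (l : PLine) : negP (negP l) = l := by
  induction l using OnePoint.rec with
  | infty => simp
  | coe z => simp

lemma continuous_negP : Continuous negP :=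
  OnePoint.continuous_map continuous_neg (by
    have := (Homeomorph.neg ℂ).isClosedEmbedding.tendsto_cocompact
    simpa [coclosedCompact_eq_cocompact] using this)

lemma negX_negX {M : Type*} (x : PLine × M) : negX (negX x) = x := by simp [negX, negP_negP]

lemma continuous_negX : Continuous (negX : PLine × M → PLine × M) :=
  (continuous_negP.comp continuous_fst).prodMk continuous_snd

lemma negP_ne_zero {l : PLine} (h : l ≠ ((0 : ℂ) : PLine)) : negP l ≠ ((0 : ℂ) : PLine) := by
  intro h'
  apply h
  rw [← negP_negP l, h']
  simp

lemma negP_ne_infty {l : PLine} (h : l ≠ .infty) : negP l ≠ .infty := by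
  intro h'
  apply h
  rw [← negP_negP l, h']
  simp

/-- The complement of `{0, infinity} × M`. -/
def regular (M : Type*) : Set (PLine × M) := {y | y.1 ≠ ((0 : ℂ) : PLine) ∧ y.1 ≠ .infty}

lemma isOpen_regular : IsOpen (regular M) :=
  (isOpen_ne.preimage continuous_fst).inter (isOpen_ne.preimage continuous_fst)

lemma dense_regular : Dense (regular M) := by
  have h : Dense ({((0 : ℂ) : PLine), .infty}ᶜ : Set PLine) := by
    have := (dense_compl_singleton ((0 : ℂ) : PLine)).inter_of_isOpen_left
      (dense_compl_singleton (.infty : PLine)) isOpen_compl_singleton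
    rwa [← compl_union, singleton_union] at this
  have h2 : regular M = ({((0 : ℂ) : PLine), .infty}ᶜ : Set PLine) ×ˢ (univ : Set M) := by
    ext y; simp [regular]
  rw [h2]
  exact h.prod dense_univ

/-- A continuous function vanishing near `x` off `{0, infinity} × M` vanishes at `x`. -/
lemma eq_zero_of_eventually_regular {f : PLine × M → ℂ} {x : PLine × M} (hf : ContinuousAt f x)
    (h : ∀ᶠ y in 𝓝 x, y ∈ regular M → f y = 0) : f x = 0 := by
  have hne : (𝓝[regular M] x).NeBot := mem_closure_iff_nhdsWithin_neBot.1 (dense_regular x)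
  refine tendsto_nhds_unique (hf.mono_left (nhdsWithin_le_nhds (s := regular M))) ?_
  refine tendsto_const_nhds.congr' ?_
  filter_upwards [nhdsWithin_le_nhds h, self_mem_nhdsWithin] with y hy hy'
  exact (hy hy').symm

end HolomorphicFunctions

/-! ### Fields with poles -/

section PoleFields

variable {E : Type*} [NormedAddCommGroup E] [NormedSpace ℂ E]
  {M : Type*} [TopologicalSpace M] [ChartedSpace E M] [IsManifold 𝓘(ℂ, E) ω M]

lemma HolFieldAt.congr {v v' : VField E M} {x : PLine × M} (hv : HolFieldAt v x)
    (h : ∀ᶠ y in 𝓝 x, v y = v' y) : HolFieldAt v' x :=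
  ContMDiffAt.congr_of_eventuallyEq hv (h.mono fun y hy => by simp [hy])

lemma HolFieldAt.eventually {v : VField E M} {x : PLine × M} (hv : HolFieldAt v x) :
    ∀ᶠ y in 𝓝 x, HolFieldAt v y :=
  (contMDiffAt_iff_contMDiffAt_nhds (by simp)).1 hv

lemma HolFieldAt.smul {f : PLine × M → ℂ} {v : VField E M} {x : PLine × M}
    (hv : HolFieldAt v x) (hf : HolFunAt E f x) : HolFieldAt (fun y => f y • v y) x :=
  ContMDiffAt.smul_section hf hv

lemma LogFieldAt.congr {v v' : VField E M} {x : PLine × M} (hv : LogFieldAt v x)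
    (h : ∀ᶠ y in 𝓝 x, v y = v' y) : LogFieldAt v' x := by
  refine ⟨hv.1.congr h, ?_⟩
  filter_upwards [hv.2, h] with y hy h'
  rwa [← h']

lemma LogFieldAt.eventually {v : VField E M} {x : PLine × M} (hv : LogFieldAt v x) :
    ∀ᶠ y in 𝓝 x, LogFieldAt v y := by
  filter_upwards [hv.1.eventually, hv.2.eventually_nhds] with y h1 h2
  exact ⟨h1, h2⟩

lemma HolFieldAt.logFieldAt {v : VField E M} {x : PLine × M} (hv : HolFieldAt v x)
    (hx : x ∈ regular M) : LogFieldAt v x := by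
  refine ⟨hv, ?_⟩
  filter_upwards [isOpen_regular.mem_nhds hx] with y hy h
  exact (h.elim hy.1 hy.2).elim

/-- Off `{0, infinity} × M` the function `λ` is a unit: tangency is an empty condition, and dividing
by `λ` supplies the required logarithmic factor. -/
lemma HolFieldAt.poleFieldAt {v : VField E M} {x : PLine × M} (hv : HolFieldAt v x)
    (hx : x ∈ regular M) : PoleFieldAt v x := by
  refine ⟨hv.logFieldAt hx, fun _ => ⟨fun y => (lam y.1)⁻¹ • v y, ?_, ?_⟩⟩
  · exact (HolFieldAt.smul hv ((holFunAt_lam hx.2).inv (lam_ne_zero hx.1 hx.2))).logFieldAt hx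
  · filter_upwards [isOpen_regular.mem_nhds hx] with y hy
    rw [smul_smul, mul_inv_cancel₀ (lam_ne_zero hy.1 hy.2), one_smul]

lemma PoleFieldAt.congr {v v' : VField E M} {x : PLine × M} (hv : PoleFieldAt v x)
    (h : ∀ᶠ y in 𝓝 x, v y = v' y) : PoleFieldAt v' x := by
  refine ⟨hv.1.congr h, fun hx => ?_⟩
  obtain ⟨w, hw, hw'⟩ := hv.2 hx
  refine ⟨w, hw, ?_⟩
  filter_upwards [hw', h] with y h1 h2
  rw [← h1, h2]

lemma PoleFieldAt.eventually {v : VField E M} {x : PLine × M} (hv : PoleFieldAt v x) :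
    ∀ᶠ y in 𝓝 x, PoleFieldAt v y := by
  by_cases hx : x.1 = .infty
  · have h0 : ∀ᶠ y in 𝓝 x, y.1 ≠ ((0 : ℂ) : PLine) :=
      (isOpen_ne.preimage continuous_fst).mem_nhds (by simp [hx])
    filter_upwards [hv.1.eventually, h0] with y h1 h2
    -- A point near `infinity × M` at which `λ` is finite is regular, so the condition on
    -- divisibility by `λ` is automatic there.
    refine ⟨h1, fun h3 => ((h1.1.poleFieldAt ⟨h2, h3⟩).2 h3)⟩
  · obtain ⟨w, hw, hw'⟩ := hv.2 hx
    filter_upwards [hv.1.eventually, hw.eventually, hw'.eventually_nhds] with y h1 h2 h3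
    exact ⟨h1, fun _ => ⟨w, h2, h3⟩⟩

lemma LogFieldAt.add {v v' : VField E M} {x : PLine × M} (hv : LogFieldAt v x)
    (hv' : LogFieldAt v' x) : LogFieldAt (fun y => v y + v' y) x := by
  refine ⟨ContMDiffAt.add_section hv.1 hv'.1, ?_⟩
  filter_upwards [hv.2, hv'.2] with y h h' hy
  rw [map_add, h hy, h' hy, add_zero]

lemma LogFieldAt.smul {f : PLine × M → ℂ} {v : VField E M} {x : PLine × M}
    (hv : LogFieldAt v x) (hf : HolFunAt E f x) : LogFieldAt (fun y => f y • v y) x := by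
  refine ⟨hv.1.smul hf, ?_⟩
  filter_upwards [hv.2] with y h hy
  rw [map_smul, h hy, smul_zero]

lemma PoleFieldAt.add {v v' : VField E M} {x : PLine × M} (hv : PoleFieldAt v x)
    (hv' : PoleFieldAt v' x) : PoleFieldAt (fun y => v y + v' y) x := by
  refine ⟨hv.1.add hv'.1, fun hx => ?_⟩
  obtain ⟨w, hw, h⟩ := hv.2 hx
  obtain ⟨w', hw', h'⟩ := hv'.2 hx
  refine ⟨_, hw.add hw', ?_⟩
  filter_upwards [h, h'] with y h1 h2
  rw [h1, h2, smul_add]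

lemma PoleFieldAt.smul {f : PLine × M → ℂ} {v : VField E M} {x : PLine × M}
    (hv : PoleFieldAt v x) (hf : HolFunAt E f x) : PoleFieldAt (fun y => f y • v y) x := by
  refine ⟨hv.1.smul hf, fun hx => ?_⟩
  obtain ⟨w, hw, h⟩ := hv.2 hx
  refine ⟨_, hw.smul hf, ?_⟩
  filter_upwards [h] with y h1
  rw [h1, smul_comm]

end PoleFields

/-! ### Frames over open sets -/

namespace HolFamily

variable (E : Type*) [NormedAddCommGroup E] [NormedSpace ℂ E]
  {M : Type*} [TopologicalSpace M] [ChartedSpace E M]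

/-- The sections `e` form a holomorphic frame of `H` over the open set `U`. -/
structure FrameOn (H : HolFamily (PLine × M)) {ι : Type*} [Fintype ι] (e : ι → H.Sec)
    (U : Set (PLine × M)) : Prop where
  isOpen : IsOpen U
  linearIndependent : ∀ y ∈ U, LinearIndependent ℂ fun i => e i y
  span_eq_top : ∀ y ∈ U, Submodule.span ℂ (range fun i => e i y) = ⊤
  holAt_iff : ∀ y ∈ U, ∀ s : H.Sec, H.HolAt s y ↔
    ∃ f : ι → PLine × M → ℂ, (∀ i, HolFunAt E (f i) y) ∧ ∀ᶠ z in 𝓝 y, s z = ∑ i, f i z • e i z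

variable {E} {H : HolFamily (PLine × M)} {ι κ : Type*} [Fintype ι] [Fintype κ] {e : ι → H.Sec}
  {U : Set (PLine × M)}

lemma IsFrameAt.exists_frameOn {n : ℕ} {e : Fin n → H.Sec} {x : PLine × M}
    (h : H.IsFrameAt E e x) : ∃ U, x ∈ U ∧ H.FrameOn E e U := by
  obtain ⟨U, hU, hU1, hx⟩ := eventually_nhds_iff.1 h
  exact ⟨U, hx, hU1, fun y hy => (hU y hy).1.1, fun y hy => (hU y hy).1.2, fun y hy => (hU y hy).2⟩

lemma FrameOn.isFrameAt {n : ℕ} {e : Fin n → H.Sec} (h : H.FrameOn E e U) {x : PLine × M}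
    (hx : x ∈ U) : H.IsFrameAt E e x := by
  filter_upwards [h.isOpen.mem_nhds hx] with y hy
  exact ⟨⟨h.linearIndependent y hy, h.span_eq_top y hy⟩, h.holAt_iff y hy⟩

lemma FrameOn.reindex (h : H.FrameOn E e U) (σ : κ ≃ ι) : H.FrameOn E (fun k => e (σ k)) U where
  isOpen := h.isOpen
  linearIndependent y hy := (h.linearIndependent y hy).comp σ σ.injective
  span_eq_top y hy := by
    rw [← h.span_eq_top y hy]
    exact congrArg _ (σ.surjective.range_comp fun i => e i y)
  holAt_iff y hy s := by
    rw [h.holAt_iff y hy]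
    constructor
    · rintro ⟨f, hf, hs⟩
      refine ⟨fun k => f (σ k), fun k => hf _, hs.mono fun z hz => ?_⟩
      rw [hz, σ.sum_comp fun i => f i z • e i z]
    · rintro ⟨f, hf, hs⟩
      refine ⟨fun i => f (σ.symm i), fun k => hf _, hs.mono fun z hz => ?_⟩
      rw [hz, ← σ.sum_comp fun i => f (σ.symm i) z • e i z]
      simp

lemma FrameOn.mono (h : H.FrameOn E e U) {V : Set (PLine × M)} (hV : IsOpen V) (hVU : V ⊆ U) :
    H.FrameOn E e V :=
  ⟨hV, fun y hy => h.linearIndependent y (hVU hy),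
    fun y hy => h.span_eq_top y (hVU hy), fun y hy => h.holAt_iff y (hVU hy)⟩

lemma FrameOn.coeff_unique (h : H.FrameOn E e U) {y : PLine × M} (hy : y ∈ U) {f g : ι → ℂ}
    (hfg : ∑ i, f i • e i y = ∑ i, g i • e i y) : f = g := by
  funext i
  have := Fintype.linearIndependent_iff.1 (h.linearIndependent y hy) (fun i => f i - g i)
    (by simp [sub_smul, hfg]) i
  exact sub_eq_zero.1 this

/-- The basis of a fibre given by a frame. -/
def FrameOn.basisAt (h : H.FrameOn E e U) {y : PLine × M} (hy : y ∈ U) :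
    Module.Basis ι ℂ (H.fiber y) :=
  Module.Basis.mk (h.linearIndependent y hy) (h.span_eq_top y hy).ge

lemma FrameOn.basisAt_apply (h : H.FrameOn E e U) {y : PLine × M} (hy : y ∈ U) (i : ι) :
    h.basisAt hy i = e i y := by
  simp [FrameOn.basisAt]

lemma FrameOn.exists_coeff (h : H.FrameOn E e U) {y : PLine × M} (hy : y ∈ U) (a : H.fiber y) :
    ∃ f : ι → ℂ, a = ∑ i, f i • e i y :=
  ⟨(h.basisAt hy).repr a, by
    simpa only [h.basisAt_apply] using ((h.basisAt hy).sum_repr a).symm⟩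

/-- A combination of frame vectors lies in the span of a part of them iff the other coefficients
vanish. -/
lemma FrameOn.mem_span_image_iff (h : H.FrameOn E e U) {y : PLine × M} (hy : y ∈ U) (S : Set ι)
    (f : ι → ℂ) :
    ∑ i, f i • e i y ∈ Submodule.span ℂ ((fun i => e i y) '' S) ↔ ∀ i ∉ S, f i = 0 := by
  have h1 := (h.basisAt hy).mem_span_image (m := ∑ i, f i • e i y) (s := S)
  have h2 : ∀ i, (h.basisAt hy).repr (∑ i, f i • e i y) i = f i := by
    intro i
    simp only [← h.basisAt_apply hy]
    exact congrFun ((h.basisAt hy).repr_sum_self f) i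
  have h3 : (h.basisAt hy : ι → H.fiber y) = fun i => e i y := funext (h.basisAt_apply hy)
  rw [h3] at h1
  rw [h1]
  simp only [subset_def, Finset.mem_coe, Finsupp.mem_support_iff, h2]
  exact forall_congr' fun i => not_imp_comm

lemma FrameOn.holAt_apply (h : H.FrameOn E e U) {y : PLine × M} (hy : y ∈ U) (i : ι) :
    H.HolAt (e i) y := by
  classical
  refine (h.holAt_iff y hy _).2 ⟨fun j _ => if i = j then 1 else 0,
    fun j => holFunAt_const _ _, Eventually.of_forall fun z => ?_⟩
  simp

lemma FrameOn.exists_holomorphic_coeff (h : H.FrameOn E e U) {x : PLine × M} (hx : x ∈ U)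
    {s : H.Sec} (hs : H.HolAt s x) :
    ∃ f : ι → PLine × M → ℂ, (∀ i, HolFunAt E (f i) x) ∧
      ∀ᶠ z in 𝓝 x, z ∈ U ∧ s z = ∑ i, f i z • e i z := by
  obtain ⟨f, hf, hsf⟩ := (h.holAt_iff x hx s).1 hs
  exact ⟨f, hf, Filter.Eventually.and (h.isOpen.mem_nhds hx) hsf⟩

/-- A change of frame with holomorphic coefficients in both directions. -/
lemma FrameOn.change (h : H.FrameOn E e U) (hc : Fintype.card κ = Fintype.card ι)
    (e' : κ → H.Sec) (g : κ → ι → PLine × M → ℂ) (g' : ι → κ → PLine × M → ℂ)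
    (hg : ∀ k i, ∀ y ∈ U, HolFunAt E (g k i) y) (hg' : ∀ i k, ∀ y ∈ U, HolFunAt E (g' i k) y)
    (he' : ∀ k, ∀ y ∈ U, e' k y = ∑ i, g k i y • e i y)
    (he : ∀ i, ∀ y ∈ U, e i y = ∑ k, g' i k y • e' k y) : H.FrameOn E e' U := by
  have hspan : ∀ y ∈ U, Submodule.span ℂ (range fun k => e' k y) = ⊤ := by
    intro y hy
    rw [eq_top_iff, ← h.span_eq_top y hy, Submodule.span_le]
    rintro _ ⟨i, rfl⟩
    simp only [SetLike.mem_coe]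
    rw [he i y hy]
    exact Submodule.sum_mem _ fun k _ =>
      Submodule.smul_mem _ _ (Submodule.subset_span (mem_range_self k))
  refine ⟨h.isOpen, fun y hy => ?_, hspan, fun y hy s => ?_⟩
  · refine linearIndependent_of_top_le_span_of_card_eq_finrank (hspan y hy).ge ?_
    rw [hc, Module.finrank_eq_card_basis (h.basisAt hy)]
  · rw [h.holAt_iff y hy]
    constructor
    · rintro ⟨f, hf, hs⟩
      refine ⟨fun k z => ∑ i, f i z * g' i k z,
        fun k => .sum fun i _ => (hf i).mul (hg' i k y hy), ?_⟩
      filter_upwards [hs, h.isOpen.mem_nhds hy] with z hz hzU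
      simp_rw [hz, Finset.sum_smul, mul_smul]
      rw [Finset.sum_comm]
      refine Finset.sum_congr rfl fun i _ => ?_
      rw [← Finset.smul_sum, ← he i z hzU]
    · rintro ⟨f, hf, hs⟩
      refine ⟨fun i z => ∑ k, f k z * g k i z,
        fun i => .sum fun k _ => (hf k).mul (hg k i y hy), ?_⟩
      filter_upwards [hs, h.isOpen.mem_nhds hy] with z hz hzU
      simp_rw [hz, Finset.sum_smul, mul_smul]
      rw [Finset.sum_comm]
      refine Finset.sum_congr rfl fun i _ => ?_
      rw [← Finset.smul_sum, ← he' i z hzU]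

lemma sum_subtype_eq_sum {A : Type*} [AddCommMonoid A] {S : Set ι} [Fintype S] (g : ι → A)
    (hg : ∀ i ∉ S, g i = 0) : ∑ i : S, g i = ∑ i, g i :=
  Fintype.sum_of_injective Subtype.val Subtype.val_injective _ _
    (fun i hi => hg i fun h => hi ⟨⟨i, h⟩, rfl⟩) fun _ => rfl

section Maps

variable {X : Type*} {H : HolFamily X}

/-- The inclusion of a subfamily. -/
def incl (W : ∀ x, Submodule ℂ (H.fiber x)) (x : X) : (H.sub W).fiber x →ₗ[ℂ] H.fiber x :=
  (W x).subtype

variable {W : ∀ x, Submodule ℂ (H.fiber x)} {x : X}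

lemma incl_injective : Function.Injective (incl W x) := (W x).subtype_injective

lemma incl_mem (a : (H.sub W).fiber x) : incl W x a ∈ W x := Subtype.property (p := (· ∈ W x)) a

lemma exists_incl_eq {a : H.fiber x} (ha : a ∈ W x) : ∃ b, incl W x b = a := ⟨⟨a, ha⟩, rfl⟩

lemma holAt_sub_iff {s : (H.sub W).Sec} :
    (H.sub W).HolAt s x ↔ H.HolAt (fun y => incl W y (s y)) x := Iff.rfl

open Classical in
/-- The section of a subfamily given by a section of the family, zero where that section is not in
the subfamily. -/
def toSub (W : ∀ x, Submodule ℂ (H.fiber x)) (s : H.Sec) : (H.sub W).Sec :=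
  fun y => if h : s y ∈ W y then (exists_incl_eq h).choose else 0

lemma incl_toSub {s : H.Sec} (h : s x ∈ W x) : incl W x (toSub W s x) = s x := by
  rw [toSub, dif_pos h]
  exact (exists_incl_eq h).choose_spec

variable [TopologicalSpace X]

/-- The projection to a quotient family. -/
def proj (W : ∀ x, Submodule ℂ (H.fiber x)) (x : X) : H.fiber x →ₗ[ℂ] (H.quot W).fiber x :=
  (W x).mkQ

lemma proj_surjective : Function.Surjective (proj W x) := (W x).mkQ_surjective

lemma proj_eq_zero_iff {a : H.fiber x} : proj W x a = 0 ↔ a ∈ W x :=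
  Submodule.Quotient.mk_eq_zero (W x)

lemma proj_eq_proj_iff {a b : H.fiber x} : proj W x a = proj W x b ↔ a - b ∈ W x := by
  rw [← proj_eq_zero_iff, map_sub, sub_eq_zero]

lemma holAt_quot_iff {s : (H.quot W).Sec} :
    (H.quot W).HolAt s x ↔ ∃ r : H.Sec, H.HolAt r x ∧ ∀ᶠ y in 𝓝 x, s y = proj W y (r y) :=
  Iff.rfl

end Maps

/-- A holomorphic section of `H` lies in `W` exactly when its coefficients outside `S` vanish; the
others are then holomorphic coefficients in the vectors indexed by `S`. Conversely, extension by
zero returns to the frame of `H`. -/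
lemma FrameOn.sub (h : H.FrameOn E e U) {W : ∀ x, Submodule ℂ (H.fiber x)} {S : Set ι}
    [Fintype S] (hW : ∀ y ∈ U, W y = Submodule.span ℂ ((fun i => e i y) '' S)) :
    (H.sub W).FrameOn E (fun i : S => toSub W (e i)) U := by
  have hmem : ∀ y ∈ U, ∀ i : S, e i y ∈ W y := fun y hy i => by
    rw [hW y hy]; exact Submodule.subset_span ⟨i, i.2, rfl⟩
  have hcoe : ∀ y ∈ U, ∀ f : S → ℂ,
      incl W y (∑ i, f i • toSub W (e i) y) = ∑ i, f i • e i y := by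
    intro y hy f
    rw [map_sum]
    exact Finset.sum_congr rfl fun i _ => by rw [map_smul, incl_toSub (hmem y hy i)]
  have hext : ∀ y ∈ U, ∀ (a : (H.sub W).fiber y) (f : ι → ℂ), incl W y a = ∑ i, f i • e i y →
      a = ∑ i : S, f i • toSub W (e i) y := by
    intro y hy a f ha
    have h0 : ∀ i ∉ S, f i = 0 := by
      rw [← h.mem_span_image_iff hy S f, ← ha, ← hW y hy]; exact incl_mem a
    refine incl_injective ?_
    rw [hcoe y hy fun i => f i, ha,
      sum_subtype_eq_sum (fun i => f i • e i y) fun i hi => by simp [h0 i hi]]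
  refine ⟨h.isOpen, fun y hy => ?_, fun y hy => ?_, fun y hy s => ?_⟩
  · have h1 : LinearIndependent ℂ fun i : S => e i y :=
      (h.linearIndependent y hy).comp _ Subtype.val_injective
    refine LinearIndependent.of_comp (incl W y) ?_
    convert h1 with i
    exact incl_toSub (hmem y hy i)
  · refine eq_top_iff.2 fun a _ => ?_
    obtain ⟨f, hf⟩ := h.exists_coeff hy (incl W y a)
    rw [hext y hy a f hf]
    exact Submodule.sum_mem _ fun k _ =>
      Submodule.smul_mem _ _ (Submodule.subset_span (mem_range_self k))
  · rw [holAt_sub_iff]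
    constructor
    · intro hs
      obtain ⟨f, hf, hsf⟩ := h.exists_holomorphic_coeff hy hs
      exact ⟨fun i => f i, fun i => hf i, hsf.mono fun z hz => hext z hz.1 _ (f · z) hz.2⟩
    · rintro ⟨f, hf, hs⟩
      classical
      refine (h.holAt_iff y hy _).2 ⟨fun i z => if hi : i ∈ S then f ⟨i, hi⟩ z else 0, ?_, ?_⟩
      · intro i
        by_cases hi : i ∈ S
        · simpa [hi] using hf ⟨i, hi⟩
        · simpa [hi] using holFunAt_const _ _
      · filter_upwards [hs, h.isOpen.mem_nhds hy] with z hz hzU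
        rw [hz, hcoe z hzU fun i => f i z,
          ← sum_subtype_eq_sum (S := S) _ fun i hi => by simp [hi]]
        exact Finset.sum_congr rfl fun i _ => by simp

/-- The vectors indexed by `S` die in the quotient, and a combination of the remaining classes lifts
holomorphically by putting zero coefficients on `S`. -/
lemma FrameOn.quot (h : H.FrameOn E e U) {W : ∀ x, Submodule ℂ (H.fiber x)} {S : Set ι}
    [Fintype ↥(Sᶜ)] (hW : ∀ y ∈ U, W y = Submodule.span ℂ ((fun i => e i y) '' S)) :
    (H.quot W).FrameOn E (fun (i : ↥(Sᶜ)) y => proj W y (e i y)) U := by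
  have hmem : ∀ y ∈ U, ∀ i ∈ S, proj W y (e i y) = 0 := fun y hy i hi => by
    rw [proj_eq_zero_iff, hW y hy]
    exact Submodule.subset_span ⟨i, hi, rfl⟩
  have hext : ∀ y ∈ U, ∀ f : ι → ℂ,
      proj W y (∑ i, f i • e i y) = ∑ i : ↥(Sᶜ), f i • proj W y (e i y) := by
    intro y hy f
    rw [map_sum, ← sum_subtype_eq_sum (S := Sᶜ) _ fun i hi => by
      rw [map_smul, hmem y hy i (not_not.1 hi), smul_zero]]
    exact Finset.sum_congr rfl fun i _ => by rw [map_smul]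
  classical
  have hzero : ∀ y, ∀ f : ↥(Sᶜ) → ℂ, ∑ i, f i • e i y =
      ∑ i, (if hi : i ∈ Sᶜ then f ⟨i, hi⟩ else 0) • e i y := by
    intro y f
    rw [← sum_subtype_eq_sum (S := Sᶜ) _ fun i hi => by rw [dif_neg hi, zero_smul]]
    exact Finset.sum_congr rfl fun i _ => by rw [dif_pos i.2]
  have hquot : ∀ y, ∀ f : ↥(Sᶜ) → ℂ,
      ∑ i, f i • proj W y (e i y) = proj W y (∑ i, f i • e i y) := by
    intro y f
    rw [map_sum]
    exact Finset.sum_congr rfl fun i _ => by rw [map_smul]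
  refine ⟨h.isOpen, fun y hy => ?_, fun y hy => ?_, fun y hy s => ?_⟩
  · refine Fintype.linearIndependent_iff.2 fun f hf i => ?_
    rw [hquot y f, proj_eq_zero_iff, hW y hy, hzero, h.mem_span_image_iff hy] at hf
    have := hf i i.2
    rwa [dif_pos i.2] at this
  · refine eq_top_iff.2 fun a _ => ?_
    obtain ⟨a, rfl⟩ := proj_surjective a
    obtain ⟨f, rfl⟩ := h.exists_coeff hy a
    rw [hext y hy]
    exact Submodule.sum_mem _ fun k _ =>
      Submodule.smul_mem _ _ (Submodule.subset_span (mem_range_self k))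
  · rw [holAt_quot_iff]
    constructor
    · rintro ⟨r, hr, hs⟩
      obtain ⟨f, hf, hrf⟩ := h.exists_holomorphic_coeff hy hr
      refine ⟨fun i => f i, fun i => hf i, ?_⟩
      filter_upwards [hs, hrf] with z hz hz'
      rw [hz, hz'.2, hext z hz'.1 (f · z)]
    · rintro ⟨f, hf, hs⟩
      refine ⟨fun z => ∑ i, f i z • e i z, (h.holAt_iff y hy _).2
        ⟨fun i z => if hi : i ∈ Sᶜ then f ⟨i, hi⟩ z else 0, fun i => ?_,
          Eventually.of_forall fun z => hzero z fun i => f i z⟩, ?_⟩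
      · by_cases hi : i ∈ Sᶜ
        · simpa only [dif_pos hi] using hf ⟨i, hi⟩
        · simpa only [dif_neg hi] using holFunAt_const _ _
      · filter_upwards [hs] with z hz
        rw [hz, hquot]

/-! ### Holomorphic sections of bundles -/

lemma IsBundle.exists_frameOn (h : H.IsBundle E) (x : PLine × M) :
    ∃ (n : ℕ) (e : Fin n → H.Sec) (U : Set (PLine × M)), x ∈ U ∧ H.FrameOn E e U := by
  obtain ⟨n, e, he⟩ := h x
  obtain ⟨U, hU⟩ := he.exists_frameOn
  exact ⟨n, e, U, hU⟩

lemma IsBundle.holAt_congr (h : H.IsBundle E) {x : PLine × M} {s s' : H.Sec}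
    (hs : H.HolAt s x) (hss' : ∀ᶠ y in 𝓝 x, s y = s' y) : H.HolAt s' x := by
  obtain ⟨n, e, U, hx, hU⟩ := h.exists_frameOn x
  obtain ⟨f, hf, hsf⟩ := (hU.holAt_iff x hx s).1 hs
  refine (hU.holAt_iff x hx s').2 ⟨f, hf, ?_⟩
  filter_upwards [hsf, hss'] with y h1 h2
  rw [← h2, h1]

lemma IsBundle.holAt_eventually [IsManifold 𝓘(ℂ, E) ω M] (h : H.IsBundle E) {x : PLine × M}
    {s : H.Sec} (hs : H.HolAt s x) : ∀ᶠ y in 𝓝 x, H.HolAt s y := by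
  obtain ⟨n, e, U, hx, hU⟩ := h.exists_frameOn x
  obtain ⟨f, hf, hsf⟩ := (hU.holAt_iff x hx s).1 hs
  filter_upwards [hU.isOpen.mem_nhds hx, eventually_all.2 fun i => (hf i).eventually,
    hsf.eventually_nhds] with y h1 h2 h3
  exact (hU.holAt_iff y h1 s).2 ⟨f, h2, h3⟩

lemma IsBundle.holAt_add (h : H.IsBundle E) {x : PLine × M} {s s' : H.Sec}
    (hs : H.HolAt s x) (hs' : H.HolAt s' x) : H.HolAt (fun y => s y + s' y) x := by
  obtain ⟨n, e, U, hx, hU⟩ := h.exists_frameOn x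
  obtain ⟨f, hf, hsf⟩ := (hU.holAt_iff x hx s).1 hs
  obtain ⟨f', hf', hsf'⟩ := (hU.holAt_iff x hx s').1 hs'
  refine (hU.holAt_iff x hx _).2 ⟨fun i y => f i y + f' i y, fun i => (hf i).add (hf' i), ?_⟩
  filter_upwards [hsf, hsf'] with y h1 h2
  simp only [h1, h2, add_smul, Finset.sum_add_distrib]

lemma IsBundle.holAt_smul (h : H.IsBundle E) {x : PLine × M} {g : PLine × M → ℂ} {s : H.Sec}
    (hg : HolFunAt E g x) (hs : H.HolAt s x) : H.HolAt (fun y => g y • s y) x := by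
  obtain ⟨n, e, U, hx, hU⟩ := h.exists_frameOn x
  obtain ⟨f, hf, hsf⟩ := (hU.holAt_iff x hx s).1 hs
  refine (hU.holAt_iff x hx _).2 ⟨fun i y => g y * f i y, fun i => hg.mul (hf i), ?_⟩
  filter_upwards [hsf] with y h1
  simp only [h1, mul_smul, Finset.smul_sum]

lemma IsBundle.holAt_zero (h : H.IsBundle E) (x : PLine × M) : H.HolAt (fun _ => 0) x := by
  obtain ⟨n, e, U, hx, hU⟩ := h.exists_frameOn x
  exact (hU.holAt_iff x hx _).2 ⟨fun _ _ => 0, fun i => holFunAt_const _ _, by simp⟩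

omit [Fintype ι] in
lemma IsBundle.holAt_sum (h : H.IsBundle E) {x : PLine × M} {t : Finset ι} {s : ι → H.Sec}
    (hs : ∀ i ∈ t, H.HolAt (s i) x) : H.HolAt (fun y => ∑ i ∈ t, s i y) x := by
  classical
  induction t using Finset.induction_on with
  | empty => simpa using h.holAt_zero x
  | insert i t hi ih =>
    simp only [Finset.sum_insert hi]
    exact h.holAt_add (hs i (by simp)) (ih fun j hj => hs j (by simp [hj]))

lemma IsBundle.holAt_sub (h : H.IsBundle E) {x : PLine × M} {s s' : H.Sec}
    (hs : H.HolAt s x) (hs' : H.HolAt s' x) : H.HolAt (fun y => s y - s' y) x := by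
  simpa [sub_eq_add_neg] using
    h.holAt_add hs (h.holAt_smul (holFunAt_const (-1) x) hs')

lemma IsTrivialAlong.isBundle (h : H.IsTrivialAlong E) : H.IsBundle E := by
  rintro ⟨l, t⟩
  obtain ⟨n, e, he⟩ := h t
  exact ⟨n, e, he l⟩

/-- By compactness of the projective line, the frames of a bundle which is trivial along it are
defined over products. -/
lemma IsTrivialAlong.exists_frameOn (h : H.IsTrivialAlong E) (t : M) :
    ∃ (n : ℕ) (e : Fin n → H.Sec) (V : Set M), IsOpen V ∧ t ∈ V ∧
      H.FrameOn E e (univ ×ˢ V) := by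
  obtain ⟨n, e, he⟩ := h t
  choose U hU hF using fun l => (he l).exists_frameOn
  have hopen : IsOpen (⋃ l, U l) := isOpen_iUnion fun l => (hF l).isOpen
  obtain ⟨A, V, -, hV, hA, hV', hAV⟩ := generalized_tube_lemma (isCompact_univ (X := PLine))
    (isCompact_singleton (x := t)) hopen (by
      rintro ⟨l, s⟩ ⟨-, hs⟩
      rw [mem_singleton_iff] at hs
      subst hs
      exact mem_iUnion.2 ⟨l, hU l⟩)
  have hsub : ∀ y ∈ (univ : Set PLine) ×ˢ V, ∃ l, y ∈ U l := fun y hy =>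
    mem_iUnion.1 (hAV ⟨hA trivial, hy.2⟩)
  refine ⟨n, e, V, hV, hV' rfl, isOpen_univ.prod hV, fun y hy => ?_, fun y hy => ?_,
    fun y hy => ?_⟩ <;> obtain ⟨l, hl⟩ := hsub y hy
  · exact (hF l).linearIndependent y hl
  · exact (hF l).span_eq_top y hl
  · exact (hF l).holAt_iff y hl

/-- A bundle with frames over products is trivial along the projective line. -/
lemma isTrivialAlong_of_frameOn
    (h : ∀ t : M, ∃ (ι : Type) (_ : Fintype ι) (e : ι → H.Sec) (V : Set M), IsOpen V ∧ t ∈ V ∧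
      H.FrameOn E e (univ ×ˢ V)) : H.IsTrivialAlong E := by
  intro t
  obtain ⟨ι, _, e, V, -, ht, hF⟩ := h t
  exact ⟨_, _, fun l => (hF.reindex (Fintype.equivFin ι).symm).isFrameAt ⟨trivial, ht⟩⟩

lemma FrameOn.exists_isFrameAt_span (h : H.FrameOn E e U) {W : ∀ x, Submodule ℂ (H.fiber x)}
    {S : Set ι} (hW : ∀ y ∈ U, W y = Submodule.span ℂ ((fun i => e i y) '' S))
    {x : PLine × M} (hx : x ∈ U) :
    ∃ (n : ℕ) (e : Fin n → H.Sec) (S : Set (Fin n)), H.IsFrameAt E e x ∧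
      ∀ᶠ y in 𝓝 x, W y = Submodule.span ℂ ((fun i => e i y) '' S) := by
  refine ⟨_, _, Fintype.equivFin ι '' S, (h.reindex (Fintype.equivFin ι).symm).isFrameAt hx, ?_⟩
  filter_upwards [h.isOpen.mem_nhds hx] with y hy
  rw [hW y hy, image_image]
  simp

end HolFamily

open HolFamily

/-! ### Induced connections -/

section InducedConnections

variable {E : Type*} [NormedAddCommGroup E] [NormedSpace ℂ E]
  {M : Type*} [TopologicalSpace M] [ChartedSpace E M] [IsManifold 𝓘(ℂ, E) ω M]
  {H : HolFamily (PLine × M)} {D : Conn E H} {W : ∀ x, Submodule ℂ (H.fiber x)}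

lemma IsFlatConn.apply_zero (hD : IsFlatConn H D) (hH : H.IsBundle E) {x : PLine × M}
    {v : VField E M} (hv : PoleFieldAt v x) : D v (fun _ => 0) x = 0 := by
  have h := hD.add_sec x v _ _ hv (hH.holAt_zero x) (hH.holAt_zero x)
  simpa using h

lemma IsFlatConn.apply_sub (hD : IsFlatConn H D) (hH : H.IsBundle E) {x : PLine × M}
    {v : VField E M} {s s' : H.Sec} (hv : PoleFieldAt v x) (hs : H.HolAt s x)
    (hs' : H.HolAt s' x) : D v (fun y => s y - s' y) x = D v s x - D v s' x := by
  have h := hD.add_sec x v _ _ hv (hH.holAt_sub hs hs') hs'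
  simp only [sub_add_cancel] at h
  exact eq_sub_of_add_eq h.symm

lemma IsFlatConn.apply_sum (hD : IsFlatConn H D) (hH : H.IsBundle E) {x : PLine × M}
    {v : VField E M} {ι : Type*} {t : Finset ι} {s : ι → H.Sec} (hv : PoleFieldAt v x)
    (hs : ∀ i ∈ t, H.HolAt (s i) x) : D v (fun y => ∑ i ∈ t, s i y) x = ∑ i ∈ t, D v (s i) x := by
  classical
  induction t using Finset.induction_on with
  | empty => simpa using hD.apply_zero hH hv
  | insert i t hi ih =>
    simp only [Finset.sum_insert hi]
    have ht : ∀ j ∈ t, H.HolAt (s j) x := fun j hj => hs j (by simp [hj])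
    rw [hD.add_sec x v _ _ hv (hs i (by simp)) (hH.holAt_sum ht), ih ht]

/-- The restriction of a connection to a subfamily. -/
def subConn (D : Conn E H) (W : ∀ x, Submodule ℂ (H.fiber x)) : Conn E (H.sub W) :=
  fun v s => toSub W (D v fun y => incl W y (s y))

lemma incl_subConn (hW : IsFlatSub H D W) {x : PLine × M} {v : VField E M} {s : (H.sub W).Sec}
    (hv : PoleFieldAt v x) (hs : (H.sub W).HolAt s x) :
    incl W x (subConn D W v s x) = D v (fun y => incl W y (s y)) x :=
  incl_toSub (hW x v _ hv hs (Eventually.of_forall fun _ => incl_mem _))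

lemma IsFlatConn.sub (hD : IsFlatConn H D) (hH : H.IsBundle E) (hW : IsFlatSub H D W) :
    IsFlatConn (H.sub W) (subConn D W) := by
  have hev : ∀ x v s, PoleFieldAt v x → (H.sub W).HolAt s x →
      ∀ᶠ y in 𝓝 x, D v (fun y => incl W y (s y)) y = incl W y (subConn D W v s y) := by
    intro x v s hv hs
    filter_upwards [hv.eventually, hH.holAt_eventually hs] with y h1 h2
    exact (incl_subConn hW h1 h2).symm
  have hhol : ∀ x v s, PoleFieldAt v x → (H.sub W).HolAt s x →
      (H.sub W).HolAt (subConn D W v s) x := fun x v s hv hs =>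
    hH.holAt_congr (hD.hol x v _ hv hs) (hev x v s hv hs)
  refine ⟨hhol, ?_, ?_, ?_, ?_, ?_, ?_⟩
  · intro x v v' s s' hv hs hvv' hss'
    have hss : ∀ᶠ y in 𝓝 x, incl W y (s y) = incl W y (s' y) := hss'.mono fun y hy => by rw [hy]
    refine incl_injective ?_
    rw [incl_subConn hW hv hs, incl_subConn hW (hv.congr hvv') (hH.holAt_congr hs hss)]
    exact hD.congr x v v' _ _ hv hs hvv' hss
  · intro x v v' s hv hv' hs
    refine incl_injective ?_
    have hvv : PoleFieldAt (fun y => v y + v' y) x := hv.add hv'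
    rw [map_add, incl_subConn hW hv hs, incl_subConn hW hv' hs, incl_subConn hW hvv hs]
    exact hD.add_field x v v' _ hv hv' hs
  · intro x v f s hv hf hs
    refine incl_injective ?_
    have hfv : PoleFieldAt (fun y => f y • v y) x := hv.smul hf
    rw [map_smul, incl_subConn hW hv hs, incl_subConn hW hfv hs]
    exact hD.smul_field x v f _ hv hf hs
  · intro x v s s' hv hs hs'
    refine incl_injective ?_
    have hss : (H.sub W).HolAt (fun y => s y + s' y) x := by
      simpa only [holAt_sub_iff, map_add] using hH.holAt_add (holAt_sub_iff.1 hs) (holAt_sub_iff.1 hs')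
    rw [map_add, incl_subConn hW hv hs, incl_subConn hW hv hs', incl_subConn hW hv hss]
    simpa only [map_add] using hD.add_sec x v _ _ hv (holAt_sub_iff.1 hs) (holAt_sub_iff.1 hs')
  · intro x v f s hv hf hs
    refine incl_injective ?_
    have hfs : (H.sub W).HolAt (fun y => f y • s y) x := by
      simpa only [holAt_sub_iff, map_smul] using hH.holAt_smul hf (holAt_sub_iff.1 hs)
    rw [map_add, map_smul, map_smul, incl_subConn hW hv hs, incl_subConn hW hv hfs]
    simpa only [map_smul] using hD.leibniz x v f _ hv hf (holAt_sub_iff.1 hs)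
  · intro x v v' w s hv hv' hw hs hvw
    refine incl_injective ?_
    rw [map_sub, incl_subConn hW hw hs, incl_subConn hW hv (hhol x v' s hv' hs),
      incl_subConn hW hv' (hhol x v s hv hs), ← hD.flat x v v' w _ hv hv' hw (holAt_sub_iff.1 hs) hvw]
    -- The inner derivative of the restricted connection agrees with that of `D` only near `x`, so
    -- the outer derivatives are compared as functions of germs.
    congr 1
    · exact (hD.congr x v v _ _ hv (hD.hol x v' _ hv' hs) (by simp) (hev x v' s hv' hs)).symm
    · exact (hD.congr x v' v' _ _ hv' (hD.hol x v _ hv hs) (by simp) (hev x v s hv hs)).symm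

open Classical in
/-- The connection induced on a quotient family. -/
def quotConn (D : Conn E H) (W : ∀ x, Submodule ℂ (H.fiber x)) : Conn E (H.quot W) :=
  fun v σ x => if h : (H.quot W).HolAt σ x then proj W x (D v h.choose x) else 0

/-- Two local lifts differ by a holomorphic section of `W`, which `D` keeps in `W`; the lift chosen
in `quotConn` may thus be replaced by any other. The axioms of a connection then descend from `D`.
-/
lemma quotConn_apply (hD : IsFlatConn H D) (hH : H.IsBundle E) (hW : IsFlatSub H D W)
    {x : PLine × M} {v : VField E M} {σ : (H.quot W).Sec} {s : H.Sec} (hv : PoleFieldAt v x)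
    (hs : H.HolAt s x) (hσ : ∀ᶠ y in 𝓝 x, σ y = proj W y (s y)) :
    quotConn D W v σ x = proj W x (D v s x) := by
  have h : (H.quot W).HolAt σ x := ⟨s, hs, hσ⟩
  rw [quotConn, dif_pos h, proj_eq_proj_iff, ← hD.apply_sub hH hv h.choose_spec.1 hs]
  refine hW x v _ hv (hH.holAt_sub h.choose_spec.1 hs) ?_
  filter_upwards [hσ, h.choose_spec.2] with y h1 h2
  rw [← proj_eq_proj_iff, ← h1]
  exact h2.symm

lemma IsFlatConn.quot (hD : IsFlatConn H D) (hH : H.IsBundle E) (hW : IsFlatSub H D W) :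
    IsFlatConn (H.quot W) (quotConn D W) := by
  have hev : ∀ x v (σ : (H.quot W).Sec) (s : H.Sec), PoleFieldAt v x → H.HolAt s x →
      (∀ᶠ y in 𝓝 x, σ y = proj W y (s y)) →
      ∀ᶠ y in 𝓝 x, quotConn D W v σ y = proj W y (D v s y) := by
    intro x v σ s hv hs hσ
    filter_upwards [hv.eventually, hH.holAt_eventually hs, hσ.eventually_nhds] with y h1 h2 h3
    exact quotConn_apply hD hH hW h1 h2 h3
  refine ⟨?_, ?_, ?_, ?_, ?_, ?_, ?_⟩
  · rintro x v σ hv ⟨s, hs, hσ⟩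
    exact ⟨D v s, hD.hol x v s hv hs, hev x v σ s hv hs hσ⟩
  · rintro x v v' σ σ' hv ⟨s, hs, hσ⟩ hvv' hσσ'
    have hσ' : ∀ᶠ y in 𝓝 x, σ' y = proj W y (s y) := by
      filter_upwards [hσ, hσσ'] with y h1 h2
      rw [← h2]; exact h1
    rw [quotConn_apply hD hH hW hv hs hσ, quotConn_apply hD hH hW (hv.congr hvv') hs hσ',
      hD.congr x v v' s s hv hs hvv' (by simp)]
  · rintro x v v' σ hv hv' ⟨s, hs, hσ⟩
    have hvv : PoleFieldAt (fun y => v y + v' y) x := hv.add hv'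
    rw [quotConn_apply hD hH hW hv hs hσ, quotConn_apply hD hH hW hv' hs hσ,
      quotConn_apply hD hH hW hvv hs hσ, hD.add_field x v v' s hv hv' hs, map_add]
  · rintro x v f σ hv hf ⟨s, hs, hσ⟩
    have hfv : PoleFieldAt (fun y => f y • v y) x := hv.smul hf
    rw [quotConn_apply hD hH hW hv hs hσ, quotConn_apply hD hH hW hfv hs hσ,
      hD.smul_field x v f s hv hf hs, map_smul]
  · rintro x v σ σ' hv ⟨s, hs, hσ⟩ ⟨s', hs', hσ'⟩
    have hσσ : ∀ᶠ y in 𝓝 x, σ y + σ' y = proj W y (s y + s' y) := by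
      filter_upwards [hσ, hσ'] with y h1 h2
      rw [map_add]; exact congrArg₂ (· + ·) h1 h2
    rw [quotConn_apply hD hH hW hv hs hσ, quotConn_apply hD hH hW hv hs' hσ',
      quotConn_apply hD hH hW hv (hH.holAt_add hs hs') hσσ, hD.add_sec x v s s' hv hs hs', map_add]
  · rintro x v f σ hv hf ⟨s, hs, hσ⟩
    have hσσ : ∀ᶠ y in 𝓝 x, f y • σ y = proj W y (f y • s y) := by
      filter_upwards [hσ] with y h1
      rw [map_smul]; exact congrArg (f y • ·) h1
    rw [quotConn_apply hD hH hW hv hs hσ, quotConn_apply hD hH hW hv (hH.holAt_smul hf hs) hσσ,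
      hD.leibniz x v f s hv hf hs, map_add, map_smul, map_smul]
    exact congrArg (applyField v f x • · + _) hσ.self_of_nhds.symm
  · rintro x v v' w σ hv hv' hw ⟨s, hs, hσ⟩ hvw
    rw [quotConn_apply hD hH hW hw hs hσ,
      quotConn_apply hD hH hW hv (hD.hol x v' s hv' hs) (hev x v' σ s hv' hs hσ),
      quotConn_apply hD hH hW hv' (hD.hol x v s hv hs) (hev x v σ s hv hs hσ),
      ← hD.flat x v v' w s hv hv' hw hs hvw, map_sub]

/-- Whether `W` is preserved by the connection can be checked off `{0, infinity} × M`. -/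
lemma isFlatSub_of_regular (hD : IsFlatConn H D)
    (hW : ∀ t : M, ∃ (ι : Type) (_ : Fintype ι) (e : ι → H.Sec) (V : Set M) (S : Set ι), t ∈ V ∧
      H.FrameOn E e (univ ×ˢ V) ∧
      ∀ y ∈ (univ : Set PLine) ×ˢ V, W y = Submodule.span ℂ ((fun i => e i y) '' S))
    (h : ∀ x v s, x ∈ regular M → PoleFieldAt v x → H.HolAt s x → (∀ᶠ y in 𝓝 x, s y ∈ W y) →
      D v s x ∈ W x) (hH : H.IsBundle E) : IsFlatSub H D W := by
  rintro x v s hv hs hsW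
  obtain ⟨ι, _, e, V, S, hx, hF, hS⟩ := hW x.2
  have hxV : x ∈ (univ : Set PLine) ×ˢ V := ⟨trivial, hx⟩
  obtain ⟨f, hf, hsf⟩ := hF.exists_holomorphic_coeff hxV (hD.hol x v s hv hs)
  rw [hS x hxV, hsf.self_of_nhds.2, hF.mem_span_image_iff hxV]
  intro i hi
  -- The coefficients of `D v s` outside `S` are holomorphic and vanish on the dense regular locus,
  -- hence vanish at `x` by continuity.
  refine eq_zero_of_eventually_regular (hf i).continuousAt ?_
  filter_upwards [hsf, hv.eventually, hH.holAt_eventually hs, hsW.eventually_nhds]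
    with y h1 h2 h3 h4 hy
  have h5 := h y v s hy h2 h3 h4
  rw [hS y h1.1, h1.2, hF.mem_span_image_iff h1.1] at h5
  exact h5 i hi

end InducedConnections

/-! ### Linear differential equations -/

section LinearDifferentialEquations

variable {E : Type*} [NormedAddCommGroup E] [NormedSpace ℂ E] [FiniteDimensional ℂ E]
  {κ : Type*} [Finite κ]

/-- A function which vanishes at a point and whose derivative is bounded by the function
vanishes near the point. -/
lemma eventually_eq_zero_of_norm_fderiv_le {F : Type*} [NormedAddCommGroup F] [NormedSpace ℂ F]
    (b : Module.Basis κ ℂ E) {f : E → F} {z₀ : E} {C : ℝ}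
    (hf : ∀ᶠ z in 𝓝 z₀, DifferentiableAt ℂ f z ∧ ∀ k, ‖fderiv ℂ f z (b k)‖ ≤ C * ‖f z‖)
    (h0 : f z₀ = 0) : ∀ᶠ z in 𝓝 z₀, f z = 0 := by
  have : ProperSpace E := FiniteDimensional.proper ℂ E
  obtain ⟨K, hK, hKb⟩ := b.exists_opNorm_le (F := F)
  obtain ⟨r, hr, hrf⟩ := Metric.nhds_basis_closedBall.eventually_iff.1 hf
  -- `K` compares the operator norm with the values on the basis `b`, and the summand 1 makes `A`
  -- positive. On a ball of radius at most `1 / (2 A)` the mean value inequality bounds the maximum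
  -- of `‖f‖` by half of itself, so it is zero.
  set A : ℝ := K * |C| + 1 with hA
  have hA0 : 0 < A := by positivity
  set δ := min r (2 * A)⁻¹ with hδ
  have hδ0 : 0 < δ := by positivity
  have hsub : Metric.closedBall z₀ δ ⊆ Metric.closedBall z₀ r :=
    Metric.closedBall_subset_closedBall (min_le_left _ _)
  have hdiff : ∀ z ∈ Metric.closedBall z₀ δ, DifferentiableAt ℂ f z := fun z hz =>
    (hrf (hsub hz)).1
  obtain ⟨z₁, hz₁, hmax⟩ := (isCompact_closedBall z₀ δ).exists_isMaxOn
    ⟨z₀, Metric.mem_closedBall_self hδ0.le⟩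
    (f := fun z => ‖f z‖) (fun z hz => (hdiff z hz).continuousAt.norm.continuousWithinAt)
  have hbound : ∀ z ∈ Metric.closedBall z₀ δ, ‖fderiv ℂ f z‖ ≤ A * ‖f z₁‖ := by
    intro z hz
    have h1 : ∀ k, ‖fderiv ℂ f z (b k)‖ ≤ |C| * ‖f z₁‖ := fun k =>
      ((hrf (hsub hz)).2 k).trans
        (mul_le_mul (le_abs_self C) (hmax hz) (norm_nonneg _) (abs_nonneg C))
    refine (hKb (by positivity) h1).trans ?_
    rw [hA, add_mul, mul_assoc]
    linarith [norm_nonneg (f z₁)]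
  have h2 := (convex_closedBall z₀ δ).norm_image_sub_le_of_norm_fderiv_le (𝕜 := ℂ) hdiff hbound
    (Metric.mem_closedBall_self hδ0.le) hz₁
  rw [h0, sub_zero] at h2
  have h3 : ‖z₁ - z₀‖ ≤ (2 * A)⁻¹ := by
    rw [← dist_eq_norm]
    exact (Metric.mem_closedBall.1 hz₁).trans (min_le_right _ _)
  have h4 : ‖f z₁‖ ≤ ‖f z₁‖ / 2 := by
    calc ‖f z₁‖ ≤ A * ‖f z₁‖ * ‖z₁ - z₀‖ := h2
      _ ≤ A * ‖f z₁‖ * (2 * A)⁻¹ := by gcongr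
      _ = ‖f z₁‖ / 2 := by field_simp
  have h5 : ‖f z₁‖ = 0 := by linarith [norm_nonneg (f z₁)]
  filter_upwards [Metric.closedBall_mem_nhds z₀ hδ0] with z hz
  exact norm_le_zero_iff.1 ((hmax hz).trans h5.le)

variable {R : Type*} [NormedRing R] [NormedAlgebra ℂ R] [CompleteSpace R]

/-- If `B` satisfies the differential equations `∂ B = [B, Γ]` and `g` is a generalized inverse of
`B z₀`, then `z ↦ (1 + g (B z - B z₀))⁻¹` maps the kernel of `B z₀` to the kernel of `B z`. -/
theorem mul_inverse_eq_zero_of_fderiv_eq_commutator (b : Module.Basis κ ℂ E) {B : E → R} {z₀ : E}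
    (Γ : κ → E → R) (hΓ : ∀ k, ContinuousAt (Γ k) z₀)
    (hB : ∀ᶠ z in 𝓝 z₀, DifferentiableAt ℂ B z ∧
      ∀ k, fderiv ℂ B z (b k) = B z * Γ k z - Γ k z * B z)
    {g : R} (hg : B z₀ * g * B z₀ = B z₀) :
    ∀ᶠ z in 𝓝 z₀, B z * (Ring.inverse (1 + g * (B z - B z₀)) * (1 - g * B z₀)) = 0 := by
  set u : E → R := fun z => 1 + g * (B z - B z₀) with hu
  set p : R := 1 - g * B z₀ with hp
  have hu0 : u z₀ = 1 := by simp [hu]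
  have hBc : ContinuousAt B z₀ := hB.self_of_nhds.1.continuousAt
  have huc : ContinuousAt u z₀ := by fun_prop
  have hunit : ∀ᶠ z in 𝓝 z₀, IsUnit (u z) :=
    huc.eventually (Units.isOpen.mem_nhds (by simp [hu0]))
  have hic : ContinuousAt (fun z => Ring.inverse (u z)) z₀ := by
    have h1 : ContinuousAt (Ring.inverse : R → R) (u z₀) := by
      rw [hu0]; exact NormedRing.inverse_continuousAt (1 : Rˣ)
    exact h1.comp huc
  -- With `F = B u⁻¹ p` one has `∂ F = (1 - B u⁻¹ g) (∂ B) u⁻¹ p`. Inserting `∂ B = B Γ - Γ B` gives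
  -- `∂ F = F X - Y F`, with `X = Γ u⁻¹ p` and `Y = (1 - B u⁻¹ g) Γ`.
  have hder : ∀ᶠ z in 𝓝 z₀, DifferentiableAt ℂ (fun z => B z * (Ring.inverse (u z) * p)) z ∧
      ∀ k, fderiv ℂ (fun z => B z * (Ring.inverse (u z) * p)) z (b k) =
        B z * (Ring.inverse (u z) * p) * (Γ k z * (Ring.inverse (u z) * p)) -
          (1 - B z * Ring.inverse (u z) * g) * Γ k z * (B z * (Ring.inverse (u z) * p)) := by
    filter_upwards [hB, hunit] with z hz hzu
    obtain ⟨w, hw⟩ := hzu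
    have hinv : Ring.inverse (u z) = ((w⁻¹ : Rˣ) : R) := by rw [← hw, Ring.inverse_unit]
    have d1 : HasFDerivAt B (fderiv ℂ B z) z := hz.1.hasFDerivAt
    have d2 : HasFDerivAt u (g • fderiv ℂ B z) z :=
      ((d1.sub_const (B z₀)).const_mul g).const_add 1
    have d3 := (hasFDerivAt_ringInverse (𝕜 := ℂ) w)
    rw [hw] at d3
    have d4 := (d3.comp z d2).mul_const' p
    have d5 := d1.mul' d4
    refine ⟨d5.differentiableAt, fun k => ?_⟩
    have e1 : fderiv ℂ (fun z => B z * (Ring.inverse (u z) * p)) z = _ := d5.fderiv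
    rw [e1, hinv]
    have hk := hz.2 k
    have hwu : (w : R) = 1 + g * B z - g * B z₀ := by rw [hw, hu]; noncomm_ring
    -- From `p = u - g B`; this turns `(1 - B u⁻¹ g) B` into `B u⁻¹ p = F`, which makes the equation
    -- homogeneous in `F`.
    have key : ((w⁻¹ : Rˣ) : R) * p = 1 - ((w⁻¹ : Rˣ) : R) * (g * B z) := by
      have : p = w - g * B z := by rw [hwu, hp]; noncomm_ring
      rw [this, mul_sub, Units.inv_mul]
    have e2 : B z * (((w⁻¹ : Rˣ) : R) * p) * (Γ k z * (((w⁻¹ : Rˣ) : R) * p)) =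
        B z * (1 - ((w⁻¹ : Rˣ) : R) * (g * B z)) * (Γ k z * (((w⁻¹ : Rˣ) : R) * p)) := by
      rw [key]
    simp only [hk, hinv, e2, Function.comp_apply, add_apply,
      smul_apply, ContinuousLinearMap.comp_apply,
      neg_apply, ContinuousLinearMap.mulLeftRight_apply, smul_eq_mul,
      MulOpposite.smul_eq_mul_unop, MulOpposite.unop_op]
    noncomm_ring
  cases nonempty_fintype κ
  set X : κ → E → R := fun k z => Γ k z * (Ring.inverse (u z) * p) with hX
  set Y : κ → E → R := fun k z => (1 - B z * Ring.inverse (u z) * g) * Γ k z with hY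
  -- Only boundedness of `X` and `Y` near `z₀` is needed, so `Γ` has to be merely continuous at
  -- `z₀`.
  have hXY : ∀ k, ∀ᶠ z in 𝓝 z₀, ‖X k z‖ + ‖Y k z‖ < ‖X k z₀‖ + ‖Y k z₀‖ + 1 := by
    intro k
    have hc : ContinuousAt (fun z => ‖X k z‖ + ‖Y k z‖) z₀ := by
      have := hΓ k
      fun_prop
    exact hc.eventually_lt continuousAt_const (lt_add_one _)
  refine eventually_eq_zero_of_norm_fderiv_le b (C := ∑ k, (‖X k z₀‖ + ‖Y k z₀‖ + 1)) ?_ ?_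
  · filter_upwards [hder, eventually_all.2 hXY] with z hz hzXY
    refine ⟨hz.1, fun k => ?_⟩
    have h1 : ‖X k z‖ + ‖Y k z‖ ≤ ∑ k, (‖X k z₀‖ + ‖Y k z₀‖ + 1) :=
      (hzXY k).le.trans (Finset.single_le_sum (f := fun k => ‖X k z₀‖ + ‖Y k z₀‖ + 1)
        (fun i _ => by positivity) (Finset.mem_univ k))
    rw [hz.2 k]
    set F := B z * (Ring.inverse (u z) * p)
    calc ‖F * X k z - Y k z * F‖ ≤ ‖F‖ * ‖X k z‖ + ‖Y k z‖ * ‖F‖ :=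
          (norm_sub_le _ _).trans (add_le_add (norm_mul_le _ _) (norm_mul_le _ _))
      _ = (‖X k z‖ + ‖Y k z‖) * ‖F‖ := by ring
      _ ≤ _ := by gcongr
  · change B z₀ * (Ring.inverse (u z₀) * p) = 0
    rw [hu0, Ring.inverse_one, one_mul, hp, mul_sub, mul_one, ← mul_assoc, hg, sub_self]

end LinearDifferentialEquations

/-! ### Jordan bases -/

section JordanBases

open Polynomial DirectSum

/-- A nilpotent endomorphism has a Jordan basis, consisting of the vectors `A ^ i (v j)` with
`i < l j`. -/
theorem exists_jordan_basis {V : Type*} [AddCommGroup V] [Module ℂ V] [FiniteDimensional ℂ V]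
    (A : Module.End ℂ V) (hA : IsNilpotent A) :
    ∃ (ι : Type) (_ : Fintype ι) (l : ι → ℕ) (v : ι → V), (∀ j, 0 < l j) ∧
      (∀ j, (A ^ l j) (v j) = 0) ∧
      LinearIndependent ℂ (fun p : Σ j, Fin (l j) => (A ^ (p.2 : ℕ)) (v p.1)) ∧
      Submodule.span ℂ (range fun p : Σ j, Fin (l j) => (A ^ (p.2 : ℕ)) (v p.1)) = ⊤ := by
  classical
  obtain ⟨N, hN⟩ := hA
  -- `V` becomes a `ℂ[X]`-module with `X` acting as `A`. Nilpotency makes it torsion for the powers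
  -- of `X`, hence a direct sum of cyclic modules `ℂ[X] / (X ^ k i)`; the chain heads are the
  -- generators `w i`.
  have htors : Module.IsTorsion' (Module.AEval' A) (Submonoid.powers (X : ℂ[X])) := by
    intro x
    obtain ⟨m, rfl⟩ := (Module.AEval'.of A).surjective x
    refine ⟨⟨X ^ N, N, rfl⟩, ?_⟩
    change (X ^ N : ℂ[X]) • Module.AEval'.of A m = 0
    rw [Module.AEval'.X_pow_smul_of, hN, zero_smul, map_zero]
  obtain ⟨d, k, ⟨φ⟩⟩ := Module.torsion_by_prime_power_decomposition irreducible_X htors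
  set w : Fin d → Module.AEval' A := fun i =>
    φ.symm (lof ℂ[X] (Fin d) (fun i => ℂ[X] ⧸ ℂ[X] ∙ (X : ℂ[X]) ^ k i) i
      (Submodule.Quotient.mk 1)) with hw
  set v : Fin d → V := fun i => (Module.AEval'.of A).symm (w i) with hv
  have hwv : ∀ i n, (X ^ n : ℂ[X]) • w i = Module.AEval'.of A ((A ^ n) (v i)) := by
    intro i n
    rw [← Module.End.smul_def, ← Module.AEval'.X_pow_smul_of]
    simp [hv]
  have hφw : ∀ i (f : ℂ[X]), φ (f • w i) =
      lof ℂ[X] (Fin d) (fun i => ℂ[X] ⧸ ℂ[X] ∙ (X : ℂ[X]) ^ k i) i (Submodule.Quotient.mk f) := by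
    intro i f
    rw [map_smul, hw]
    simp only [LinearEquiv.apply_symm_apply]
    rw [← map_smul, ← Submodule.Quotient.mk_smul, smul_eq_mul, mul_one]
  have hzero : ∀ i n, k i ≤ n → (A ^ n) (v i) = 0 := by
    intro i n hn
    refine (Module.AEval'.of A).injective ?_
    rw [map_zero, ← hwv]
    refine φ.injective ?_
    rw [hφw, map_zero]
    have : (Submodule.Quotient.mk (X ^ n) : ℂ[X] ⧸ ℂ[X] ∙ (X : ℂ[X]) ^ k i) = 0 := by
      rw [Submodule.Quotient.mk_eq_zero]
      exact Ideal.mem_span_singleton.2 (pow_dvd_pow _ hn)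
    rw [this, map_zero]
  -- Summands with `k i = 0` are zero modules; discarding them makes all chain lengths positive.
  refine ⟨{i // 0 < k i}, inferInstance, fun i => k i, fun i => v i, fun i => i.2,
    fun i => hzero i _ le_rfl, ?_, ?_⟩
  · rw [Fintype.linearIndependent_iff]
    rintro c hc ⟨i, n⟩
    -- The coefficients along a chain form a polynomial of degree less than `k i`. A linear relation
    -- makes it divisible by `X ^ k i`, so its coefficients vanish.
    set f : {i // 0 < k i} → ℂ[X] := fun i => ∑ n : Fin (k i), C (c ⟨i, n⟩) * X ^ (n : ℕ) with hf
    have h1 : ∑ i, f i • w i = 0 := by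
      have h2 : ∀ i, f i • w i =
          Module.AEval'.of A (∑ n : Fin (k i), c ⟨i, n⟩ • (A ^ (n : ℕ)) (v i)) := by
        intro i
        rw [hf, map_sum]
        simp only [Finset.sum_smul]
        refine Finset.sum_congr rfl fun n _ => ?_
        rw [mul_smul, hwv, map_smul]
        exact Module.AEval.C_smul _ _ _
      simp_rw [h2]
      rw [← map_sum, ← map_zero (Module.AEval'.of A)]
      congr 1
      rw [← hc, Fintype.sum_sigma]
    have h3 := congrArg φ h1
    rw [map_sum, map_zero] at h3
    simp_rw [hφw] at h3
    have h4 := congrArg (fun x => component ℂ[X] (Fin d)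
      (fun i => ℂ[X] ⧸ ℂ[X] ∙ (X : ℂ[X]) ^ k i) i x) h3
    simp only [map_sum, map_zero] at h4
    rw [Finset.sum_eq_single i] at h4
    · rw [component.lof_self, Submodule.Quotient.mk_eq_zero] at h4
      have h5 := X_pow_dvd_iff.1 (Ideal.mem_span_singleton.1 h4) n n.2
      rw [hf] at h5
      simp only [finsetSum_coeff, coeff_C_mul, coeff_X_pow] at h5
      rw [Finset.sum_eq_single n] at h5
      · simpa using h5
      · intro m _ hm
        rw [if_neg (fun h => hm (Fin.ext h.symm)), mul_zero]
      · simp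
    · intro j _ hj
      rw [component.of, dif_neg fun h => hj (Subtype.ext h)]
    · simp
  · refine eq_top_iff.2 fun m _ => ?_
    have hpoly : ∀ i (f : ℂ[X]), (Module.AEval'.of A).symm (f • w i) ∈ Submodule.span ℂ
        (range fun p : Σ j : {i // 0 < k i}, Fin (k j) => (A ^ (p.2 : ℕ)) (v p.1)) := by
      intro i f
      induction f using Polynomial.induction_on' with
      | add p q hp hq => rw [add_smul, map_add]; exact Submodule.add_mem _ hp hq
      | monomial n a =>
        rw [← C_mul_X_pow_eq_monomial, mul_smul, hwv,
          Module.AEval.C_smul, ← map_smul, LinearEquiv.symm_apply_apply]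
        refine Submodule.smul_mem _ _ ?_
        rcases lt_or_ge n (k i) with hn | hn
        · exact Submodule.subset_span ⟨⟨⟨i, by omega⟩, ⟨n, hn⟩⟩, rfl⟩
        · rw [hzero i n hn]; exact Submodule.zero_mem _
    have hgen : ∀ x : Module.AEval' A, (Module.AEval'.of A).symm x ∈ Submodule.span ℂ
        (range fun p : Σ j : {i // 0 < k i}, Fin (k j) => (A ^ (p.2 : ℕ)) (v p.1)) := by
      intro x
      obtain ⟨y, rfl⟩ := φ.symm.surjective x
      induction y using DirectSum.induction_on with
      | zero => simp
      | of i q =>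
        obtain ⟨f, rfl⟩ := Submodule.Quotient.mk_surjective _ q
        have h1 := hφw i f
        rw [← LinearEquiv.eq_symm_apply] at h1
        change (Module.AEval'.of A).symm (φ.symm (lof ℂ[X] (Fin d)
          (fun i => ℂ[X] ⧸ ℂ[X] ∙ (X : ℂ[X]) ^ k i) i (Submodule.Quotient.mk f))) ∈ _
        rw [← h1]
        exact hpoly i f
      | add y z hy hz => rw [map_add, map_add]; exact Submodule.add_mem _ hy hz
    simpa using hgen (Module.AEval'.of A m)

/-- A linear section of `T` onto its range extends to all of `V`, and any such extension serves. -/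
lemma exists_generalized_inverse {V : Type*} [AddCommGroup V] [Module ℂ V]
    (T : Module.End ℂ V) : ∃ g : Module.End ℂ V, T * g * T = T := by
  obtain ⟨s, hs⟩ := T.rangeRestrict.exists_rightInverse_of_surjective T.range_rangeRestrict
  obtain ⟨g, hg⟩ := s.exists_extend
  refine ⟨g, LinearMap.ext fun x => ?_⟩
  have h1 : g (T x) = s (T.rangeRestrict x) := by
    rw [← hg]; rfl
  have h2 := LinearMap.congr_fun hs (T.rangeRestrict x)
  have h3 := congrArg Subtype.val h2
  simpa [h1] using h3

end JordanBases

/-! ### Holomorphic Jordan bases of families with `∂ A = [A, Γ]`. -/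

section JordanFrames

variable {E : Type*} [NormedAddCommGroup E] [NormedSpace ℂ E] [FiniteDimensional ℂ E]
  {κ : Type*} [Finite κ] {V : Type*} [NormedAddCommGroup V] [NormedSpace ℂ V]
  [FiniteDimensional ℂ V]

omit [FiniteDimensional ℂ E] [Finite κ] in
-- The commutator with `Γ` is a derivation, so by the Leibniz rule the powers of a solution of `∂ B
-- = [B, Γ]` solve the same equation.
lemma fderiv_pow_eq_commutator {R : Type*} [NormedRing R] [NormedAlgebra ℂ R] {B : E → R}
    {z : E} (b : κ → E) (Γ : κ → R) (hB : DifferentiableAt ℂ B z)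
    (h : ∀ k, fderiv ℂ B z (b k) = B z * Γ k - Γ k * B z) (m : ℕ) :
    DifferentiableAt ℂ (fun z => B z ^ m) z ∧
      ∀ k, fderiv ℂ (fun z => B z ^ m) z (b k) = B z ^ m * Γ k - Γ k * B z ^ m := by
  induction m with
  | zero => simp
  | succ m ih =>
    have h1 := ih.1.hasFDerivAt.mul' hB.hasFDerivAt
    have h2 : (fun z => B z ^ (m + 1)) = (fun z => B z ^ m) * B := by
      funext z; exact pow_succ _ _
    rw [h2]
    refine ⟨h1.differentiableAt, fun k => ?_⟩
    rw [h1.fderiv]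
    simp only [add_apply, smul_apply, smul_eq_mul, MulOpposite.smul_eq_mul_unop,
      MulOpposite.unop_op, ih.2 k, h k]
    rw [pow_succ]
    noncomm_ring

/-- A holomorphic family of endomorphisms `A` with `∂ A = [A, Γ]`, nilpotent at `z₀`, has a
holomorphic Jordan basis near `z₀`; `c` is the dual basis. -/
theorem exists_holomorphic_jordan_basis (b : Module.Basis κ ℂ E) {A : E → V →L[ℂ] V} {z₀ : E}
    (hA : ContDiffAt ℂ ω A z₀) (Γ : κ → E → V →L[ℂ] V) (hΓ : ∀ k, ContinuousAt (Γ k) z₀)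
    (hAΓ : ∀ᶠ z in 𝓝 z₀, ∀ k, fderiv ℂ A z (b k) = A z * Γ k z - Γ k z * A z)
    (hnil : IsNilpotent (A z₀)) :
    ∃ (ι : Type) (_ : Fintype ι) (l : ι → ℕ) (v : ι → E → V)
      (c : (Σ j, Fin (l j)) → E → V →L[ℂ] ℂ), (∀ j, 0 < l j) ∧
      (∀ j, ContDiffAt ℂ ω (v j) z₀) ∧ (∀ p, ContDiffAt ℂ ω (c p) z₀) ∧
      Fintype.card (Σ j, Fin (l j)) = Module.finrank ℂ V ∧
      ∀ᶠ z in 𝓝 z₀, (∀ j, (A z ^ l j) (v j z) = 0) ∧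
        ∀ w, w = ∑ p, c p z w • (A z ^ (p.2 : ℕ)) (v p.1 z) := by
  classical
  have : CompleteSpace V := FiniteDimensional.complete ℂ V
  have hnil' : IsNilpotent ((A z₀ : V →L[ℂ] V) : V →ₗ[ℂ] V) := by
    obtain ⟨n, hn⟩ := hnil
    refine ⟨n, ?_⟩
    rw [← ContinuousLinearMap.toLinearMap_pow, hn]
    rfl
  obtain ⟨ι, _, l, v₀, hl, hv0, hli, hsp⟩ := exists_jordan_basis _ hnil'
  have hpow : ∀ n (x : V), ((A z₀ : V →ₗ[ℂ] V) ^ n) x = (A z₀ ^ n) x := by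
    intro n x
    rw [← ContinuousLinearMap.toLinearMap_pow]
    rfl
  simp only [hpow] at hv0 hli hsp
  have hg : ∀ j, ∃ g : V →L[ℂ] V, A z₀ ^ l j * g * A z₀ ^ l j = A z₀ ^ l j := by
    intro j
    obtain ⟨g, hg⟩ := exists_generalized_inverse ((A z₀ ^ l j : V →L[ℂ] V) : V →ₗ[ℂ] V)
    refine ⟨LinearMap.toContinuousLinearMap g, ContinuousLinearMap.ext fun x => ?_⟩
    exact LinearMap.congr_fun hg x
  choose g hg using hg
  have hpowc : ∀ n, ContDiffAt ℂ ω (fun z => A z ^ n) z₀ := by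
    intro n
    induction n with
    | zero => simpa using contDiffAt_const
    | succ n ih => simp only [pow_succ]; exact ih.clm_comp hA
  have hdiff : ∀ᶠ z in 𝓝 z₀, DifferentiableAt ℂ A z :=
    (hA.eventually (by simp)).mono fun z hz => hz.differentiableAt (by simp)
  -- Each chain head has its own correction, built from the power `A ^ l j` that annihilates it at
  -- `z₀`. Since `1 - g j (A z₀ ^ l j)` fixes `v₀ j`, the vanishing theorem applies to `u⁻¹ (v₀ j)`
  -- itself.
  set u : ι → E → V →L[ℂ] V := fun j z => 1 + g j * (A z ^ l j - A z₀ ^ l j) with hu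
  have hu0 : ∀ j, u j z₀ = 1 := fun j => by simp [hu]
  have huc : ∀ j, ContDiffAt ℂ ω (u j) z₀ := fun j =>
    contDiffAt_const.add (contDiffAt_const.clm_comp ((hpowc (l j)).sub contDiffAt_const))
  have hinv : ∀ {f : E → V →L[ℂ] V}, ContDiffAt ℂ ω f z₀ → f z₀ = 1 →
      ContDiffAt ℂ ω (fun z => Ring.inverse (f z)) z₀ := by
    intro f hf h1
    refine ContDiffAt.comp z₀ (g := Ring.inverse) ?_ hf
    rw [h1]
    exact contDiffAt_ringInverse ℂ (1 : (V →L[ℂ] V)ˣ)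
  set v : ι → E → V := fun j z => Ring.inverse (u j z) (v₀ j) with hv
  have hvc : ∀ j, ContDiffAt ℂ ω (v j) z₀ := fun j =>
    (hinv (huc j) (hu0 j)).clm_apply contDiffAt_const
  have hker : ∀ j, ∀ᶠ z in 𝓝 z₀, (A z ^ l j) (v j z) = 0 := by
    intro j
    have h1 := mul_inverse_eq_zero_of_fderiv_eq_commutator b (B := fun z => A z ^ l j) (z₀ := z₀)
      Γ hΓ (by
        filter_upwards [hdiff, hAΓ] with z h1 h2
        exact fderiv_pow_eq_commutator b (fun k => Γ k z) h1 h2 (l j)) (hg j)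
    filter_upwards [h1] with z hz
    have h2 := congrArg (fun T : V →L[ℂ] V => T (v₀ j)) hz
    simpa [hv, hu, hv0] using h2
  set β := Module.Basis.mk hli hsp.ge with hβ
  have hβ' : ∀ p, β p = (A z₀ ^ (p.2 : ℕ)) (v₀ p.1) := fun p => by simp [hβ]
  set e : (Σ j, Fin (l j)) → E → V := fun p z => (A z ^ (p.2 : ℕ)) (v p.1 z) with he
  -- `T z` sends the Jordan basis at `z₀` to the moved chains at `z`. It is the identity at `z₀`,
  -- hence invertible nearby, and composing the coordinates of `β` with its inverse gives the dual
  -- basis.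
  set T : E → V →L[ℂ] V := fun z =>
    ∑ p, (LinearMap.toContinuousLinearMap (β.coord p)).smulRight (e p z) with hT
  have hec : ∀ p, ContDiffAt ℂ ω (e p) z₀ := fun p => (hpowc _).clm_apply (hvc _)
  have hTc : ContDiffAt ℂ ω T z₀ := ContDiffAt.sum fun p _ =>
    ContDiffAt.smulRight contDiffAt_const (hec p)
  have hT0 : T z₀ = 1 := by
    refine ContinuousLinearMap.ext fun x => ?_
    have he0 : ∀ p, e p z₀ = β p := fun p => by simp [he, hv, hu0, hβ']
    simp [hT, he0, β.sum_repr]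
  refine ⟨ι, inferInstance, l, v, fun p z =>
    (LinearMap.toContinuousLinearMap (β.coord p)).comp (Ring.inverse (T z)), hl, hvc,
    fun p => contDiffAt_const.clm_comp (hinv hTc hT0),
    (Module.finrank_eq_card_basis β).symm, ?_⟩
  have hunit : ∀ᶠ z in 𝓝 z₀, IsUnit (T z) :=
    hTc.continuousAt.eventually (Units.isOpen.mem_nhds (by simp [hT0]))
  filter_upwards [hunit, eventually_all.2 hker] with z hz hk
  refine ⟨hk, fun w => ?_⟩
  have h1 := congrArg (fun S : V →L[ℂ] V => S w) (Ring.mul_inverse_cancel _ hz)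
  simp only [mul_apply_eq_comp, one_apply_eq_self] at h1
  conv_lhs => rw [← h1]
  simp [hT, he]

end JordanFrames

/-! ### Jordan frames -/

section CoordinateFields

variable {E : Type*} [NormedAddCommGroup E] [NormedSpace ℂ E] [FiniteDimensional ℂ E]
  {M : Type*} [TopologicalSpace M] [ChartedSpace E M] [IsManifold 𝓘(ℂ, E) ω M]

/-- The vector fields on `PLine × M` which are constant in a chart and tangent to `M`. -/
lemma exists_coordinate_field (t₀ : M) (ξ : E) :
    ∃ v : VField E M, ∀ᶠ y in 𝓝 (((1 : ℂ) : PLine), t₀), y ∈ regular M ∧ PoleFieldAt v y ∧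
      dlog v y = 0 ∧
      ∀ F : E → ℂ, DifferentiableAt ℂ F (extChartAt 𝓘(ℂ, E) t₀ y.2) →
        applyField v (fun y => F (extChartAt 𝓘(ℂ, E) t₀ y.2)) y =
          fderiv ℂ F (extChartAt 𝓘(ℂ, E) t₀ y.2) ξ := by
  have : CompleteSpace E := FiniteDimensional.complete ℂ E
  set x₀ : PLine × M := (((1 : ℂ) : PLine), t₀) with hx₀
  set ψ : PLine × M → ℂ × E := ⇑(extChartAt (model E) x₀) with hψ
  -- In the chart `ψ = (λ, φ)` the field is the constant vector `(0, ξ)`: its `λ`-component is zero,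
  -- which gives `dlog v = 0`, and it differentiates functions of `φ` in the direction `ξ`.
  set v : VField E M :=
    VectorField.mpullback (model E) 𝓘(ℂ, ℂ × E) ψ (fun _ => ((0 : ℂ), ξ)) with hv
  have hreg : x₀ ∈ regular M := ⟨by simp [hx₀], by simp [hx₀]⟩
  have hψ2 : ∀ y, (ψ y).2 = extChartAt 𝓘(ℂ, E) t₀ y.2 := fun y => by
    simp [hψ, hx₀]
  have hψ1 : ∀ y, y.1 ≠ .infty → (ψ y).1 = lam y.1 := by
    rintro ⟨l, t⟩ hl
    induction l using OnePoint.rec with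
    | infty => exact absurd rfl hl
    | coe z =>
      have hc : chartAt ℂ ((1 : ℂ) : PLine) = chartZero := if_neg (OnePoint.coe_ne_infty _)
      simp [hψ, hx₀, hc, chartZero_coe]
  refine ⟨v, ?_⟩
  filter_upwards [isOpen_regular.mem_nhds hreg,
    (isOpen_extChartAt_source (I := model E) x₀).mem_nhds (mem_extChartAt_source x₀)]
    with y hy hys
  have hsm : ContMDiffAt (model E) 𝓘(ℂ, ℂ × E) ω ψ y := contMDiffAt_extChartAt' (by simpa using hys)
  have hdiff : MDifferentiableAt (model E) 𝓘(ℂ, ℂ × E) ψ y := hsm.mdifferentiableAt (by simp)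
  have hinv := isInvertible_mfderiv_extChartAt (I := model E) hys
  have hvy : mfderiv (model E) 𝓘(ℂ, ℂ × E) ψ y (v y) = ((0 : ℂ), ξ) := hinv.self_apply_inverse _
  have hG : ∀ (G : ℂ × E → ℂ), DifferentiableAt ℂ G (ψ y) →
      applyField v (fun y => G (ψ y)) y = fderiv ℂ G (ψ y) ((0 : ℂ), ξ) := by
    intro G hG
    have h1 := mfderiv_comp y hG.mdifferentiableAt hdiff
    rw [mfderiv_eq_fderiv] at h1
    have h2 : applyField v (fun y => G (ψ y)) y =
      fderiv ℂ G (ψ y) (mfderiv (model E) 𝓘(ℂ, ℂ × E) ψ y (v y)) := by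
      change mfderiv (model E) 𝓘(ℂ, ℂ) (G ∘ ψ) y (v y) = _
      rw [h1]; rfl
    rw [h2, hvy]
  refine ⟨hy, HolFieldAt.poleFieldAt ?_ hy, ?_, ?_⟩
  · refine ContMDiffAt.mpullback_vectorField_preimage (n := ω) ?_ hsm hinv le_rfl
    exact contMDiffAt_vectorSpace_iff_contDiffAt.2 contDiffAt_const
  · have h1 : applyField v (fun y => lam y.1) y = applyField v (fun y => (ψ y).1) y := by
      rw [applyField, applyField]
      have : (fun y : PLine × M => lam y.1) =ᶠ[𝓝 y] fun y => (ψ y).1 := by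
        filter_upwards [isOpen_regular.mem_nhds hy] with z hz
        exact (hψ1 z hz.2).symm
      rw [this.mfderiv_eq]
      rfl
    rw [dlog, h1, hG Prod.fst differentiableAt_fst, fderiv_fst]
    simp
  · intro F hF
    rw [← hψ2] at hF
    have h1 := hG (fun p => F p.2) (hF.comp _ differentiableAt_snd)
    simp only [hψ2] at h1
    rw [h1]
    have h2 : HasFDerivAt (fun p : ℂ × E => F p.2)
        ((fderiv ℂ F (ψ y).2).comp (ContinuousLinearMap.snd ℂ ℂ E)) (ψ y) :=
      hF.hasFDerivAt.comp (ψ y) hasFDerivAt_snd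
    rw [h2.fderiv]
    simp [hψ2]

end CoordinateFields

/-! ### The matrix of `N` and its holomorphic Jordan frames. -/

section JordanFrame

lemma contDiffAt_comp_extChartAt_symm {E : Type*} [NormedAddCommGroup E] [NormedSpace ℂ E]
    {M : Type*} [TopologicalSpace M] [ChartedSpace E M] [IsManifold 𝓘(ℂ, E) ω M]
    {f : M → ℂ} {t₀ : M} {z : E} (hz : z ∈ (extChartAt 𝓘(ℂ, E) t₀).target)
    (hf : ContMDiffAt 𝓘(ℂ, E) 𝓘(ℂ, ℂ) ω f ((extChartAt 𝓘(ℂ, E) t₀).symm z)) :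
    ContDiffAt ℂ ω (fun z => f ((extChartAt 𝓘(ℂ, E) t₀).symm z)) z := by
  rw [← contMDiffAt_iff_contDiffAt]
  exact ContMDiffAt.comp (g := f) z hf
    ((contMDiffOn_extChartAt_symm t₀).contMDiffAt (extChartAt_target_mem_nhds' hz))

open HolFamily

variable {E : Type*} [NormedAddCommGroup E] [NormedSpace ℂ E] [FiniteDimensional ℂ E]
  {M : Type*} [TopologicalSpace M] [ChartedSpace E M] [IsManifold 𝓘(ℂ, E) ω M]
  {H : HolFamily (PLine × M)} {D : Conn E H} {P : Pairing H} {N : ∀ x, Module.End ℂ (H.fiber x)}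

omit [FiniteDimensional ℂ E] in
/-- In a frame over `PLine × V` the matrix of `N` is holomorphic and does not depend on the
coordinate of the projective line. -/
lemma IsNilpotentData.exists_matrix (hN : IsNilpotentData H D P N) (hH : H.IsBundle E) {n : ℕ}
    {e : Fin n → H.Sec} {V : Set M} (he : H.FrameOn E e (univ ×ˢ V)) :
    ∃ A : Fin n → Fin n → M → ℂ, (∀ i j, ∀ t ∈ V, ContMDiffAt 𝓘(ℂ, E) 𝓘(ℂ, ℂ) ω (A i j) t) ∧
      ∀ j, ∀ y ∈ (univ : Set PLine) ×ˢ V, N y (e j y) = ∑ i, A i j y.2 • e i y := by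
  classical
  have hex : ∀ (j : Fin n) (t : M), ∃ f : Fin n → ℂ, t ∈ V →
      N (((0 : ℂ) : PLine), t) (e j (((0 : ℂ) : PLine), t)) =
        ∑ i, f i • e i (((0 : ℂ) : PLine), t) := by
    intro j t
    by_cases ht : t ∈ V
    · obtain ⟨f, hf⟩ := he.exists_coeff (y := (((0 : ℂ) : PLine), t)) ⟨trivial, ht⟩
        (N _ (e j (((0 : ℂ) : PLine), t)))
      exact ⟨f, fun _ => hf⟩
    · exact ⟨0, fun h => absurd h ht⟩
  choose f hf using hex
  have hA : ∀ i j, ∀ t ∈ V, ContMDiffAt 𝓘(ℂ, E) 𝓘(ℂ, ℂ) ω (fun t => f j t i) t := by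
    intro i j t ht
    have hmem : (((0 : ℂ) : PLine), t) ∈ (univ : Set PLine) ×ˢ V := ⟨trivial, ht⟩
    obtain ⟨g, hg, hge⟩ := he.exists_holomorphic_coeff hmem
      (hN.hol _ _ (he.holAt_apply hmem j))
    -- Holomorphy in `t` is read off on the slice `λ = 0`, where the entries are the coefficients of
    -- the holomorphic section `N (e j)`.
    have hι : ContMDiffAt 𝓘(ℂ, E) (model E) ω (fun t : M => (((0 : ℂ) : PLine), t)) t :=
      contMDiffAt_const.prodMk contMDiffAt_id
    refine (ContMDiffAt.comp t (hg i) hι).congr_of_eventuallyEq ?_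
    filter_upwards [hι.continuousAt.eventually hge] with s hs
    exact congrFun (he.coeff_unique hs.1 ((hf j s hs.1.2).symm.trans hs.2)) i
  refine ⟨fun i j t => f j t i, hA, ?_⟩
  rintro j ⟨l, t⟩ ⟨-, ht⟩
  -- The comparison section has coefficients independent of `λ` and is holomorphic along all of
  -- `PLine × {t}`, so the identity at `λ = 0` spreads to every `λ`.
  refine hN.const t (e j) (fun y => ∑ i, f j y.2 i • e i y) (fun l => ?_) (hf j t ht) l
  have hmem : (l, t) ∈ (univ : Set PLine) ×ˢ V := ⟨trivial, ht⟩
  refine ⟨he.holAt_apply hmem j, hH.holAt_sum fun i _ => hH.holAt_smul ?_ (he.holAt_apply hmem i)⟩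
  exact ContMDiffAt.comp (f := Prod.snd) (g := fun t => f j t i) ((l, t) : PLine × M)
    (hA i j t ht) contMDiffAt_snd

/-- The differential equations satisfied by the matrix of `N`. -/
lemma IsNilpotentData.fderiv_matrix (hN : IsNilpotentData H D P N) (hD : IsFlatConn H D)
    (hH : H.IsBundle E) {n : ℕ} {e : Fin n → H.Sec} {V : Set M}
    (he : H.FrameOn E e (univ ×ˢ V)) {A : Fin n → Fin n → M → ℂ}
    (hA : ∀ i j, ∀ t ∈ V, ContMDiffAt 𝓘(ℂ, E) 𝓘(ℂ, ℂ) ω (A i j) t)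
    (hNA : ∀ j, ∀ y ∈ (univ : Set PLine) ×ˢ V, N y (e j y) = ∑ i, A i j y.2 • e i y)
    {t₀ : M} (ht₀ : t₀ ∈ V) (ξ : E) :
    ∃ Γ : Fin n → Fin n → E → ℂ,
      (∀ i j, ContinuousAt (Γ i j) (extChartAt 𝓘(ℂ, E) t₀ t₀)) ∧
      ∀ᶠ z in 𝓝 (extChartAt 𝓘(ℂ, E) t₀ t₀), ∀ i j,
        fderiv ℂ (fun z => A i j ((extChartAt 𝓘(ℂ, E) t₀).symm z)) z ξ =
          ∑ l, A i l ((extChartAt 𝓘(ℂ, E) t₀).symm z) * Γ l j z -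
            ∑ l, Γ i l z * A l j ((extChartAt 𝓘(ℂ, E) t₀).symm z) := by
  set φ := extChartAt 𝓘(ℂ, E) t₀ with hφ
  -- As `A` does not depend on `λ`, one slice suffices. The slice `λ = 1` avoids `0` and infinity,
  -- where the commutation rule is not imposed.
  set x₀ : PLine × M := (((1 : ℂ) : PLine), t₀) with hx₀
  have hx₀V : x₀ ∈ (univ : Set PLine) ×ˢ V := ⟨trivial, ht₀⟩
  obtain ⟨v, hv⟩ := exists_coordinate_field (E := E) t₀ ξ
  have hex : ∀ j, ∃ f : Fin n → PLine × M → ℂ, (∀ i, HolFunAt E (f i) x₀) ∧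
      ∀ᶠ z in 𝓝 x₀, z ∈ (univ : Set PLine) ×ˢ V ∧ D v (e j) z = ∑ i, f i z • e i z := fun j =>
    he.exists_holomorphic_coeff hx₀V
      (hD.hol x₀ v _ hv.self_of_nhds.2.1 (he.holAt_apply hx₀V j))
  choose f hf hDf using hex
  have hφs : ContinuousAt φ.symm (φ t₀) := continuousAt_extChartAt_symm t₀
  have hφt : φ.symm (φ t₀) = t₀ := extChartAt_to_inv t₀
  have hι : Tendsto (fun z => (((1 : ℂ) : PLine), φ.symm z)) (𝓝 (φ t₀)) (𝓝 x₀) := by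
    have : ContinuousAt (fun z => (((1 : ℂ) : PLine), φ.symm z)) (φ t₀) :=
      continuousAt_const.prodMk hφs
    rwa [ContinuousAt, hφt] at this
  refine ⟨fun i j z => f j i (((1 : ℂ) : PLine), φ.symm z), fun i j => ?_, ?_⟩
  · have h1 : Tendsto (fun z => f j i (((1 : ℂ) : PLine), φ.symm z)) (𝓝 (φ t₀))
        (𝓝 (f j i (((1 : ℂ) : PLine), φ.symm (φ t₀)))) := by
      rw [hφt]
      exact (hf j i).continuousAt.tendsto.comp hι
    exact h1
  filter_upwards [hι.eventually hv, hι.eventually (eventually_all.2 hDf),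
    extChartAt_target_mem_nhds (I := 𝓘(ℂ, E)) t₀] with z h1 h2 h3 i j
  set x : PLine × M := (((1 : ℂ) : PLine), φ.symm z) with hx
  have hzφ : φ (φ.symm z) = z := φ.right_inv h3
  by_cases hn : Nonempty (Fin n)
  swap
  · exact absurd ⟨i⟩ hn
  have hxV : x ∈ (univ : Set PLine) ×ˢ V := (h2 i).1
  have hAx : ∀ i j, HolFunAt E (fun y : PLine × M => A i j y.2) x := fun i j =>
    ContMDiffAt.comp (f := Prod.snd) (g := A i j) x (hA i j _ hxV.2) contMDiffAt_snd
  have hflat := hN.flat x v (e j) h1.1.1 h1.1.2 h1.2.1 (he.holAt_apply hxV j)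
  -- For this field `dlog v = 0`, so `N` commutes with `D v`.
  rw [h1.2.2.1, zero_smul, sub_eq_zero] at hflat
  have hcongr : D v (fun y => N y (e j y)) x = D v (fun y => ∑ i, A i j y.2 • e i y) x := by
    refine hD.congr x v v _ _ h1.2.1 (hN.hol _ _ (he.holAt_apply hxV j)) (by simp) ?_
    filter_upwards [he.isOpen.mem_nhds hxV] with y hy
    exact hNA j y hy
  rw [hcongr, hD.apply_sum hH h1.2.1 fun i _ => hH.holAt_smul (hAx i j) (he.holAt_apply hxV i)]
    at hflat
  have hleib : ∀ i, D v (fun y => A i j y.2 • e i y) x =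
      applyField v (fun y => A i j y.2) x • e i x + A i j x.2 • D v (e i) x := fun i =>
    hD.leibniz x v _ _ h1.2.1 (hAx i j) (he.holAt_apply hxV i)
  simp only [hleib, (h2 _).2, map_sum, map_smul, hNA _ x hxV, Finset.smul_sum, smul_smul,
    Finset.sum_add_distrib] at hflat
  rw [Finset.sum_comm (f := fun i l => (A i j x.2 * f i l x) • e l x),
    Finset.sum_comm (f := fun l i => (f j l x * A i l x.2) • e i x)] at hflat
  simp only [← Finset.sum_smul] at hflat
  rw [← Finset.sum_add_distrib] at hflat
  simp only [← add_smul] at hflat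
  -- Both sides are now expanded in the frame; equality of the coefficients of `e i` is the `(i, j)`
  -- entry of `∂ A + Γ A = A Γ`.
  have hcoef := congrFun (he.coeff_unique hxV hflat) i
  have hder : applyField v (fun y => A i j y.2) x = fderiv ℂ (fun z => A i j (φ.symm z)) z ξ := by
    have h4 : ContDiffAt ℂ ω (fun z => A i j (φ.symm z)) z :=
      contDiffAt_comp_extChartAt_symm h3 (hA i j _ hxV.2)
    have h5 := h1.2.2.2 (fun z => A i j (φ.symm z)) (by
      change DifferentiableAt ℂ _ (φ (φ.symm z))
      rw [hzφ]; exact h4.differentiableAt (by simp))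
    change _ = fderiv ℂ (fun z => A i j (φ.symm z)) (φ (φ.symm z)) ξ at h5
    rw [hzφ] at h5
    rw [← h5, applyField, applyField]
    have h6 : (fun y : PLine × M => A i j y.2) =ᶠ[𝓝 x]
        fun y => A i j (φ.symm (φ y.2)) := by
      have h7 : ∀ᶠ y : PLine × M in 𝓝 x, y.2 ∈ φ.source :=
        continuous_snd.continuousAt.eventually
          ((isOpen_extChartAt_source (I := 𝓘(ℂ, E)) t₀).mem_nhds (φ.map_target h3))
      filter_upwards [h7] with y hy
      rw [φ.left_inv hy]
    rw [h6.mfderiv_eq]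
    rfl
  rw [← hder, eq_sub_of_add_eq hcoef]
  simp only [mul_comm (f j _ x), mul_comm (f _ i x)]
  rfl

/-- The continuous linear map given by a matrix. -/
def matrixCLM (n : ℕ) : (Fin n → Fin n → ℂ) →L[ℂ] (Fin n → ℂ) →L[ℂ] (Fin n → ℂ) :=
  LinearMap.toContinuousLinearMap
    { toFun := fun a => LinearMap.toContinuousLinearMap (Matrix.toLin' (Matrix.of a))
      map_add' := fun a b => by
        rw [← map_add, ← map_add]; rfl
      map_smul' := fun c a => by
        rw [RingHom.id_apply, ← map_smul, ← map_smul]; rfl }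

lemma matrixCLM_apply {n : ℕ} (a : Fin n → Fin n → ℂ) (w : Fin n → ℂ) (i : Fin n) :
    matrixCLM n a w i = ∑ j, a i j * w j := rfl

lemma matrixCLM_mul {n : ℕ} (a b : Fin n → Fin n → ℂ) :
    matrixCLM n a * matrixCLM n b = matrixCLM n fun i j => ∑ l, a i l * b l j := by
  ext w i
  simp only [mul_apply_eq_comp, matrixCLM_apply, Finset.mul_sum, Finset.sum_mul]
  rw [Finset.sum_comm]
  simp only [mul_assoc]

/-- Near every `PLine × {t₀}` there is a holomorphic Jordan frame for `N`. -/
theorem IsNilpotentData.exists_jordan_frame (hN : IsNilpotentData H D P N) (hT : IsTrTLE H D)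
    (t₀ : M) :
    ∃ (ι : Type) (_ : Fintype ι) (l : ι → ℕ) (e : (Σ j, Fin (l j)) → H.Sec) (V : Set M),
      (∀ j, 0 < l j) ∧ IsOpen V ∧ t₀ ∈ V ∧ H.FrameOn E e (univ ×ˢ V) ∧
      ∀ y ∈ (univ : Set PLine) ×ˢ V, ∀ p : Σ j, Fin (l j),
        N y (e p y) = if h : (p.2 : ℕ) + 1 < l p.1 then e ⟨p.1, ⟨p.2 + 1, h⟩⟩ y else 0 := by
  obtain ⟨n, e, V, hV, ht₀, he⟩ := hT.trivial.exists_frameOn t₀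
  obtain ⟨A, hA, hNA⟩ := hN.exists_matrix hT.bundle he
  set φ := extChartAt 𝓘(ℂ, E) t₀ with hφ
  set β := Module.finBasis ℂ E with hβ
  have hφt : φ.symm (φ t₀) = t₀ := extChartAt_to_inv t₀
  choose Γ hΓc hΓ using fun k =>
    hN.fderiv_matrix hT.conn hT.bundle he hA hNA ht₀ (β k)
  set a : E → Fin n → Fin n → ℂ := fun z i j => A i j (φ.symm z) with ha
  set Φ : ∀ y, (Fin n → ℂ) →ₗ[ℂ] H.fiber y := fun y =>
    Fintype.linearCombination ℂ (fun i => e i y) with hΦ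
  have hNΦ : ∀ y ∈ (univ : Set PLine) ×ˢ V, ∀ w,
      N y (Φ y w) = Φ y (matrixCLM n (fun i j => A i j y.2) w) := by
    intro y hy w
    simp only [hΦ, Fintype.linearCombination_apply, map_sum, map_smul, hNA _ y hy,
      matrixCLM_apply, Finset.smul_sum, Finset.sum_smul, smul_smul]
    rw [Finset.sum_comm]
    simp only [mul_comm (w _)]
  have hs : ∀ᶠ z in 𝓝 (φ t₀), z ∈ φ.target ∧ φ.symm z ∈ V := by
    refine Filter.Eventually.and (extChartAt_target_mem_nhds (I := 𝓘(ℂ, E)) t₀) ?_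
    exact (continuousAt_extChartAt_symm t₀).eventually (hV.mem_nhds (by rwa [hφt]))
  have hac : ∀ z, z ∈ φ.target → φ.symm z ∈ V → ContDiffAt ℂ ω a z := fun z h1 h2 =>
    contDiffAt_pi.2 fun i => contDiffAt_pi.2 fun j =>
      contDiffAt_comp_extChartAt_symm h1 (hA i j _ h2)
  have hAc : ∀ᶠ z in 𝓝 (φ t₀), ContDiffAt ℂ ω (fun z => matrixCLM n (a z)) z := by
    filter_upwards [hs] with z hz
    exact (matrixCLM n).contDiff.contDiffAt.comp z (hac z hz.1 hz.2)
  -- Nilpotency is needed at the centre only, and is transferred from the fibre over `(0, t₀)` by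
  -- injectivity of `Φ` there.
  have hnil : IsNilpotent (matrixCLM n (a (φ t₀))) := by
    have hy : (((0 : ℂ) : PLine), t₀) ∈ (univ : Set PLine) ×ˢ V := ⟨trivial, ht₀⟩
    obtain ⟨m, hm⟩ := hN.nilpotent (((0 : ℂ) : PLine), t₀)
    have hpow : ∀ m w, (N _ ^ m) (Φ (((0 : ℂ) : PLine), t₀) w) =
        Φ _ ((matrixCLM n (a (φ t₀)) ^ m) w) := by
      intro m
      induction m with
      | zero => intro w; simp
      | succ m ih =>
        intro w
        rw [pow_succ, pow_succ, Module.End.mul_apply, hNΦ _ hy, ih, mul_apply_eq_comp]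
        simp only [ha, hφt]
    refine ⟨m, ContinuousLinearMap.ext fun w => ?_⟩
    refine he.coeff_unique hy ?_
    have := hpow m w
    rw [hm] at this
    simpa [hΦ, Fintype.linearCombination_apply] using this.symm
  have hcomm : ∀ᶠ z in 𝓝 (φ t₀), ∀ k, fderiv ℂ (fun z => matrixCLM n (a z)) z (β k) =
      matrixCLM n (a z) * matrixCLM n (fun i j => Γ k i j z) -
        matrixCLM n (fun i j => Γ k i j z) * matrixCLM n (a z) := by
    filter_upwards [hs, eventually_all.2 hΓ] with z hz hzΓ k
    have hd : DifferentiableAt ℂ a z := (hac z hz.1 hz.2).differentiableAt (by simp)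
    have h1 : HasFDerivAt (fun z => matrixCLM n (a z)) ((matrixCLM n).comp (fderiv ℂ a z)) z :=
      (matrixCLM n).hasFDerivAt.comp z hd.hasFDerivAt
    have h2 : fderiv ℂ a z (β k) =
        (fun i j => ∑ l, a z i l * Γ k l j z) - fun i j => ∑ l, Γ k i l z * a z l j := by
      funext i j
      have h3 := hasFDerivAt_pi'.1 (hasFDerivAt_pi'.1 hd.hasFDerivAt i) j
      have h4 := congrArg (fun L => L (β k)) h3.fderiv
      exact h4.symm.trans (hzΓ k i j)
    rw [h1.fderiv, matrixCLM_mul, matrixCLM_mul, ← map_sub, ← h2]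
    rfl
  obtain ⟨ι, _, l, v, c, hl, hvc, hcc, hcard, hvz⟩ := exists_holomorphic_jordan_basis β
    hAc.self_of_nhds (fun k z => matrixCLM n fun i j => Γ k i j z)
    (fun k => (matrixCLM n).continuous.continuousAt.comp
      (continuousAt_pi.2 fun i => continuousAt_pi.2 fun j => hΓc k i j)) hcomm hnil
  have hpowc : ∀ m, ∀ z, ContDiffAt ℂ ω (fun z => matrixCLM n (a z)) z →
      ContDiffAt ℂ ω (fun z => matrixCLM n (a z) ^ m) z := by
    intro m z hz
    induction m with
    | zero => simpa using contDiffAt_const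
    | succ m ih => simp only [pow_succ]; exact ih.clm_comp hz
  have hev : ∀ᶠ t in 𝓝 t₀, t ∈ φ.source ∧ t ∈ V ∧
      ContDiffAt ℂ ω (fun z => matrixCLM n (a z)) (φ t) ∧ (∀ j, ContDiffAt ℂ ω (v j) (φ t)) ∧
      (∀ p, ContDiffAt ℂ ω (c p) (φ t)) ∧ (∀ j, (matrixCLM n (a (φ t)) ^ l j) (v j (φ t)) = 0) ∧
        ∀ w, w = ∑ p, c p (φ t) w • (matrixCLM n (a (φ t)) ^ (p.2 : ℕ)) (v p.1 (φ t)) := by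
    have hφc : Tendsto φ (𝓝 t₀) (𝓝 (φ t₀)) := continuousAt_extChartAt t₀
    filter_upwards [(isOpen_extChartAt_source (I := 𝓘(ℂ, E)) t₀).mem_nhds
      (mem_extChartAt_source t₀), hV.mem_nhds ht₀, hφc.eventually hAc,
      hφc.eventually (eventually_all.2 fun j => (hvc j).eventually (by simp)),
      hφc.eventually (eventually_all.2 fun p => (hcc p).eventually (by simp)),
      hφc.eventually hvz] with t h1 h2 h3 h4 h5 h6
    exact ⟨h1, h2, h3, h4, h5, h6.1, h6.2⟩
  obtain ⟨V', hV', hV'o, ht₀'⟩ := eventually_nhds_iff.1 hev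
  have haφ : ∀ t ∈ V', a (φ t) = fun i j => A i j t := by
    intro t ht
    funext i j
    simp only [ha]
    rw [φ.left_inv (hV' t ht).1]
  have hhol : ∀ (F : E → ℂ), ∀ y ∈ (univ : Set PLine) ×ˢ V', ContDiffAt ℂ ω F (φ y.2) →
      HolFunAt E (fun y => F (φ y.2)) y := by
    intro F y hy hF
    have h1 : ContMDiffAt 𝓘(ℂ, E) 𝓘(ℂ, E) ω φ y.2 :=
      contMDiffAt_extChartAt' (by simpa [hφ] using (hV' _ hy.2).1)
    exact ContMDiffAt.comp (g := fun t => F (φ t)) y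
      (ContMDiffAt.comp y.2 hF.contMDiffAt h1) contMDiffAt_snd
  -- The Jordan basis found on `M` is transported by the original frame, with coefficients
  -- independent of `λ`; this is why the new frame is defined over all of `PLine × V'`. The inverse
  -- change of frame applies the dual basis `c` to the standard vectors.
  set e' : (Σ j, Fin (l j)) → H.Sec := fun p y =>
    Φ y ((matrixCLM n (a (φ y.2)) ^ (p.2 : ℕ)) (v p.1 (φ y.2))) with he'
  refine ⟨ι, inferInstance, l, e', V', hl, hV'o, ht₀', ?_, ?_⟩
  · refine (he.mono (isOpen_univ.prod hV'o) (prod_mono_right fun t ht => (hV' t ht).2.1)).change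
      (by simpa using hcard) e'
      (fun p i y => (matrixCLM n (a (φ y.2)) ^ (p.2 : ℕ)) (v p.1 (φ y.2)) i)
      (fun i p y => c p (φ y.2) (Pi.single i 1)) ?_ ?_ ?_ ?_
    · intro p i y hy
      refine hhol (fun z => (matrixCLM n (a z) ^ (p.2 : ℕ)) (v p.1 z) i) y hy ?_
      have h := hV' _ hy.2
      exact contDiffAt_pi.1 ((hpowc _ _ h.2.2.1).clm_apply (h.2.2.2.1 p.1)) i
    · intro i p y hy
      have h := hV' _ hy.2
      exact hhol (fun z => c p z (Pi.single i 1)) y hy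
        ((h.2.2.2.2.1 p).clm_apply contDiffAt_const)
    · intro p y hy
      simp [he', hΦ, Fintype.linearCombination_apply]
    · intro i y hy
      have h := congrArg (Φ y) ((hV' _ hy.2).2.2.2.2.2.2 (Pi.single i 1))
      simpa [hΦ, he', Fintype.linearCombination_apply_single] using h
  · rintro y hy ⟨j, i⟩
    have h1 : N y (e' ⟨j, i⟩ y) =
        Φ y ((matrixCLM n (a (φ y.2)) ^ ((i : ℕ) + 1)) (v j (φ y.2))) := by
      simp only [he']
      rw [hNΦ y ⟨trivial, (hV' _ hy.2).2.1⟩, ← haφ _ hy.2, pow_succ', mul_apply_eq_comp]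
    rw [h1]
    split_ifs with h
    · rfl
    · have h2 : (i : ℕ) + 1 = l j := by
        have := i.2
        simp only at h
        omega
      rw [h2, (hV' _ hy.2).2.2.2.2.2.1 j, map_zero]

end JordanFrame

open HolFamily

/-! ### Filtrations with adapted frames -/

section AdaptedFrames

variable {E : Type*} [NormedAddCommGroup E] [NormedSpace ℂ E]
  {M : Type*} [TopologicalSpace M] [ChartedSpace E M]
  {H : HolFamily (PLine × M)}

variable (E) in
/-- Near every `PLine × {t}` there is a frame of `H` parts of which span the steps of the
filtration. -/
def HasAdaptedFrames (H : HolFamily (PLine × M)) (W : ℤ → ∀ x, Submodule ℂ (H.fiber x)) : Prop :=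
  ∀ t : M, ∃ (ι : Type) (_ : Fintype ι) (e : ι → H.Sec) (V : Set M) (S : ℤ → Set ι),
    IsOpen V ∧ t ∈ V ∧ H.FrameOn E e (univ ×ˢ V) ∧
    ∀ k, ∀ y ∈ (univ : Set PLine) ×ˢ V, W k y = Submodule.span ℂ ((fun i => e i y) '' S k)

variable {W : ℤ → ∀ x, Submodule ℂ (H.fiber x)}

/-- Both subspaces are coordinate subspaces for the same frame, so `W' ∩ W` is cut out inside `W` by
the vanishing of the coefficients outside `S'`. No inclusion between the two is needed. -/
lemma HolFamily.FrameOn.submoduleOf {ι : Type*} [Fintype ι] {e : ι → H.Sec}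
    {U : Set (PLine × M)} (he : H.FrameOn E e U) {S S' : Set ι} [Fintype S]
    {W W' : ∀ x, Submodule ℂ (H.fiber x)}
    (hW : ∀ y ∈ U, W y = Submodule.span ℂ ((fun i => e i y) '' S))
    (hW' : ∀ y ∈ U, W' y = Submodule.span ℂ ((fun i => e i y) '' S')) (y : PLine × M)
    (hy : y ∈ U) :
    (W' y).submoduleOf (W y) =
      Submodule.span ℂ ((fun i : S => (toSub W (e i) y : (H.sub W).fiber y)) '' {i | ↑i ∈ S'}) := by
  classical
  have hsub := he.sub hW
  have hmem : ∀ i : S, e i y ∈ W y := fun i => by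
    rw [hW y hy]; exact Submodule.subset_span ⟨i, i.2, rfl⟩
  ext a
  obtain ⟨f, hf⟩ := hsub.exists_coeff hy a
  have h1 : a ∈ (W' y).submoduleOf (W y) ↔ incl W y a ∈ W' y := Iff.rfl
  have h2 : incl W y a = ∑ i, (if hi : i ∈ S then f ⟨i, hi⟩ else 0) • e i y := by
    rw [hf, map_sum, ← sum_subtype_eq_sum (S := S) _ fun i hi => by simp [hi]]
    refine Finset.sum_congr rfl fun i _ => ?_
    rw [map_smul, incl_toSub (hmem i), dif_pos i.2]
  have h3 := hsub.mem_span_image_iff hy {i : S | ↑i ∈ S'} f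
  rw [← hf] at h3
  refine Iff.trans ?_ h3.symm
  rw [h1, h2, hW' y hy, he.mem_span_image_iff hy]
  constructor
  · intro h i hi
    have := h i hi
    rwa [dif_pos i.2] at this
  · intro h i hi
    by_cases hiS : i ∈ S
    · rw [dif_pos hiS]
      exact h ⟨i, hiS⟩ hi
    · rw [dif_neg hiS]

/-- The frame vectors indexed by `S k` but not by `S (k - 1)` induce a frame of the graded piece
over the same product `PLine × V`. -/
lemma HasAdaptedFrames.isTrivialAlong_gr (hW : HasAdaptedFrames E H W) (k : ℤ) :
    (gr H W k).IsTrivialAlong E := by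
  classical
  refine isTrivialAlong_of_frameOn fun t => ?_
  obtain ⟨ι, _, e, V, S, hV, ht, he, hWS⟩ := hW t
  refine ⟨_, inferInstance, _, V, hV, ht, (he.sub (hWS k)).quot (S := {i : S k | ↑i ∈ S (k - 1)})
    (W := fun y => (W (k - 1) y).submoduleOf (W k y)) ?_⟩
  exact he.submoduleOf (hWS k) (hWS (k - 1))

lemma HasAdaptedFrames.isSubbundle (hW : HasAdaptedFrames E H W) (k : ℤ) :
    H.IsSubbundle E (W k) := by
  intro x
  obtain ⟨ι, _, e, V, S, hV, ht, he, hWS⟩ := hW x.2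
  exact he.exists_isFrameAt_span (hWS k) ⟨trivial, ht⟩

lemma HasAdaptedFrames.isTrivialAlong (hW : HasAdaptedFrames E H W) : H.IsTrivialAlong E := by
  refine isTrivialAlong_of_frameOn fun t => ?_
  obtain ⟨ι, _, e, V, S, hV, ht, he, hWS⟩ := hW t
  exact ⟨ι, _, e, V, hV, ht, he⟩

lemma HasAdaptedFrames.isBundle_sub (hW : HasAdaptedFrames E H W) (k : ℤ) :
    (H.sub (W k)).IsBundle E := by
  classical
  refine (isTrivialAlong_of_frameOn fun t => ?_).isBundle
  obtain ⟨ι, _, e, V, S, hV, ht, he, hWS⟩ := hW t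
  exact ⟨_, inferInstance, _, V, hV, ht, he.sub (hWS k)⟩

variable [IsManifold 𝓘(ℂ, E) ω M] {D : Conn E H}

/-- The connection induced on a graded piece. -/
def grConn (D : Conn E H) (W : ℤ → ∀ x, Submodule ℂ (H.fiber x)) (k : ℤ) : Conn E (gr H W k) :=
  quotConn (subConn D (W k)) fun x => (W (k - 1) x).submoduleOf (W k x)

lemma isFlatSub_submoduleOf (hW : ∀ k, IsFlatSub H D (W k)) (k : ℤ) :
    IsFlatSub (H.sub (W k)) (subConn D (W k)) fun x => (W (k - 1) x).submoduleOf (W k x) := by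
  intro x v s hv hs hsW
  change incl (W k) x (subConn D (W k) v s x) ∈ W (k - 1) x
  rw [incl_subConn (hW k) hv hs]
  exact hW (k - 1) x v _ hv hs hsW

lemma inducedOnGr_grConn (hD : IsFlatConn H D) (hH : H.IsBundle E)
    (hF : HasAdaptedFrames E H W) (hW : ∀ k, IsFlatSub H D (W k)) (k : ℤ) :
    InducedOnGr H D W k (grConn D W k) := by
  intro x v s hv hs
  refine ⟨hW k x v _ hv hs (Eventually.of_forall fun y => (s y).2), ?_⟩
  have h1 := quotConn_apply (hD.sub hH (hW k)) (hF.isBundle_sub k) (isFlatSub_submoduleOf hW k)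
    (σ := fun y => grMk W k (s y)) hv hs (Eventually.of_forall fun y => rfl)
  refine h1.trans (congrArg _ ?_)
  refine incl_injective ?_
  rw [incl_subConn (hW k) hv hs]
  rfl

lemma isTrTLE_grConn (hD : IsFlatConn H D) (hH : H.IsBundle E)
    (hF : HasAdaptedFrames E H W) (hW : ∀ k, IsFlatSub H D (W k)) (k : ℤ) :
    IsTrTLE (gr H W k) (grConn D W k) where
  bundle := (hF.isTrivialAlong_gr k).isBundle
  trivial := hF.isTrivialAlong_gr k
  conn := (hD.sub hH (hW k)).quot (hF.isBundle_sub k) (isFlatSub_submoduleOf hW k)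

lemma HasAdaptedFrames.isFiltered (hF : HasAdaptedFrames E H W) (hD : IsFlatConn H D)
    (hW : ∀ k, IsFlatSub H D (W k)) (hmono : ∀ x, Monotone fun k => W k x)
    (hex : ∀ x, ∀ a : H.fiber x, ∃ k, a ∈ W k x) : IsFiltered H D W where
  trTLE := ⟨hF.isTrivialAlong.isBundle, hF.isTrivialAlong, hD⟩
  mono := hmono
  exhaustive := hex
  subbundle := hF.isSubbundle
  flat := hW
  graded k := ⟨grConn D W k, inducedOnGr_grConn hD hF.isTrivialAlong.isBundle hF hW k,
    isTrTLE_grConn hD hF.isTrivialAlong.isBundle hF hW k⟩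

end AdaptedFrames

open HolFamily

/-! ### The cokernel and its weight filtration in a Jordan frame -/

section JordanFrameOn

variable {E : Type*} [NormedAddCommGroup E] [NormedSpace ℂ E]
  {M : Type*} [TopologicalSpace M] [ChartedSpace E M]

variable (E) in
/-- `e` is a holomorphic Jordan frame for `N` over `U`. -/
structure JordanFrameOn (H : HolFamily (PLine × M)) (N : ∀ x, Module.End ℂ (H.fiber x))
    {ι : Type*} [Fintype ι] (l : ι → ℕ) (e : (Σ j, Fin (l j)) → H.Sec)
    (U : Set (PLine × M)) : Prop where
  pos : ∀ j, 0 < l j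
  frameOn : H.FrameOn E e U
  apply : ∀ y ∈ U, ∀ p : Σ j, Fin (l j),
    N y (e p y) = if h : (p.2 : ℕ) + 1 < l p.1 then e ⟨p.1, ⟨p.2 + 1, h⟩⟩ y else 0

variable {H : HolFamily (PLine × M)} {N : ∀ x, Module.End ℂ (H.fiber x)}
  {ι : Type*} [Fintype ι] {l : ι → ℕ} {e : (Σ j, Fin (l j)) → H.Sec} {U : Set (PLine × M)}

/-- The indices of the frame vectors in the image of `N`. -/
def imageIndices (l : ι → ℕ) : Set (Σ j, Fin (l j)) := {p | 0 < (p.2 : ℕ)}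

instance (l : ι → ℕ) : DecidablePred (· ∈ imageIndices l) := fun p =>
  inferInstanceAs (Decidable (0 < (p.2 : ℕ)))

instance (l : ι → ℕ) : Fintype ↥(imageIndices l)ᶜ :=
  inferInstanceAs (Fintype {p // ¬ p ∈ imageIndices l})

/-- The predecessor of an index in a Jordan chain. -/
def chainPred (p : Σ j, Fin (l j)) : Σ j, Fin (l j) :=
  ⟨p.1, ⟨p.2 - 1, (Nat.sub_le _ _).trans_lt p.2.2⟩⟩

namespace JordanFrameOn

lemma apply_chainPred (h : JordanFrameOn E H N l e U) {y : PLine × M} (hy : y ∈ U)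
    {p : Σ j, Fin (l j)} (hp : p ∈ imageIndices l) : N y (e (chainPred p) y) = e p y := by
  obtain ⟨j, i, hi⟩ := p
  have h0 : 0 < i := hp
  obtain ⟨i, rfl⟩ : ∃ k, i = k + 1 := ⟨i - 1, by omega⟩
  rw [h.apply y hy]
  simp [chainPred, hi]

lemma pow_apply (h : JordanFrameOn E H N l e U) {y : PLine × M} (hy : y ∈ U) (m : ℕ)
    (p : Σ j, Fin (l j)) :
    (N y ^ m) (e p y) = if h : (p.2 : ℕ) + m < l p.1 then e ⟨p.1, ⟨p.2 + m, h⟩⟩ y else 0 := by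
  induction m with
  | zero => simp
  | succ m ih =>
    rw [pow_succ', Module.End.mul_apply, ih]
    split_ifs with h1 h2 h2
    · rw [h.apply y hy]; simp [add_assoc, h2]
    · rw [h.apply y hy, dif_neg (by simpa [add_assoc] using h2)]
    · omega
    · simp

lemma range_eq (h : JordanFrameOn E H N l e U) (y : PLine × M) (hy : y ∈ U) :
    LinearMap.range (N y) = Submodule.span ℂ ((fun p => e p y) '' imageIndices l) := by
  refine le_antisymm ?_ ?_
  · rintro _ ⟨a, rfl⟩
    obtain ⟨f, rfl⟩ := h.frameOn.exists_coeff hy a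
    rw [map_sum]
    refine Submodule.sum_mem _ fun p _ => ?_
    rw [map_smul, h.apply y hy]
    refine Submodule.smul_mem _ _ ?_
    split_ifs with h1
    · exact Submodule.subset_span ⟨_, Nat.succ_pos _, rfl⟩
    · exact Submodule.zero_mem _
  · rw [Submodule.span_le]
    rintro _ ⟨p, hp, rfl⟩
    exact ⟨_, h.apply_chainPred hy hp⟩

/-- The frame of the cokernel given by the first vectors of the Jordan chains. -/
lemma frameOn_coker (h : JordanFrameOn E H N l e U) :
    (coker H N).FrameOn E (fun (q : ↥(imageIndices l)ᶜ) y => cokerMk H N y (e q y)) U :=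
  h.frameOn.quot h.range_eq

lemma cokerMk_eq (h : JordanFrameOn E H N l e U) {y : PLine × M} (hy : y ∈ U)
    (f : (Σ j, Fin (l j)) → ℂ) :
    cokerMk H N y (∑ p, f p • e p y) =
      ∑ q : ↥(imageIndices l)ᶜ, f q • cokerMk H N y (e q y) := by
  rw [map_sum, ← sum_subtype_eq_sum (S := (imageIndices l)ᶜ)]
  · exact Finset.sum_congr rfl fun q _ => map_smul _ _ _
  · intro p hp
    have h1 : cokerMk H N y (e p y) = 0 :=
      (Submodule.Quotient.mk_eq_zero _).2 ⟨_, h.apply_chainPred hy (not_not.1 hp)⟩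
    rw [map_smul, h1, smul_zero]

lemma pow_apply_eq_zero (h : JordanFrameOn E H N l e U) {y : PLine × M} (hy : y ∈ U) {m : ℕ}
    {q : Σ j, Fin (l j)} (hq : l q.1 ≤ m) : (N y ^ m) (e q y) = 0 := by
  rw [h.pow_apply hy, dif_neg (by omega)]

/-- `N ^ m` moves each vector `m` places along its chain, so the vector in position `m` of a chain
longer than `m` can only come from the head. Its coefficient in the image is therefore `f q`. -/
lemma coeff_eq_zero_of_pow_apply_eq_zero (h : JordanFrameOn E H N l e U) {y : PLine × M}
    (hy : y ∈ U) {m : ℕ} {f : (Σ j, Fin (l j)) → ℂ} (hf : (N y ^ m) (∑ p, f p • e p y) = 0)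
    {q : Σ j, Fin (l j)} (hq : q ∉ imageIndices l) (hm : m < l q.1) : f q = 0 := by
  classical
  obtain ⟨j, i⟩ := q
  have hi : (i : ℕ) = 0 := by simpa [imageIndices] using hq
  have h1 := congrArg (fun a => (h.frameOn.basisAt hy).repr a ⟨j, ⟨m, hm⟩⟩) hf
  have h2 : ∀ p, (h.frameOn.basisAt hy).repr ((N y ^ m) (e p y)) ⟨j, ⟨m, hm⟩⟩ =
      if p = ⟨j, i⟩ then 1 else 0 := by
    rintro ⟨j', i'⟩
    rw [h.pow_apply hy]
    split_ifs with h3 h4 h4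
    · obtain ⟨rfl, h5⟩ := Sigma.mk.inj_iff.1 h4
      obtain rfl := eq_of_heq h5
      rw [← h.frameOn.basisAt_apply hy]
      simp [hi]
    · rw [← h.frameOn.basisAt_apply hy, Module.Basis.repr_self, Finsupp.single_apply, if_neg]
      intro h5
      obtain ⟨rfl, h6⟩ := Sigma.mk.inj_iff.1 h5
      have h7 := eq_of_heq h6
      simp only [Fin.mk.injEq] at h7
      exact h4 (by congr 1; exact Fin.ext (by omega))
    · obtain ⟨rfl, h5⟩ := Sigma.mk.inj_iff.1 h4
      obtain rfl := eq_of_heq h5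
      exact absurd (by simpa [hi] using hm) h3
    · simp
  simpa [map_sum, map_smul, Finsupp.finsetSum_apply, h2] using h1

/-- A head is killed by `N ^ (k+1)` exactly when its chain has length at most `k + 1`, and vectors
that are not heads do not contribute to the cokernel. -/
lemma weight_eq (h : JordanFrameOn E H N l e U) (k : ℤ) (y : PLine × M) (hy : y ∈ U) :
    weight H N k y = Submodule.span ℂ ((fun q : ↥(imageIndices l)ᶜ => cokerMk H N y (e q y)) ''
      {q | (l q.1.1 : ℤ) ≤ k + 1}) := by
  rw [weight]
  split_ifs with hk
  -- For negative `k` the bound `k + 1` is at most zero, while every chain has positive length.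
  · have : {q : ↥(imageIndices l)ᶜ | (l q.1.1 : ℤ) ≤ k + 1} = ∅ := by
      ext q
      have := h.pos q.1.1
      simp only [mem_ofPred_eq, mem_empty_iff_false, iff_false]
      omega
    rw [this, image_empty, Submodule.span_empty]
  · obtain ⟨k, rfl⟩ := Int.eq_ofNat_of_zero_le (not_lt.1 hk)
    refine le_antisymm ?_ ?_
    · rintro _ ⟨a, ha, rfl⟩
      obtain ⟨f, rfl⟩ := h.frameOn.exists_coeff hy a
      rw [h.cokerMk_eq hy, h.frameOn_coker.mem_span_image_iff hy _ fun q => f q]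
      intro q hq
      refine h.coeff_eq_zero_of_pow_apply_eq_zero hy (m := k + 1) ha q.2 ?_
      simp only [mem_ofPred_eq] at hq
      omega
    · rw [Submodule.span_le]
      rintro _ ⟨q, hq, rfl⟩
      refine ⟨e q y, h.pow_apply_eq_zero hy ?_, rfl⟩
      simp only [mem_ofPred_eq] at hq
      simp only [Int.toNat_natCast]
      omega

end JordanFrameOn

end JordanFrameOn

/-! ### Lifting of sections, the induced connection, and flatness of the filtration. -/

section Cokernel

variable {E : Type*} [NormedAddCommGroup E] [NormedSpace ℂ E] [FiniteDimensional ℂ E]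
  {M : Type*} [TopologicalSpace M] [ChartedSpace E M] [IsManifold 𝓘(ℂ, E) ω M]
  {H : HolFamily (PLine × M)} {D : Conn E H} {P : Pairing H} {N : ∀ x, Module.End ℂ (H.fiber x)}

lemma IsNilpotentData.exists_jordanFrameOn (hN : IsNilpotentData H D P N) (hT : IsTrTLE H D)
    (t : M) :
    ∃ (ι : Type) (_ : Fintype ι) (l : ι → ℕ) (e : (Σ j, Fin (l j)) → H.Sec) (V : Set M),
      IsOpen V ∧ t ∈ V ∧ JordanFrameOn E H N l e (univ ×ˢ V) := by
  obtain ⟨ι, _, l, e, V, hl, hV, ht, he, hNe⟩ := hN.exists_jordan_frame hT t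
  exact ⟨ι, _, l, e, V, hV, ht, hl, he, hNe⟩

/-- Holomorphic sections with values in the image of `N` are locally in the image of `N`. -/
lemma IsNilpotentData.exists_preimage (hN : IsNilpotentData H D P N) (hT : IsTrTLE H D)
    {x : PLine × M} {s : H.Sec} (hs : H.HolAt s x)
    (hsN : ∀ᶠ y in 𝓝 x, s y ∈ LinearMap.range (N y)) :
    ∃ r : H.Sec, H.HolAt r x ∧ ∀ᶠ y in 𝓝 x, s y = N y (r y) := by
  obtain ⟨ι, _, l, e, V, hV, ht, he⟩ := hN.exists_jordanFrameOn hT x.2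
  have hxV : x ∈ (univ : Set PLine) ×ˢ V := ⟨trivial, ht⟩
  obtain ⟨f, hf, hsf⟩ := he.frameOn.exists_holomorphic_coeff hxV hs
  -- Each frame vector is shifted back by one place. A head is its own `chainPred` by truncated
  -- subtraction, which is harmless because its coefficient vanishes for sections in the image.
  refine ⟨fun y => ∑ p, f p y • e (chainPred p) y, hT.bundle.holAt_sum fun p _ =>
    hT.bundle.holAt_smul (hf p) (he.frameOn.holAt_apply hxV _), ?_⟩
  filter_upwards [hsf, hsN] with y h1 h2
  rw [he.range_eq y h1.1, h1.2, he.frameOn.mem_span_image_iff h1.1] at h2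
  rw [h1.2, map_sum]
  refine Finset.sum_congr rfl fun p _ => ?_
  rw [map_smul]
  by_cases hp : p ∈ imageIndices l
  · rw [he.apply_chainPred h1.1 hp]
  · rw [h2 p hp, zero_smul, zero_smul]

/-- Holomorphic sections of `W_k` are locally images of holomorphic sections of `Ker N ^ (k+1)`. -/
lemma IsNilpotentData.exists_lift_weight (hN : IsNilpotentData H D P N) (hT : IsTrTLE H D)
    (k : ℕ) {x : PLine × M} {s : H.Sec} (hs : H.HolAt s x)
    (hsW : ∀ᶠ y in 𝓝 x, cokerMk H N y (s y) ∈ weight H N k y) :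
    ∃ r : H.Sec, H.HolAt r x ∧ ∀ᶠ y in 𝓝 x,
      (N y ^ (k + 1)) (r y) = 0 ∧ cokerMk H N y (s y) = cokerMk H N y (r y) := by
  obtain ⟨ι, _, l, e, V, hV, ht, he⟩ := hN.exists_jordanFrameOn hT x.2
  have hxV : x ∈ (univ : Set PLine) ×ˢ V := ⟨trivial, ht⟩
  obtain ⟨f, hf, hsf⟩ := he.frameOn.exists_holomorphic_coeff hxV hs
  -- Keeping only the heads does not change the class in the cokernel, and for sections in `W_k`
  -- only heads of chains of length at most `k + 1` survive.
  refine ⟨fun y => ∑ q : ↥(imageIndices l)ᶜ, f q y • e q y, hT.bundle.holAt_sum fun p _ =>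
    hT.bundle.holAt_smul (hf p) (he.frameOn.holAt_apply hxV _), ?_⟩
  filter_upwards [hsf, hsW] with y h1 h2
  rw [h1.2, he.cokerMk_eq h1.1 (f · y)] at h2 ⊢
  rw [he.weight_eq k y h1.1,
    he.frameOn_coker.mem_span_image_iff h1.1 _ fun q : ↥(imageIndices l)ᶜ => f q y] at h2
  simp only [map_sum, map_smul, and_true]
  refine Finset.sum_eq_zero fun q _ => ?_
  by_cases hq : (l q.1.1 : ℤ) ≤ k + 1
  · rw [he.pow_apply_eq_zero h1.1 (by omega), smul_zero]
  · rw [h2 q hq, zero_smul]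

lemma IsNilpotentData.hasAdaptedFrames (hN : IsNilpotentData H D P N) (hT : IsTrTLE H D) :
    HasAdaptedFrames E (coker H N) (weight H N) := by
  intro t
  obtain ⟨ι, _, l, e, V, hV, ht, he⟩ := hN.exists_jordanFrameOn hT t
  exact ⟨↥(imageIndices l)ᶜ, _, fun q y => cokerMk H N y (e q y), V,
    fun k => {q | (l q.1.1 : ℤ) ≤ k + 1}, hV, ht, he.frameOn_coker, he.weight_eq⟩

omit [FiniteDimensional ℂ E] in
lemma IsNilpotentData.holAt_pow (hN : IsNilpotentData H D P N) (m : ℕ) {x : PLine × M} {s : H.Sec}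
    (hs : H.HolAt s x) : H.HolAt (fun y => (N y ^ m) (s y)) x := by
  induction m with
  | zero => simpa using hs
  | succ m ih => simpa only [pow_succ', Module.End.mul_apply] using hN.hol x _ ih

omit [FiniteDimensional ℂ E] in
/-- `[∇, N ^ m] = m N ^ m dλ / λ`. -/
lemma IsNilpotentData.apply_pow (hN : IsNilpotentData H D P N) (m : ℕ) {x : PLine × M}
    (hx : x ∈ regular M) {v : VField E M} (hv : PoleFieldAt v x) {s : H.Sec} (hs : H.HolAt s x) :
    D v (fun y => (N y ^ m) (s y)) x =
      (N x ^ m) (D v s x) + ((m : ℂ) * dlog v x) • (N x ^ m) (s x) := by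
  induction m with
  | zero => simp
  | succ m ih =>
    have h1 := hN.flat x v _ hx.1 hx.2 hv (hN.holAt_pow m hs)
    simp only [pow_succ', Module.End.mul_apply]
    rw [sub_eq_iff_eq_add.1 h1, ih, map_add, map_smul]
    push_cast
    module

/-- At regular points `D v (N r) = N (D v r) + dlog v • N r` is visibly in the image; the Jordan
frames carry this over `{0, infinity} × M`. -/
lemma IsNilpotentData.isFlatSub_range (hN : IsNilpotentData H D P N) (hT : IsTrTLE H D) :
    IsFlatSub H D fun x => LinearMap.range (N x) := by
  refine isFlatSub_of_regular hT.conn (fun t => ?_) (fun x v s hx hv hs hsN => ?_) hT.bundle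
  · obtain ⟨ι, _, l, e, V, hV, ht, he⟩ := hN.exists_jordanFrameOn hT t
    exact ⟨_, inferInstance, e, V, imageIndices l, ht, he.frameOn, he.range_eq⟩
  · obtain ⟨r, hr, hsr⟩ := hN.exists_preimage hT hs hsN
    rw [hT.conn.congr x v v s _ hv hs (by simp) hsr,
      sub_eq_iff_eq_add.1 (hN.flat x v r hx.1 hx.2 hv hr)]
    exact Submodule.add_mem _ (Submodule.smul_mem _ _ ⟨_, rfl⟩) ⟨_, rfl⟩

/-- The connection induced on the cokernel. -/
def cokerConn (D : Conn E H) (N : ∀ x, Module.End ℂ (H.fiber x)) : Conn E (coker H N) :=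
  quotConn D fun x => LinearMap.range (N x)

lemma IsNilpotentData.cokerConn_apply (hN : IsNilpotentData H D P N) (hT : IsTrTLE H D)
    {x : PLine × M} {v : VField E M} {σ : (coker H N).Sec} {s : H.Sec} (hv : PoleFieldAt v x)
    (hs : H.HolAt s x) (hσ : ∀ᶠ y in 𝓝 x, σ y = cokerMk H N y (s y)) :
    cokerConn D N v σ x = cokerMk H N x (D v s x) :=
  quotConn_apply hT.conn hT.bundle (hN.isFlatSub_range hT) hv hs hσ

lemma IsNilpotentData.isFlatConn_coker (hN : IsNilpotentData H D P N) (hT : IsTrTLE H D) :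
    IsFlatConn (coker H N) (cokerConn D N) :=
  hT.conn.quot hT.bundle (hN.isFlatSub_range hT)

/-- Holomorphic sections of the cokernel with values in `W_k` locally lift to holomorphic sections
of `Ker N ^ (k+1)`. -/
lemma IsNilpotentData.exists_lift (hN : IsNilpotentData H D P N) (hT : IsTrTLE H D)
    (k : ℕ) {x : PLine × M} {σ : (coker H N).Sec} (hσ : (coker H N).HolAt σ x)
    (hσW : ∀ᶠ y in 𝓝 x, σ y ∈ weight H N k y) :
    ∃ r : H.Sec, H.HolAt r x ∧ ∀ᶠ y in 𝓝 x,
      (N y ^ (k + 1)) (r y) = 0 ∧ σ y = cokerMk H N y (r y) := by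
  obtain ⟨s, hs, hσs⟩ := hσ
  replace hσs : ∀ᶠ y in 𝓝 x, σ y = cokerMk H N y (s y) := hσs
  obtain ⟨r, hr, hsr⟩ := hN.exists_lift_weight hT k hs (by
    filter_upwards [hσW, hσs] with y h1 h2
    rwa [← h2])
  refine ⟨r, hr, ?_⟩
  filter_upwards [hsr, hσs] with y h1 h2
  exact ⟨h1.1, h2.trans h1.2⟩

omit [FiniteDimensional ℂ E] in
/-- Off `{0, infinity} × M` the connection preserves the kernel of `N ^ m`. -/
lemma IsNilpotentData.pow_apply_conn_eq_zero (hN : IsNilpotentData H D P N) (hT : IsTrTLE H D)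
    (m : ℕ) {x : PLine × M} (hx : x ∈ regular M) {v : VField E M} (hv : PoleFieldAt v x)
    {r : H.Sec} (hr : H.HolAt r x) (hrN : ∀ᶠ y in 𝓝 x, (N y ^ m) (r y) = 0) :
    (N x ^ m) (D v r x) = 0 := by
  have h1 := hN.apply_pow m hx hv hr
  rw [hT.conn.congr x v v _ (fun _ => 0) hv (hN.holAt_pow m hr) (by simp) hrN,
    hT.conn.apply_zero hT.bundle hv, hrN.self_of_nhds, smul_zero, add_zero] at h1
  exact h1.symm

lemma weight_of_neg {k : ℤ} (hk : k < 0) (x : PLine × M) : weight H N k x = ⊥ := if_pos hk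

lemma weight_natCast (k : ℕ) (x : PLine × M) :
    weight H N k x = (LinearMap.ker (N x ^ (k + 1))).map (cokerMk H N x) := by
  rw [weight, if_neg (by omega), Int.toNat_natCast]

lemma cokerMk_mem_weight {k : ℕ} {x : PLine × M} {a : H.fiber x} (ha : (N x ^ (k + 1)) a = 0) :
    cokerMk H N x a ∈ weight H N k x := by
  rw [weight_natCast]
  exact ⟨a, ha, rfl⟩

/-- At regular points a section is lifted to `Ker N ^ (k+1)`, which the connection preserves there;
adapted frames extend the conclusion by continuity. -/
lemma IsNilpotentData.isFlatSub_weight (hN : IsNilpotentData H D P N) (hT : IsTrTLE H D) (k : ℤ) :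
    IsFlatSub (coker H N) (cokerConn D N) (weight H N k) := by
  have hF := hN.hasAdaptedFrames hT
  have hb := hF.isTrivialAlong.isBundle
  have hflat := hN.isFlatConn_coker hT
  refine isFlatSub_of_regular hflat (fun t => ?_) (fun x v σ hx hv hσ hσW => ?_) hb
  · obtain ⟨ι, _, e, V, S, hV, ht, he, hS⟩ := hF t
    exact ⟨ι, _, e, V, S k, ht, he, hS k⟩
  · rcases lt_or_ge k 0 with hk | hk
    · have h0 : ∀ᶠ y in 𝓝 x, σ y = 0 := by
        filter_upwards [hσW] with y hy
        rwa [weight_of_neg hk, Submodule.mem_bot] at hy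
      rw [hflat.congr x v v σ (fun _ => 0) hv hσ (by simp) h0, hflat.apply_zero hb hv]
      exact Submodule.zero_mem _
    · obtain ⟨k, rfl⟩ := Int.eq_ofNat_of_zero_le hk
      obtain ⟨r, hr, hσr⟩ := hN.exists_lift hT k hσ hσW
      rw [hN.cokerConn_apply hT hv hr (hσr.mono fun y hy => hy.2)]
      exact cokerMk_mem_weight
        (hN.pow_apply_conn_eq_zero hT _ hx hv hr (hσr.mono fun y hy => hy.1))

lemma weight_mono (x : PLine × M) : Monotone fun k => weight H N k x := by
  intro k k' hkk
  rcases lt_or_ge k 0 with hk | hk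
  · simp only [weight_of_neg hk]; exact bot_le
  · obtain ⟨k, rfl⟩ := Int.eq_ofNat_of_zero_le hk
    obtain ⟨k', rfl⟩ := Int.eq_ofNat_of_zero_le (hk.trans hkk)
    simp only [weight_natCast]
    refine Submodule.map_mono fun a ha => ?_
    obtain ⟨m, rfl⟩ : ∃ m, k' = k + m := ⟨k' - k, by omega⟩
    rw [LinearMap.mem_ker] at ha ⊢
    rw [show k + m + 1 = m + (k + 1) by ring, pow_add, Module.End.mul_apply, ha, map_zero]

omit [FiniteDimensional ℂ E] in
lemma IsNilpotentData.exists_mem_weight (hN : IsNilpotentData H D P N) (x : PLine × M)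
    (α : (coker H N).fiber x) : ∃ k, α ∈ weight H N k x := by
  obtain ⟨a, rfl⟩ : ∃ a, cokerMk H N x a = α := Submodule.mkQ_surjective _ α
  obtain ⟨m, hm⟩ := hN.nilpotent x
  refine ⟨m, cokerMk_mem_weight ?_⟩
  rw [pow_succ', hm, mul_zero, LinearMap.zero_apply]

theorem IsNilpotentData.isFiltered (hN : IsNilpotentData H D P N) (hT : IsTrTLE H D) :
    IsFiltered (coker H N) (cokerConn D N) (weight H N) :=
  (hN.hasAdaptedFrames hT).isFiltered (hN.isFlatConn_coker hT) (hN.isFlatSub_weight hT)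
    weight_mono hN.exists_mem_weight

end Cokernel

open HolFamily

/-! ### The pairings on the graded pieces -/

section GradedClasses

variable {M : Type*} [TopologicalSpace M] {H : HolFamily (PLine × M)}
  {N : ∀ x, Module.End ℂ (H.fiber x)}

variable (H N) in
/-- The class in `Gr_k` of a vector in the kernel of `N ^ (k + 1)`. -/
def grClass (k : ℕ) (x : PLine × M) :
    LinearMap.ker (N x ^ (k + 1)) →ₗ[ℂ] (gr (coker H N) (weight H N) k).fiber x :=
  (((weight H N (k - 1) x).submoduleOf (weight H N k x)).mkQ).comp
    (((cokerMk H N x).comp (LinearMap.ker (N x ^ (k + 1))).subtype).codRestrict (weight H N k x)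
      fun a => cokerMk_mem_weight a.2)

lemma grMk_eq_grClass {k : ℕ} {x : PLine × M} {α : weight H N k x} {a : H.fiber x}
    (ha : (N x ^ (k + 1)) a = 0) (hα : (α : (coker H N).fiber x) = cokerMk H N x a) :
    grMk (weight H N) k α = grClass H N k x ⟨a, ha⟩ :=
  congrArg _ (Subtype.ext hα)

lemma grMk_surjective {W : ℤ → ∀ x, Submodule ℂ (H.fiber x)} {k : ℤ} {x : PLine × M}
    (g : (gr H W k).fiber x) : ∃ α, grMk W k α = g :=
  Submodule.mkQ_surjective _ g

lemma grClass_surjective (k : ℕ) (x : PLine × M) : Function.Surjective (grClass H N k x) := by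
  intro g
  obtain ⟨α, rfl⟩ := grMk_surjective g
  obtain ⟨α, hα⟩ := α
  have h := hα
  rw [weight_natCast] at h
  obtain ⟨a, ha, rfl⟩ := h
  exact ⟨⟨a, ha⟩, rfl⟩

/-- The class of `a` in the cokernel lies in `W_(k-1)` when `a` agrees modulo `Im N` with a vector
of `Ker N ^ k`. This explicit kernel is what both well-definedness and non-degeneracy use. -/
lemma grClass_eq_zero_iff {k : ℕ} {x : PLine × M} (a : LinearMap.ker (N x ^ (k + 1))) :
    grClass H N k x a = 0 ↔ ∃ c d, (N x ^ k) c = 0 ∧ (a : H.fiber x) = c + N x d := by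
  have h1 : grClass H N k x a = 0 ↔ cokerMk H N x a ∈ weight H N (k - 1) x :=
    Submodule.Quotient.mk_eq_zero _
  have h2 : ∀ b c : H.fiber x, cokerMk H N x b = cokerMk H N x c ↔ ∃ d, N x d = b - c :=
    fun b c => Submodule.Quotient.eq _
  rw [h1, weight]
  split_ifs with hk
  -- Here `W_(-1) = 0` by convention, which matches `Ker N ^ 0 = 0`.
  · obtain rfl : k = 0 := by omega
    rw [Submodule.mem_bot, ← map_zero (cokerMk H N x), h2]
    simp only [pow_zero, Module.End.one_apply, sub_zero]
    constructor
    · rintro ⟨d, hd⟩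
      exact ⟨0, d, rfl, hd.symm.trans (zero_add _).symm⟩
    · rintro ⟨c, d, rfl, h⟩
      exact ⟨d, by rw [h, zero_add]⟩
  · obtain ⟨k, rfl⟩ : ∃ j, k = j + 1 := ⟨k - 1, by omega⟩
    have h3 : ((k + 1 : ℕ) - 1 : ℤ).toNat + 1 = k + 1 := by omega
    rw [h3]
    constructor
    · rintro ⟨c, hc, hca⟩
      obtain ⟨d, hd⟩ := (h2 _ _).1 hca.symm
      exact ⟨c, d, hc, by rw [hd]; abel⟩
    · rintro ⟨c, d, hc, h⟩
      exact ⟨c, hc, ((h2 _ _).2 ⟨d, by rw [h]; abel⟩).symm⟩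

variable (H N) in
/-- A linear section of `grClass`. -/
def grLift (k : ℕ) (x : PLine × M) :
    (gr (coker H N) (weight H N) k).fiber x →ₗ[ℂ] LinearMap.ker (N x ^ (k + 1)) :=
  ((grClass H N k x).exists_rightInverse_of_surjective
    (LinearMap.range_eq_top.2 (grClass_surjective k x))).choose

lemma grClass_grLift (k : ℕ) (x : PLine × M) (g : (gr (coker H N) (weight H N) k).fiber x) :
    grClass H N k x (grLift H N k x g) = g :=
  LinearMap.congr_fun ((grClass H N k x).exists_rightInverse_of_surjective
    (LinearMap.range_eq_top.2 (grClass_surjective k x))).choose_spec g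

/-- The pairing `([a], [b]) ↦ P (N ^ k a, b)` on `Gr_k`. -/
def natGrPairing (P : Pairing H) (N : ∀ x, Module.End ℂ (H.fiber x)) (k : ℕ) :
    Pairing (gr (coker H N) (weight H N) k) :=
  fun x y => (P x y).compl₁₂
    ((N x ^ k).comp ((LinearMap.ker (N x ^ (k + 1))).subtype.comp (grLift H N k x)))
    ((LinearMap.ker (N y ^ (k + 1))).subtype.comp (grLift H N k y))

/-- The pairings on the graded pieces of the cokernel. -/
def grPairing (P : Pairing H) (N : ∀ x, Module.End ℂ (H.fiber x)) :
    ∀ k : ℤ, Pairing (gr (coker H N) (weight H N) k)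
  | Int.ofNat k => natGrPairing P N k
  | Int.negSucc _ => fun _ _ => 0

lemma subsingleton_gr_negSucc (m : ℕ) (x : PLine × M) :
    Subsingleton ((gr (coker H N) (weight H N) (Int.negSucc m)).fiber x) := by
  refine subsingleton_of_forall_eq 0 fun g => ?_
  obtain ⟨α, rfl⟩ := grMk_surjective g
  obtain ⟨α, hα⟩ := α
  have h := hα
  rw [weight_of_neg (Int.negSucc_lt_zero m), Submodule.mem_bot] at h
  subst h
  exact map_zero (Submodule.mkQ _)

end GradedClasses

/-! ### Well-definedness, non-degeneracy, flatness and symmetry of the pairings. -/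

section GradedPairings

variable {E : Type*} [NormedAddCommGroup E] [NormedSpace ℂ E]
  {M : Type*} [TopologicalSpace M] [ChartedSpace E M] [IsManifold 𝓘(ℂ, E) ω M]
  {H : HolFamily (PLine × M)} {D : Conn E H} {P : Pairing H} {N : ∀ x, Module.End ℂ (H.fiber x)}

/-- The second point is a variable with `y = negX x`, so that the lemma also applies to the pair
`(negX x, x)`, for which `negX (negX x) = x` is not definitional. -/
lemma IsNilpotentData.pow_selfAdjoint (hN : IsNilpotentData H D P N) (m : ℕ) {x y : PLine × M}
    (hy : y = negX x) (a : H.fiber x) (b : H.fiber y) :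
    P x y ((N x ^ m) a) b = P x y a ((N y ^ m) b) := by
  subst hy
  induction m generalizing a with
  | zero => simp
  | succ m ih =>
    rw [pow_succ, Module.End.mul_apply, ih, hN.selfAdjoint, pow_succ', Module.End.mul_apply]

/-- The pairings on the graded pieces are well defined. -/
lemma IsNilpotentData.natGrPairing_grClass (hN : IsNilpotentData H D P N) (k : ℕ)
    {x y : PLine × M} (hy : y = negX x) (a : LinearMap.ker (N x ^ (k + 1)))
    (b : LinearMap.ker (N y ^ (k + 1))) :
    natGrPairing P N k x y (grClass H N k x a) (grClass H N k y b) =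
      P x y ((N x ^ k) a) b := by
  set a' := grLift H N k x (grClass H N k x a) with ha'
  set b' := grLift H N k y (grClass H N k y b) with hb'
  change P x y ((N x ^ k) a') b' = _
  have ha : grClass H N k x (a - a') = 0 := by rw [map_sub, ha', grClass_grLift, sub_self]
  have hb : grClass H N k y (b - b') = 0 := by rw [map_sub, hb', grClass_grLift, sub_self]
  obtain ⟨c, d, hc, hd⟩ := (grClass_eq_zero_iff _).1 ha
  obtain ⟨c', d', hc', hd'⟩ := (grClass_eq_zero_iff _).1 hb
  -- The `Ker N ^ k` part is killed by `N ^ k`; for the other part `N ^ (k+1)` passes to `b'`, which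
  -- it annihilates.
  have h1 : P x y ((N x ^ k) (a - a' : H.fiber x)) b' = 0 := by
    have h2 : (a : H.fiber x) - a' = c + N x d := hd
    rw [h2, map_add, hc, zero_add, ← Module.End.mul_apply, ← pow_succ,
      hN.pow_selfAdjoint _ hy, b'.2, map_zero]
  -- Symmetrically, `N ^ k` passes to the `Ker N ^ k` part of `b - b'`, and the `N` of its image
  -- part passes to `N ^ k a`.
  have h3 : P x y ((N x ^ k) a) (b - b' : H.fiber y) = 0 := by
    have h2 : (b : H.fiber y) - b' = c' + N y d' := hd'
    have h4 : P x y ((N x ^ k) a) (N y d') = 0 := by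
      rw [← pow_one (N y), ← hN.pow_selfAdjoint 1 hy, ← Module.End.mul_apply, ← pow_add,
        add_comm, a.2, map_zero, LinearMap.zero_apply]
    rw [h2, map_add, h4, hN.pow_selfAdjoint _ hy, hc', map_zero, add_zero]
  rw [map_sub, map_sub, LinearMap.sub_apply, sub_eq_zero] at h1
  rw [map_sub, sub_eq_zero] at h3
  rw [h3, h1]

/-- Non-degeneracy of the pairings on the graded pieces. -/
lemma IsNilpotentData.natGrPairing_bijective (hN : IsNilpotentData H D P N)
    (hP : ∀ x, Function.Bijective (P x (negX x))) (k : ℕ) (x : PLine × M) :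
    Function.Bijective (natGrPairing P N k x (negX x)) := by
  set y := negX x with hy
  -- a vector orthogonal to the kernel of `N ^ m` is in the image of `N ^ m`
  have horth : ∀ m (z : H.fiber x), (∀ b, (N y ^ m) b = 0 → P x y z b = 0) →
      ∃ d, (N x ^ m) d = z := by
    intro m z hz
    obtain ⟨ψ, hψ⟩ : ∃ ψ : H.fiber y →ₗ[ℂ] ℂ, ψ.comp (N y ^ m) = P x y z := by
      have h := LinearMap.range_dualMap_eq_dualAnnihilator_ker (N y ^ m)
      have hz' : P x y z ∈ (LinearMap.ker (N y ^ m)).dualAnnihilator :=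
        (Submodule.mem_dualAnnihilator _).2 hz
      rw [← h] at hz'
      exact hz'
    obtain ⟨d, rfl⟩ := (hP x).2 ψ
    refine ⟨d, (hP x).1 (LinearMap.ext fun b => ?_)⟩
    rw [hN.pow_selfAdjoint m hy]
    exact LinearMap.congr_fun hψ b
  constructor
  · rw [injective_iff_map_eq_zero]
    intro g hg
    obtain ⟨a, rfl⟩ := grClass_surjective k x g
    -- If `[a]` pairs to zero with everything, then `N ^ k a = N ^ (k+1) d`. So `a - N d` lies in
    -- `Ker N ^ k`, and `[a] = 0`.
    obtain ⟨d, hd⟩ := horth (k + 1) ((N x ^ k) a) fun b hb => by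
      rw [← hN.natGrPairing_grClass k hy a ⟨b, hb⟩, hg, LinearMap.zero_apply]
    refine (grClass_eq_zero_iff _).2 ⟨a - N x d, d, ?_, by abel⟩
    rw [map_sub, ← Module.End.mul_apply, ← pow_succ, hd, sub_self]
  · intro ψ
    -- The functional is pulled back to `W_k`, extended to the cokernel and then represented by a
    -- vector `z`. Factoring through the cokernel forces `N z = 0`, and vanishing on `Ker N ^ k`
    -- forces `z = N ^ k a`; hence `a` lies in `Ker N ^ (k+1)`.
    obtain ⟨ψ', hψ'⟩ :=
      (ψ.comp ((weight H N (k - 1) y).submoduleOf (weight H N k y)).mkQ).exists_extend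
    obtain ⟨z, hz⟩ := (hP x).2 (ψ'.comp (cokerMk H N y))
    have hzψ : ∀ b : LinearMap.ker (N y ^ (k + 1)), P x y z b = ψ (grClass H N k y b) := by
      intro b
      rw [hz]
      exact LinearMap.congr_fun hψ' ⟨_, cokerMk_mem_weight b.2⟩
    have hNz : N x z = 0 := by
      refine (hP x).1 (LinearMap.ext fun b => ?_)
      rw [hN.selfAdjoint, hz, map_zero, LinearMap.zero_apply, LinearMap.comp_apply]
      have : cokerMk H N y (N y b) = 0 := (Submodule.Quotient.mk_eq_zero _).2 ⟨b, rfl⟩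
      rw [this, map_zero]
    obtain ⟨a, ha⟩ := horth k z fun b hb => by
      have hb' : (N y ^ (k + 1)) b = 0 := by rw [pow_succ', Module.End.mul_apply, hb, map_zero]
      rw [hzψ ⟨b, hb'⟩, (grClass_eq_zero_iff _).2 ⟨b, 0, hb, by simp⟩, map_zero]
    refine ⟨grClass H N k x ⟨a, ?_⟩, LinearMap.ext fun h => ?_⟩
    · rw [LinearMap.mem_ker, pow_succ', Module.End.mul_apply, ha, hNz]
    · obtain ⟨b, rfl⟩ := grClass_surjective k y h
      rw [hN.natGrPairing_grClass k hy, ← hzψ, ha]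

omit [IsManifold 𝓘(ℂ, E) ω M] in
/-- The derivative of `λ ^ m f`. -/
lemma applyField_lam_zpow_mul {x : PLine × M} (hx : x ∈ regular M) (v : VField E M) (m : ℤ)
    {f : PLine × M → ℂ} (hf : HolFunAt E f x) :
    applyField v (fun y => lam y.1 ^ m * f y) x =
      m * dlog v x * (lam x.1 ^ m * f x) + lam x.1 ^ m * applyField v f x := by
  have hlam := lam_ne_zero hx.1 hx.2
  have h1 : HasMFDerivAt (model E) 𝓘(ℂ, ℂ) (fun y : PLine × M => lam y.1) x _ :=
    (holFunAt_lam hx.2).mdifferentiableAt.hasMFDerivAt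
  have h2 : HasMFDerivAt 𝓘(ℂ, ℂ) 𝓘(ℂ, ℂ) (fun z : ℂ => z ^ m) (lam x.1) _ :=
    (hasDerivAt_zpow m (lam x.1) (Or.inl hlam)).hasFDerivAt.hasMFDerivAt
  have h3 := h2.comp x h1
  have h4 := h3.mul hf.mdifferentiableAt.hasMFDerivAt
  have h5 : applyField v (fun y => lam y.1 ^ m * f y) x =
      lam x.1 ^ m * applyField v f x +
        f x * (applyField v (fun y => lam y.1) x * (m * lam x.1 ^ (m - 1))) :=
    congrArg (fun L => L (v x)) h4.mfderiv
  rw [h5, dlog, zpow_sub_one₀ hlam]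
  field_simp
  ring

variable [FiniteDimensional ℂ E]

/-- Holomorphic sections of `Gr_k` locally lift to holomorphic sections of `Ker N ^ (k+1)`. -/
lemma IsNilpotentData.exists_lift_gr (hN : IsNilpotentData H D P N) (hT : IsTrTLE H D) (k : ℕ)
    {x : PLine × M} {τ : (gr (coker H N) (weight H N) k).Sec}
    (hτ : (gr (coker H N) (weight H N) k).HolAt τ x) :
    ∃ r : H.Sec, H.HolAt r x ∧ ∀ᶠ y in 𝓝 x, ∃ h : (N y ^ (k + 1)) (r y) = 0,
      τ y = grClass H N k y ⟨r y, h⟩ := by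
  obtain ⟨σ, hσ, hτσ⟩ := hτ
  obtain ⟨r, hr, hσr⟩ := hN.exists_lift hT k (σ := fun y => incl (weight H N k) y (σ y)) hσ
    (Eventually.of_forall fun y => incl_mem (σ y))
  refine ⟨r, hr, ?_⟩
  filter_upwards [hσr, hτσ] with y h1 h2
  refine ⟨h1.1, ?_⟩
  rw [← grMk_eq_grClass (α := σ y) h1.1 h1.2]
  exact h2

/-- The connection on `Gr_k` is computed on lifts to `Ker N ^ (k+1)`. Regular points suffice, since
flatness of a pairing is tested only there. -/
lemma IsNilpotentData.grConn_apply (hN : IsNilpotentData H D P N) (hT : IsTrTLE H D) (k : ℕ)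
    {x : PLine × M} (hx : x ∈ regular M) {v : VField E M} (hv : PoleFieldAt v x)
    {τ : (gr (coker H N) (weight H N) k).Sec} {r : H.Sec} (hr : H.HolAt r x)
    (hτ : ∀ᶠ y in 𝓝 x, ∃ h : (N y ^ (k + 1)) (r y) = 0, τ y = grClass H N k y ⟨r y, h⟩) :
    ∃ h : (N x ^ (k + 1)) (D v r x) = 0,
      grConn (cokerConn D N) (weight H N) k v τ x = grClass H N k x ⟨D v r x, h⟩ := by
  have h0 := hN.pow_apply_conn_eq_zero hT (k + 1) hx hv hr (hτ.mono fun y hy => hy.1)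
  refine ⟨h0, ?_⟩
  have hF := hN.hasAdaptedFrames hT
  have hb := hF.isTrivialAlong.isBundle
  have hflat := hN.isFlatConn_coker hT
  have hW := hN.isFlatSub_weight hT
  set σ : ((coker H N).sub (weight H N k)).Sec :=
    toSub (weight H N k) fun y => cokerMk H N y (r y) with hσ
  have hσr : ∀ᶠ y in 𝓝 x, incl (weight H N k) y (σ y) = cokerMk H N y (r y) := by
    filter_upwards [hτ] with y hy
    exact incl_toSub (cokerMk_mem_weight hy.1)
  have hr' : (coker H N).HolAt (fun y => cokerMk H N y (r y)) x :=
    ⟨r, hr, Eventually.of_forall fun y => rfl⟩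
  have hσh : ((coker H N).sub (weight H N k)).HolAt σ x :=
    hb.holAt_congr hr' (hσr.mono fun y hy => hy.symm)
  have h1 := quotConn_apply (hflat.sub hb (hW k)) (hF.isBundle_sub k) (isFlatSub_submoduleOf hW k)
    (σ := τ) hv hσh (by
      filter_upwards [hτ, hσr] with y h2 h3
      obtain ⟨h2, h4⟩ := h2
      rw [h4]
      exact (grMk_eq_grClass (α := σ y) h2 h3).symm)
  refine h1.trans (congrArg _ (incl_injective ?_))
  rw [incl_subConn (hW k) hv hσh]
  exact hN.cokerConn_apply hT hv hr hσr

/-- The graded pieces of non-negative weight. -/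
theorem IsNilpotentData.isTrTLEP_natGrPairing (hN : IsNilpotentData H D P N)
    (hT : IsTrTLEP 0 H D P) (k : ℕ) :
    IsTrTLEP (-k) (gr (coker H N) (weight H N) k) (grConn (cokerConn D N) (weight H N) k)
      (natGrPairing P N k) where
  trTLE := isTrTLE_grConn (hN.isFlatConn_coker hT.trTLE)
    (hN.hasAdaptedFrames hT.trTLE).isTrivialAlong.isBundle (hN.hasAdaptedFrames hT.trTLE)
    (hN.isFlatSub_weight hT.trTLE) k
  hol x a b ha hb := by
    obtain ⟨r, hr, har⟩ := hN.exists_lift_gr hT.trTLE k ha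
    obtain ⟨s, hs, hbs⟩ := hN.exists_lift_gr hT.trTLE k hb
    refine (hT.hol x _ s (hN.holAt_pow k hr) hs).congr ?_
    filter_upwards [har, continuous_negX.continuousAt.eventually hbs] with y h1 h2
    obtain ⟨h1, h3⟩ := h1
    obtain ⟨h2, h4⟩ := h2
    rw [h3, h4, hN.natGrPairing_grClass k rfl]
  flat x v w a b hx0 hx1 hv hw hvw ha hb := by
    have hx : x ∈ regular M := ⟨hx0, hx1⟩
    obtain ⟨r, hr, har⟩ := hN.exists_lift_gr hT.trTLE k ha
    obtain ⟨s, hs, hbs⟩ := hN.exists_lift_gr hT.trTLE k hb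
    obtain ⟨hr1, hr2⟩ := hN.grConn_apply hT.trTLE k hx hv hr har
    obtain ⟨hs1, hs2⟩ := hN.grConn_apply hT.trTLE k
      (x := negX x) ⟨negP_ne_zero hx0, negP_ne_infty hx1⟩ hw hs hbs
    have hF := hT.hol x _ s (hN.holAt_pow k hr) hs
    have h1 := hT.flat x v w _ s hx0 hx1 hv hw hvw (hN.holAt_pow k hr) hs
    simp only [Pairing.val, zpow_zero, one_mul] at h1
    have h2 : (fun y => Pairing.val (natGrPairing P N k) (-k) y (negX y) (a y) (b (negX y))) =ᶠ[𝓝 x]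
        fun y => lam y.1 ^ (-k : ℤ) * P y (negX y) ((N y ^ k) (r y)) (s (negX y)) := by
      filter_upwards [har, continuous_negX.continuousAt.eventually hbs] with y h3 h4
      obtain ⟨h3, h5⟩ := h3
      obtain ⟨h4, h6⟩ := h4
      rw [Pairing.val, h5, h6, hN.natGrPairing_grClass k rfl]
    have h3 : applyField v
        (fun y => Pairing.val (natGrPairing P N k) (-k) y (negX y) (a y) (b (negX y))) x =
        applyField v
          (fun y => lam y.1 ^ (-k : ℤ) * P y (negX y) ((N y ^ k) (r y)) (s (negX y))) x := by
      rw [applyField, applyField, h2.mfderiv_eq]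
      rfl
    obtain ⟨har1, har2⟩ := har.self_of_nhds
    obtain ⟨hbs1, hbs2⟩ := hbs.self_of_nhds
    -- The derivative of `λ ^ (-k)` contributes `-k dlog v`, and commuting `D v` past `N ^ k`
    -- contributes `k dlog v`; these cancel.
    rw [h3, applyField_lam_zpow_mul hx v _ hF, h1, hN.apply_pow k hx hv hr, Pairing.val,
      Pairing.val, hr2, hs2, har2, hbs2, hN.natGrPairing_grClass k rfl,
      hN.natGrPairing_grClass k rfl, map_add, map_smul, LinearMap.add_apply, LinearMap.smul_apply,
      smul_eq_mul]
    push_cast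
    ring
  symm x y hy hx0 hx1 a b := by
    subst hy
    obtain ⟨a, rfl⟩ := grClass_surjective k x a
    obtain ⟨b, rfl⟩ := grClass_surjective k (negX x) b
    have h1 := hT.symm x (negX x) rfl hx0 hx1 a ((N _ ^ k) b)
    simp only [Pairing.val, zpow_zero, one_mul] at h1
    rw [Pairing.val, Pairing.val, hN.natGrPairing_grClass k (negX_negX x).symm,
      hN.natGrPairing_grClass k rfl, h1, ← hN.pow_selfAdjoint k rfl]
    -- `P` is symmetric in weight 0 and `N ^ k` is self-adjoint, so the sign comes entirely from
    -- `(-λ) ^ (-k)`.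
    have h2 : lam (negX x).1 = -1 * lam x.1 := by
      rw [neg_one_mul]; exact lam_negP hx1
    rw [h2, mul_zpow, mul_assoc]
  nondegenerate x := hN.natGrPairing_bijective hT.nondegenerate k x

/-- The graded pieces of negative weight, which are zero. -/
theorem IsNilpotentData.isTrTLEP_negSucc (hN : IsNilpotentData H D P N)
    (hT : IsTrTLEP 0 H D P) (m : ℕ) :
    IsTrTLEP (-Int.negSucc m) (gr (coker H N) (weight H N) (Int.negSucc m))
      (grConn (cokerConn D N) (weight H N) (Int.negSucc m)) (fun _ _ => 0) where
  trTLE := isTrTLE_grConn (hN.isFlatConn_coker hT.trTLE)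
    (hN.hasAdaptedFrames hT.trTLE).isTrivialAlong.isBundle (hN.hasAdaptedFrames hT.trTLE)
    (hN.isFlatSub_weight hT.trTLE) _
  hol x a b ha hb := holFunAt_const 0 x
  flat x v w a b hx0 hx1 hv hw hvw ha hb := by
    have h1 : ∀ (y z : PLine × M) a b, Pairing.val (H := gr (coker H N) (weight H N)
        (Int.negSucc m)) (fun _ _ => 0) (-Int.negSucc m) y z a b = 0 := fun y z a b => by
      simp [Pairing.val]
    have h2 : applyField v (fun _ => (0 : ℂ)) x = 0 := by
      rw [applyField, mfderiv_const]; rfl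
    simp only [h1, h2, add_zero]
  symm x y hy hx0 hx1 a b := by simp [Pairing.val]
  nondegenerate x := by
    have h1 := subsingleton_gr_negSucc (N := N) m x
    have h2 := subsingleton_gr_negSucc (N := N) m (negX x)
    refine ⟨fun a b _ => Subsingleton.elim a b, fun f => ⟨0, LinearMap.ext fun b => ?_⟩⟩
    rw [Subsingleton.elim b 0, map_zero, map_zero]

theorem IsNilpotentData.isMixed (hN : IsNilpotentData H D P N) (hT : IsTrTLEP 0 H D P) :
    IsMixed (coker H N) (cokerConn D N) (weight H N) (grPairing P N) where
  filtered := hN.isFiltered hT.trTLE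
  graded k := by
    refine ⟨grConn (cokerConn D N) (weight H N) k,
      inducedOnGr_grConn (hN.isFlatConn_coker hT.trTLE)
        (hN.hasAdaptedFrames hT.trTLE).isTrivialAlong.isBundle (hN.hasAdaptedFrames hT.trTLE)
        (hN.isFlatSub_weight hT.trTLE) k, ?_⟩
    cases k with
    | ofNat k => exact hN.isTrTLEP_natGrPairing hT k
    | negSucc m => exact hN.isTrTLEP_negSucc hT m

end GradedPairings

end TrTLE

end

theorem mainTheorem9 {E : Type*} [NormedAddCommGroup E] [NormedSpace ℂ E] [FiniteDimensional ℂ E]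
    {M : Type*} [TopologicalSpace M] [ChartedSpace E M] [IsManifold 𝓘(ℂ, E) ω M]
    (H : TrTLE.HolFamily (TrTLE.PLine × M)) (D : TrTLE.Conn E H) (P : TrTLE.Pairing H)
    (hT : TrTLE.IsTrTLEP 0 H D P)
    (N : ∀ x, Module.End ℂ (H.fiber x)) (hN : TrTLE.IsNilpotentData H D P N) :
    -- a holomorphic section with values in the fibrewise image of `N` is locally `N` of a
    -- holomorphic section, so the family of fibrewise cokernels is the cokernel as a sheaf
    (∀ (x : TrTLE.PLine × M) (s : H.Sec), H.HolAt s x →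
      (∀ᶠ y in 𝓝 x, s y ∈ LinearMap.range (N y)) →
      ∃ r : H.Sec, H.HolAt r x ∧ ∀ᶠ y in 𝓝 x, s y = N y (r y)) ∧
    -- likewise, `W_k` is the image of `Ker N^(k+1)` as a sheaf
    (∀ (k : ℕ) (x : TrTLE.PLine × M) (s : H.Sec), H.HolAt s x →
      (∀ᶠ y in 𝓝 x, TrTLE.cokerMk H N y (s y) ∈ TrTLE.weight H N k y) →
      ∃ r : H.Sec, H.HolAt r x ∧ ∀ᶠ y in 𝓝 x,
        (N y ^ (k + 1)) (r y) = 0 ∧ TrTLE.cokerMk H N y (s y) = TrTLE.cokerMk H N y (r y)) ∧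
    -- the connection descends, the pairings are well defined, and the result is mixed trTLEP
    ∃ (D' : TrTLE.Conn E (TrTLE.coker H N))
      (B : ∀ k : ℤ, TrTLE.Pairing (TrTLE.gr (TrTLE.coker H N) (TrTLE.weight H N) k)),
      TrTLE.InducedOnQuot H D (fun x => LinearMap.range (N x)) D' ∧
      -- `Q_k = λ^(-k) B_k` with `B_k ([a], [b]) = P (N^k a, b)` for `k ≥ 0`
      (∀ (k : ℕ) (x : TrTLE.PLine × M) (a : H.fiber x) (b : H.fiber (TrTLE.negX x))
        (α : TrTLE.weight H N k x) (β : TrTLE.weight H N k (TrTLE.negX x)),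
        (N x ^ (k + 1)) a = 0 → (N (TrTLE.negX x) ^ (k + 1)) b = 0 →
        (α : (TrTLE.coker H N).fiber x) = TrTLE.cokerMk H N x a →
        (β : (TrTLE.coker H N).fiber (TrTLE.negX x)) = TrTLE.cokerMk H N (TrTLE.negX x) b →
        B k x (TrTLE.negX x) (TrTLE.grMk (TrTLE.weight H N) k α)
          (TrTLE.grMk (TrTLE.weight H N) k β) = P x (TrTLE.negX x) ((N x ^ k) a) b) ∧
      -- `Q_k = 0` for `k < 0`
      (∀ k : ℤ, k < 0 → ∀ x, B k x (TrTLE.negX x) = 0) ∧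
      TrTLE.IsMixed (TrTLE.coker H N) D' (TrTLE.weight H N) B := by
  refine ⟨fun x s hs hsN => hN.exists_preimage hT.trTLE hs hsN,
    fun k x s hs hsW => hN.exists_lift_weight hT.trTLE k hs hsW,
    TrTLE.cokerConn D N, TrTLE.grPairing P N, fun x v s hv hs => ?_, fun k x a b α β ha hb hα hβ => ?_,
    fun k hk x => ?_, hN.isMixed hT⟩
  · exact hN.cokerConn_apply hT.trTLE hv hs (Eventually.of_forall fun y => rfl)
  · rw [TrTLE.grMk_eq_grClass ha hα, TrTLE.grMk_eq_grClass hb hβ]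
    exact hN.natGrPairing_grClass k rfl _ _
  · cases k with
    | ofNat k => exact absurd hk (not_lt.2 (Int.natCast_nonneg k))
    | negSucc m => rfl
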